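/- **Setting.** A temporal graph $\mathcal G=(V,E_1,\dots,E_T)$ consists of a finite vertex set $V$ and $T\ge 1$ edge sets; its layers are $G_i=(V,E_i)$. Let $\mathcal G=(V,E_1,\dots,E_T)$ and $\mathcal H=(W,F_1,\dots,F_U)$ be temporal graphs, with arbitrary vertex signatures $f_{G_i}\colon V\to\mathbb Q^k$, $f_{H_j}\colon W\to\mathbb Q^k$, arbitrary deletion costs $\Delta_{G_i}(u),\Delta_{H_j}(v)\in\mathbb Q$, and an arbitrary metric $d\colon\mathbb Q^k\times\mathbb Q^k\to\mathbb Q$. A vertex mapping is a set $M\subseteq V\times W$ of $\min(|V|,|W|)$ pairs in which every vertex of $V$ and every vertex of $W$ occurs at most once ($V$ and $W$ are regarded as disjoint), and $$C(G_i,H_j,M)=\sum_{(u,v)\in M}d(f_{G_i}(u),f_{H_j}(v))+\sum_{u\in V\text{ unmatched}}\Delta_{G_i}(u)+\sum_{v\in W\text{ unmatched}}\Delta_{H_j}(v).$$ A warping path of order $T\times U$ and length $L$ is a set $\{p_1,\dots,p_L\}$ with $p_1=(1,1)$, $p_L=(T,U)$ and $p_{\ell+1}-p_\ell\in\{(1,1),(0,1),(1,0)\}$.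 For $\lambda\in\mathbb N$ let $\mathrm{dtgw}_\lambda(\mathcal G,\mathcal H)$ be the minimum of $\sum_{(i,j)\in p}C(G_i,H_j,M)$ over all vertex mappings $M$ and all warping paths $p$ of order $T\times U$ and length at most $T+\lambda$. The problem DTGW (with restricted path length) asks, given $\mathcal G$, $\mathcal H$, $\lambda$ and $c\in\mathbb Q$, whether $\mathrm{dtgw}_\lambda(\mathcal G,\mathcal H)\le c$. The signature distances $d(f_{G_i}(u),f_{H_j}(v))$ and the deletion costs are precomputed and can be looked up; the computational model is a random access machine that adds, subtracts and compares natural numbers and rational numbers (without multiplication), has indirectly addressed memory, and performs each such operation, lookup or comparison in one step. The logarithmic cost of a step is the total encoding length of the numbers involved in it. **Theorem.** Let $n=\max(|V|,|W|)\ge 1$ and $T=U+t$ with $t\ge 0$. For all vertex signatures, deletion costs and metrics, DTGW restricted to warping paths of length at most $T+\lambda$ is solvable in $$\mathcal O\bigl((T+\lambda)^{\lambda}\cdot T^{\lambda+t}\cdot(n^2(T+\lambda)+n^3)\bigr)$$ steps, by one program and with an absolute constant. This program moreover witnesses membership in XP for the parameter $(\lambda,t)$: its total logarithmic cost is at most $|x|^{f(\lambda,t)}$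 for some function $f\colon\mathbb N^2\to\mathbb N$, where $|x|$ is $T+U+|V|+|W|$ plus the total encoding length of $c$, of all signature distances and of all deletion costs. Finally, the number of warping paths of order $T\times U$ of length at most $T+\lambda$ is $$\sum_{l=0}^{\lambda}\binom{T+l-1}{l}\binom{T-1}{l+t}.$$ -/

import Mathlib

namespace DTGW

/-! ## Temporal graphs, vertex mappings, warping paths -/

/-- A temporal graph on the vertex set `V` with lifetime `T ≥ 1`.
Layers are indexed by `0, …, T - 1`. -/
structure TemporalGraph (V : Type*) (T : ℕ) where
  layer : Fin T → SimpleGraph V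
  lifetime_pos : 1 ≤ T

/-- A temporal graph together with, for each layer `G i`, an arbitrary vertex signature function
`sig i : V → ℚ^k` and arbitrary vertex deletion costs `del i : V → ℚ`. -/
structure SignedTemporalGraph (V : Type*) (T k : ℕ) extends TemporalGraph V T where
  sig : Fin T → V → (Fin k → ℚ)
  del : Fin T → V → ℚ

/-- A rational-valued metric on `ℚ^k` (nonnegativity follows from these axioms). -/
structure IsMetric {k : ℕ} (d : (Fin k → ℚ) → (Fin k → ℚ) → ℚ) : Prop where
  eq_zero_iff : ∀ a b, d a b = 0 ↔ a = b
  symm : ∀ a b, d a b = d b a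
  triangle : ∀ a b c, d a c ≤ d a b + d b c

/-- A vertex mapping between `V` and `W`: a set of `min |V| |W|` pairs such that every vertex
occurs in at most one of them. -/
def IsVertexMapping {V W : Type*} [Fintype V] [Fintype W] (M : Finset (V × W)) : Prop :=
  M.card = min (Fintype.card V) (Fintype.card W) ∧
  (∀ a ∈ M, ∀ b ∈ M, a.1 = b.1 → a = b) ∧
  (∀ a ∈ M, ∀ b ∈ M, a.2 = b.2 → a = b)

open Classical in
/-- The set of all vertex mappings between `V` and `W`. -/
noncomputable def vertexMappings (V W : Type*) [Fintype V] [Fintype W] :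
    Finset (Finset (V × W)) :=
  Finset.univ.filter IsVertexMapping

/-- Admissible consecutive pairs of a warping path. -/
def IsWarpingStep {T U : ℕ} (a b : Fin T × Fin U) : Prop :=
  (b.1.val = a.1.val + 1 ∧ b.2.val = a.2.val + 1) ∨
  (b.1.val = a.1.val ∧ b.2.val = a.2.val + 1) ∨
  (b.1.val = a.1.val + 1 ∧ b.2.val = a.2.val)

/-- A warping path of order `T × U`: a set of pairs that can be listed from the pair of the two
first indices to the pair of the two last indices by admissible steps. (The listed pairs are
automatically distinct, so the length of the path is the cardinality of the set.) -/
def IsWarpingPath {T U : ℕ} (p : Finset (Fin T × Fin U)) : Prop :=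
  ∃ l : List (Fin T × Fin U), l.toFinset = p ∧
    (∃ a ∈ l.head?, a.1.val = 0 ∧ a.2.val = 0) ∧
    (∃ b ∈ l.getLast?, b.1.val + 1 = T ∧ b.2.val + 1 = U) ∧
    l.IsChain IsWarpingStep

open Classical in
/-- The set of all warping paths of order `T × U` of length at most `L`. -/
noncomputable def warpingPaths (T U L : ℕ) : Finset (Finset (Fin T × Fin U)) :=
  Finset.univ.filter fun p => IsWarpingPath p ∧ p.card ≤ L

/-! ## The distance -/

section Distance

variable {V W : Type*} [Fintype V] [Fintype W] [DecidableEq V] [DecidableEq W] {T U k : ℕ}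

/-- The cost `C(G_i, H_j, M)` of the vertex mapping `M` between layer `i` of `G` and layer `j`
of `H`. -/
def layerCost (d : (Fin k → ℚ) → (Fin k → ℚ) → ℚ) (G : SignedTemporalGraph V T k)
    (H : SignedTemporalGraph W U k) (M : Finset (V × W)) (i : Fin T) (j : Fin U) : ℚ :=
  ∑ a ∈ M, d (G.sig i a.1) (H.sig j a.2)
    + ∑ u ∈ Finset.univ \ M.image Prod.fst, G.del i u
    + ∑ v ∈ Finset.univ \ M.image Prod.snd, H.del j v

/-- The dtgw-distance with respect to warping paths of length at most `L`: the minimum over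
all vertex mappings and all such warping paths (`⊤` if there is no such path). -/
noncomputable def boundedDtgw (d : (Fin k → ℚ) → (Fin k → ℚ) → ℚ)
    (G : SignedTemporalGraph V T k) (H : SignedTemporalGraph W U k) (L : ℕ) : WithTop ℚ :=
  (vertexMappings V W).inf fun M =>
    (warpingPaths T U L).inf fun p =>
      ((∑ a ∈ p, layerCost d G H M a.1 a.2 : ℚ) : WithTop ℚ)

end Distance

/-! ## A random access machine over the naturals and the rationals

The machine has finitely many (in each program) natural-number and rational registers, an
unbounded natural-number memory and an unbounded rational memory, both indirectly addressed.
It can add, subtract and compare, and it can query the precomputed values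
`d(f_{G_i}(u), f_{H_j}(v))` and the deletion costs. There is no multiplication. Programs are built
from instructions by sequencing, branching and loops. -/

/-- The tables of precomputed values that a program may query. -/
structure Tables where
  dist : ℕ → ℕ → ℕ → ℕ → ℚ
  delG : ℕ → ℕ → ℚ
  delH : ℕ → ℕ → ℚ

structure State where
  nreg : ℕ → ℕ
  qreg : ℕ → ℚ
  nmem : ℕ → ℕ
  qmem : ℕ → ℚ

/-- Elementary instructions; all arguments except the literal `v` of `const` are register names. -/
inductive Instr where
  /-- do nothing -/
  | nop
  /-- `nreg x := v` -/
  | const (x v : ℕ)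
  /-- `nreg x := nreg y + nreg z` -/
  | add (x y z : ℕ)
  /-- `nreg x := nreg y - nreg z` (truncated) -/
  | sub (x y z : ℕ)
  /-- `nreg x := nmem (nreg y)` -/
  | load (x y : ℕ)
  /-- `nmem (nreg x) := nreg y` -/
  | store (x y : ℕ)
  /-- `qreg x := qreg y + qreg z` -/
  | qadd (x y z : ℕ)
  /-- `qreg x := qreg y - qreg z` -/
  | qsub (x y z : ℕ)
  /-- `qreg x := qmem (nreg y)` -/
  | qload (x y : ℕ)
  /-- `qmem (nreg x) := qreg y` -/
  | qstore (x y : ℕ)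
  /-- `qreg x :=` the signature distance for layers `nreg i`, `nreg j` and vertices `nreg u`,
  `nreg v` -/
  | dist (x i j u v : ℕ)
  /-- `qreg x :=` the cost of deleting vertex `nreg u` from layer `nreg i` of the first graph -/
  | delG (x i u : ℕ)
  /-- `qreg x :=` the cost of deleting vertex `nreg v` from layer `nreg j` of the second graph -/
  | delH (x j v : ℕ)

/-- The effect of an instruction. -/
def Instr.run (E : Tables) : Instr → State → State
  | .nop, s => s
  | .const x v, s => { s with nreg := Function.update s.nreg x v }
  | .add x y z, s => { s with nreg := Function.update s.nreg x (s.nreg y + s.nreg z) }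
  | .sub x y z, s => { s with nreg := Function.update s.nreg x (s.nreg y - s.nreg z) }
  | .load x y, s => { s with nreg := Function.update s.nreg x (s.nmem (s.nreg y)) }
  | .store x y, s => { s with nmem := Function.update s.nmem (s.nreg x) (s.nreg y) }
  | .qadd x y z, s => { s with qreg := Function.update s.qreg x (s.qreg y + s.qreg z) }
  | .qsub x y z, s => { s with qreg := Function.update s.qreg x (s.qreg y - s.qreg z) }
  | .qload x y, s => { s with qreg := Function.update s.qreg x (s.qmem (s.nreg y)) }
  | .qstore x y, s => { s with qmem := Function.update s.qmem (s.nreg x) (s.qreg y) }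
  | .dist x i j u v, s =>
      let q := E.dist (s.nreg i) (s.nreg j) (s.nreg u) (s.nreg v)
      { s with qreg := Function.update s.qreg x q }
  | .delG x i u, s =>
      { s with qreg := Function.update s.qreg x (E.delG (s.nreg i) (s.nreg u)) }
  | .delH x j v, s =>
      { s with qreg := Function.update s.qreg x (E.delH (s.nreg j) (s.nreg v)) }

/-- Encoding length of a natural number. -/
def natSize (a : ℕ) : ℕ := a.size + 1

/-- Encoding length of a rational number. -/
def ratSize (q : ℚ) : ℕ := q.num.natAbs.size + q.den.size + 1

/-- The logarithmic cost of an instruction: the total encoding length of all operands, addresses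
and results. -/
def Instr.bits (E : Tables) : Instr → State → ℕ
  | .nop, _ => 1
  | .const _ v, _ => natSize v
  | .add _ y z, s => natSize (s.nreg y) + natSize (s.nreg z) + natSize (s.nreg y + s.nreg z)
  | .sub _ y z, s => natSize (s.nreg y) + natSize (s.nreg z) + natSize (s.nreg y - s.nreg z)
  | .load _ y, s => natSize (s.nreg y) + natSize (s.nmem (s.nreg y))
  | .store x y, s => natSize (s.nreg x) + natSize (s.nreg y)
  | .qadd _ y z, s => ratSize (s.qreg y) + ratSize (s.qreg z) + ratSize (s.qreg y + s.qreg z)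
  | .qsub _ y z, s => ratSize (s.qreg y) + ratSize (s.qreg z) + ratSize (s.qreg y - s.qreg z)
  | .qload _ y, s => natSize (s.nreg y) + ratSize (s.qmem (s.nreg y))
  | .qstore x y, s => natSize (s.nreg x) + ratSize (s.qreg y)
  | .dist _ i j u v, s =>
      natSize (s.nreg i) + natSize (s.nreg j) + natSize (s.nreg u) + natSize (s.nreg v)
        + ratSize (E.dist (s.nreg i) (s.nreg j) (s.nreg u) (s.nreg v))
  | .delG _ i u, s =>
      natSize (s.nreg i) + natSize (s.nreg u) + ratSize (E.delG (s.nreg i) (s.nreg u))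
  | .delH _ j v, s =>
      natSize (s.nreg j) + natSize (s.nreg v) + ratSize (E.delH (s.nreg j) (s.nreg v))

/-- Comparisons of two registers. -/
inductive Test where
  | natLt (x y : ℕ)
  | natEq (x y : ℕ)
  | ratLt (x y : ℕ)
  | ratLe (x y : ℕ)

def Test.holds : Test → State → Prop
  | .natLt x y, s => s.nreg x < s.nreg y
  | .natEq x y, s => s.nreg x = s.nreg y
  | .ratLt x y, s => s.qreg x < s.qreg y
  | .ratLe x y, s => s.qreg x ≤ s.qreg y

/-- The logarithmic cost of a comparison. -/
def Test.bits : Test → State → ℕ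
  | .natLt x y, s => natSize (s.nreg x) + natSize (s.nreg y)
  | .natEq x y, s => natSize (s.nreg x) + natSize (s.nreg y)
  | .ratLt x y, s => ratSize (s.qreg x) + ratSize (s.qreg y)
  | .ratLe x y, s => ratSize (s.qreg x) + ratSize (s.qreg y)

inductive Program where
  | instr (a : Instr)
  | seq (P Q : Program)
  | ite (b : Test) (P Q : Program)
  | loop (b : Test) (P : Program)

/-- `Exec E P s m B s'`: started in state `s`, the program `P` halts in state `s'` after `m` steps
(every executed instruction and every evaluated comparison is one step), and the sum of the
logarithmic costs of these steps is `B`. `loop b P` repeats `P` while `b` holds. -/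
inductive Exec (E : Tables) : Program → State → ℕ → ℕ → State → Prop where
  | instr (a : Instr) (s : State) : Exec E (.instr a) s 1 (a.bits E s) (a.run E s)
  | seq {P Q : Program} {s₁ s₂ s₃ : State} {m₁ m₂ B₁ B₂ : ℕ} :
      Exec E P s₁ m₁ B₁ s₂ → Exec E Q s₂ m₂ B₂ s₃ →
      Exec E (.seq P Q) s₁ (m₁ + m₂) (B₁ + B₂) s₃
  | ite_true {b : Test} {P Q : Program} {s s' : State} {m B : ℕ} :
      b.holds s → Exec E P s m B s' → Exec E (.ite b P Q) s (1 + m) (b.bits s + B) s'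
  | ite_false {b : Test} {P Q : Program} {s s' : State} {m B : ℕ} :
      ¬ b.holds s → Exec E Q s m B s' → Exec E (.ite b P Q) s (1 + m) (b.bits s + B) s'
  | loop_done {b : Test} {P : Program} {s : State} :
      ¬ b.holds s → Exec E (.loop b P) s 1 (b.bits s) s
  | loop_step {b : Test} {P : Program} {s₁ s₂ s₃ : State} {m₁ m₂ B₁ B₂ : ℕ} :
      b.holds s₁ → Exec E P s₁ m₁ B₁ s₂ → Exec E (.loop b P) s₂ m₂ B₂ s₃ →
      Exec E (.loop b P) s₁ (1 + m₁ + m₂) (b.bits s₁ + B₁ + B₂) s₃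

/-! ## The decision problem -/

/-- An instance: two temporal graphs on numbered vertex sets with signatures and deletion costs,
a metric, a threshold `c`, and the slack `lam` in the length of the warping paths. -/
structure Instance where
  (nV nW T U k : ℕ)
  G : SignedTemporalGraph (Fin nV) T k
  H : SignedTemporalGraph (Fin nW) U k
  d : (Fin k → ℚ) → (Fin k → ℚ) → ℚ
  isMetric : IsMetric d
  c : ℚ
  lam : ℕ

namespace Instance

/-- The larger of the two numbers of vertices. -/
def n (x : Instance) : ℕ := max x.nV x.nW

/-- Is the dtgw-distance, over warping paths of length at most `T + lam`, at most `c`? -/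
def IsYes (x : Instance) : Prop :=
  boundedDtgw x.d x.G x.H (x.T + x.lam) ≤ (x.c : WithTop ℚ)

/-- The precomputed values of the instance (`0` for indices out of range). -/
def tables (x : Instance) : Tables where
  dist i j u v :=
    if h : i < x.T ∧ j < x.U ∧ u < x.nV ∧ v < x.nW then
      x.d (x.G.sig ⟨i, h.1⟩ ⟨u, h.2.2.1⟩) (x.H.sig ⟨j, h.2.1⟩ ⟨v, h.2.2.2⟩)
    else 0
  delG i u := if h : i < x.T ∧ u < x.nV then x.G.del ⟨i, h.1⟩ ⟨u, h.2⟩ else 0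
  delH j v := if h : j < x.U ∧ v < x.nW then x.H.del ⟨j, h.1⟩ ⟨v, h.2⟩ else 0

/-- The initial state: the lifetimes, the numbers of vertices and the slack in the first natural
registers, the threshold in the first rational register, and `0` everywhere else. -/
def init (x : Instance) : State where
  nreg
    | 0 => x.T
    | 1 => x.U
    | 2 => x.nV
    | 3 => x.nW
    | 4 => x.lam
    | _ => 0
  qreg
    | 0 => x.c
    | _ => 0
  nmem _ := 0
  qmem _ := 0

/-- The size of the instance: the lifetimes and numbers of vertices plus the encoding lengths of
all rational numbers involved. -/
def size (x : Instance) : ℕ :=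
  x.T + x.U + x.nV + x.nW + ratSize x.c
    + ∑ i, ∑ j, ∑ u, ∑ v, ratSize (x.d (x.G.sig i u) (x.H.sig j v))
    + ∑ i, ∑ u, ratSize (x.G.del i u)
    + ∑ j, ∑ v, ratSize (x.H.del j v)

end Instance

/-- `P` halts on `x` after `m` steps of total logarithmic cost `B` and answers correctly
(register `0` finally holds `1` for "yes" and `0` for "no"). -/
def Decides (P : Program) (x : Instance) (m B : ℕ) : Prop :=
  ∃ s : State, Exec x.tables P x.init m B s ∧
    (x.IsYes ∧ s.nreg 0 = 1 ∨ ¬ x.IsYes ∧ s.nreg 0 = 0)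

end DTGW

namespace DTGW

/-! ## Logarithmic cost versus number of steps -/

/-! The vertex mapping is the same along the whole warping path. For a fixed path the two sums can
therefore be exchanged, and what remains is one assignment problem whose weights are the layer
weights added up along the path. Padding the smaller vertex set with dummies turns this into a
square problem of order `n`: a dummy partner means deletion, and vertex mappings become permutations
(`Instance.isYes_iff`). The Hungarian method solves it with `O(n^3)` operations (`wp_hungarian`),
using potentials that certify optimality (`Matching.assignmentLe_iff`).

The paths are enumerated by a depth-first search from the last pair of layers back to the first. The
matrix of accumulated weights is maintained by adding a layer's weights on entry and subtracting
them on exit, `O(n^2)` operations each. A pair `(i, j)` can be completed with `r` moves iff `i ≤ r`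
and `j ≤ r` (`backPaths_nonempty_iff`), so the search never enters a dead end. Every visited node
can be charged to a complete path, and a path has at most `T + lam` nodes. This gives at most
(number of paths) times `O(n^2 (T + lam) + n^3)` steps (`visits`).

For the number of paths, consider exactly `s` moves that decrease the row by `i` and the column by
`j`. Of these, `i` change the row, and the `s - j` moves that leave the column alone must be among
them. Hence there are `s.choose i * i.choose (s - j)` such paths (`card_backPaths`). Summing over
`s` gives the stated formula, and a geometric series gives `2 (T + lam)^lam T^(lam + t)` as an upper
bound (`card_backPaths_le`).

For the logarithmic cost, no step more than doubles a magnitude, and addition and subtraction keep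
every denominator a divisor of the product of the input denominators. After `m` steps all numbers
thus have encoding length linear in `m`, the input size, `lam` and the literals of the program
(`Exec.bits_le`). The total cost is polynomial in these quantities, which is enough for XP
(`le_size_pow`).

The algorithm is written in a small imperative language, verified there with weakest preconditions
that also count steps, and compiled to the machine with constant overhead (`Runs.exec_compile`). -/

/-- `q` has a denominator dividing `D` and absolute value at most `2 ^ β`. -/
def RatBound (D β : ℕ) (q : ℚ) : Prop := q.den ∣ D ∧ |q| ≤ 2 ^ β

theorem RatBound.mono {D β γ : ℕ} {q : ℚ} (h : RatBound D β q) (hb : β ≤ γ) :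
    RatBound D γ q :=
  ⟨h.1, h.2.trans (pow_le_pow_right₀ (by norm_num) hb)⟩

/-- Integrality of `q * D` is visibly closed under addition, unlike divisibility of the reduced
denominator. -/
theorem den_dvd_iff_exists_int {D : ℕ} (hD : D ≠ 0) (q : ℚ) :
    q.den ∣ D ↔ ∃ z : ℤ, q * D = z := by
  constructor
  · rintro ⟨c, rfl⟩
    refine ⟨q.num * c, ?_⟩
    push_cast
    rw [← mul_assoc, Rat.mul_den_eq_num]
  · rintro ⟨z, hz⟩
    have hq : q = z / (D : ℤ) := by
      have : (D : ℚ) ≠ 0 := by exact_mod_cast hD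
      push_cast
      field_simp
      exact hz
    have := Rat.den_dvd z D
    rw [Rat.divInt_eq_div, ← hq] at this
    exact_mod_cast this

theorem RatBound.add {D β : ℕ} (hD : D ≠ 0) {p q : ℚ} (hp : RatBound D β p)
    (hq : RatBound D β q) : RatBound D (β + 1) (p + q) := by
  refine ⟨?_, ?_⟩
  · obtain ⟨a, ha⟩ := (den_dvd_iff_exists_int hD p).1 hp.1
    obtain ⟨b, hb⟩ := (den_dvd_iff_exists_int hD q).1 hq.1
    exact (den_dvd_iff_exists_int hD _).2 ⟨a + b, by push_cast; rw [add_mul, ha, hb]⟩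
  · calc |p + q| ≤ |p| + |q| := abs_add_le p q
      _ ≤ 2 ^ β + 2 ^ β := add_le_add hp.2 hq.2
      _ = 2 ^ (β + 1) := by ring

theorem RatBound.neg {D β : ℕ} {q : ℚ} (hq : RatBound D β q) : RatBound D β (-q) :=
  ⟨by simpa using hq.1, by simpa using hq.2⟩

theorem RatBound.sub {D β : ℕ} (hD : D ≠ 0) {p q : ℚ} (hp : RatBound D β p)
    (hq : RatBound D β q) : RatBound D (β + 1) (p - q) := by
  rw [sub_eq_add_neg]
  exact hp.add hD hq.neg

theorem RatBound.zero (D β : ℕ) : RatBound D β 0 := ⟨by simp, by simp⟩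

/-- The denominator is below `2 ^ e`, and the numerator, being the value times the denominator, is
below `2 ^ (β + e)` in absolute value. -/
theorem RatBound.ratSize_le {D β e : ℕ} (hD : D ≠ 0) (he : D < 2 ^ e) {q : ℚ}
    (hq : RatBound D β q) : ratSize q ≤ β + 2 * e + 1 := by
  have hden : q.den < 2 ^ e := (Nat.le_of_dvd (Nat.pos_of_ne_zero hD) hq.1).trans_lt he
  have hnum : q.num.natAbs < 2 ^ (β + e) := by
    have h1 : (q.num.natAbs : ℚ) = |q| * q.den := by
      rw [Nat.cast_natAbs, Int.cast_abs, ← Rat.mul_den_eq_num q, abs_mul, Nat.abs_cast]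
    have h2 : (q.num.natAbs : ℚ) < 2 ^ (β + e) := by
      rw [h1, pow_add]
      have h3 : (q.den : ℚ) < 2 ^ e := by exact_mod_cast hden
      calc |q| * q.den ≤ 2 ^ β * q.den := by gcongr; exact hq.2
        _ < 2 ^ β * 2 ^ e := by gcongr
    exact_mod_cast h2
  have := Nat.size_le.2 hden
  have := Nat.size_le.2 hnum
  unfold ratSize
  omega

theorem natSize_le {β a : ℕ} (h : a ≤ 2 ^ β) : natSize a ≤ β + 2 := by
  have : a < 2 ^ (β + 1) := h.trans_lt (Nat.pow_lt_pow_right (by norm_num) (by omega))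
  have := Nat.size_le.2 this
  unfold natSize
  omega

/-- All numbers of the state are bounded by `2 ^ β` and all denominators divide `D`. -/
structure State.Bounded (D β : ℕ) (s : State) : Prop where
  nreg : ∀ x, s.nreg x ≤ 2 ^ β
  nmem : ∀ x, s.nmem x ≤ 2 ^ β
  qreg : ∀ x, RatBound D β (s.qreg x)
  qmem : ∀ x, RatBound D β (s.qmem x)

theorem State.Bounded.mono {D β γ : ℕ} {s : State} (h : s.Bounded D β) (hb : β ≤ γ) :
    s.Bounded D γ where
  nreg x := (h.nreg x).trans (Nat.pow_le_pow_right (by norm_num) hb)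
  nmem x := (h.nmem x).trans (Nat.pow_le_pow_right (by norm_num) hb)
  qreg x := (h.qreg x).mono hb
  qmem x := (h.qmem x).mono hb

/-- All table entries are bounded by `2 ^ β` and all their denominators divide `D`. -/
structure Tables.Bounded (D β : ℕ) (E : Tables) : Prop where
  dist : ∀ i j u v, RatBound D β (E.dist i j u v)
  delG : ∀ i u, RatBound D β (E.delG i u)
  delH : ∀ j v, RatBound D β (E.delH j v)

theorem Tables.Bounded.mono {D β γ : ℕ} {E : Tables} (h : E.Bounded D β) (hb : β ≤ γ) :
    E.Bounded D γ where
  dist i j u v := (h.dist i j u v).mono hb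
  delG i u := (h.delG i u).mono hb
  delH i u := (h.delH i u).mono hb

/-- The largest literal of an instruction. -/
def Instr.literal : Instr → ℕ
  | .const _ v => v
  | _ => 0

/-- A bound on the literals of a program. -/
def Program.literals : Program → ℕ
  | .instr a => a.literal
  | .seq P Q => P.literals + Q.literals
  | .ite _ P Q => P.literals + Q.literals
  | .loop _ P => P.literals

theorem forall_update {α β : Type*} [DecidableEq α] {p : β → Prop} {f : α → β} {b : β} {y : α}
    (hf : ∀ x, p (f x)) (hb : p b) : ∀ x, p (Function.update f y b x) := by
  intro x
  rw [Function.update_apply]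
  split_ifs
  · exact hb
  · exact hf x

/-- Only additions and rational subtractions can exceed the previous bound, and they at most double
it; everything else copies, truncates or inserts a literal. -/
theorem Instr.run_bounded {D β : ℕ} (hD : D ≠ 0) {E : Tables} (hE : E.Bounded D β) (a : Instr)
    (ha : a.literal ≤ 2 ^ β) {s : State} (hs : s.Bounded D β) :
    (a.run E s).Bounded D (β + 1) := by
  have h := hs.mono (Nat.le_succ β)
  have two : (2 : ℕ) ^ (β + 1) = 2 ^ β + 2 ^ β := by ring
  have hle : (2 : ℕ) ^ β ≤ 2 ^ (β + 1) := by omega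
  have hup : ∀ {f : ℕ → ℕ} {b y : ℕ}, (∀ x, f x ≤ 2 ^ (β + 1)) → b ≤ 2 ^ (β + 1) →
      ∀ x, Function.update f y b x ≤ 2 ^ (β + 1) :=
    fun hf hb => forall_update (p := fun a : ℕ => a ≤ 2 ^ (β + 1)) hf hb
  cases a with
  | nop => exact h
  | const x v => exact ⟨hup h.nreg (ha.trans hle), h.nmem, h.qreg, h.qmem⟩
  | add x y z =>
    refine ⟨hup h.nreg ?_, h.nmem, h.qreg, h.qmem⟩
    rw [two]
    exact add_le_add (hs.nreg y) (hs.nreg z)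
  | sub x y z =>
    exact ⟨hup h.nreg ((Nat.sub_le _ _).trans (h.nreg y)), h.nmem, h.qreg, h.qmem⟩
  | load x y => exact ⟨hup h.nreg (h.nmem _), h.nmem, h.qreg, h.qmem⟩
  | store x y => exact ⟨h.nreg, hup h.nmem (h.nreg _), h.qreg, h.qmem⟩
  | qadd x y z =>
    exact ⟨h.nreg, h.nmem, forall_update h.qreg ((hs.qreg y).add hD (hs.qreg z)), h.qmem⟩
  | qsub x y z =>
    exact ⟨h.nreg, h.nmem, forall_update h.qreg ((hs.qreg y).sub hD (hs.qreg z)), h.qmem⟩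
  | qload x y => exact ⟨h.nreg, h.nmem, forall_update h.qreg (h.qmem _), h.qmem⟩
  | qstore x y => exact ⟨h.nreg, h.nmem, h.qreg, forall_update h.qmem (h.qreg _)⟩
  | dist x i j u v =>
    exact ⟨h.nreg, h.nmem, forall_update h.qreg ((hE.dist _ _ _ _).mono (Nat.le_succ β)), h.qmem⟩
  | delG x i u =>
    exact ⟨h.nreg, h.nmem, forall_update h.qreg ((hE.delG _ _).mono (Nat.le_succ β)), h.qmem⟩
  | delH x i u =>
    exact ⟨h.nreg, h.nmem, forall_update h.qreg ((hE.delH _ _).mono (Nat.le_succ β)), h.qmem⟩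

/-- Each number involved, results included, has encoding length at most `β + 2 * e + 3`. The factor
`5` comes from `dist`, with four indices and one value. -/
theorem Instr.bits_le {D β e : ℕ} (hD : D ≠ 0) (he : D < 2 ^ e) {E : Tables}
    (hE : E.Bounded D β) (a : Instr) (ha : a.literal ≤ 2 ^ β) {s : State} (hs : s.Bounded D β) :
    a.bits E s ≤ 5 * (β + 2 * e + 3) := by
  have hn := fun x => natSize_le (hs.nreg x)
  have hm := fun x => natSize_le (hs.nmem x)
  have hq := fun x => (hs.qreg x).ratSize_le hD he
  have hqm := fun x => (hs.qmem x).ratSize_le hD he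
  have two : (2 : ℕ) ^ (β + 1) = 2 ^ β + 2 ^ β := by ring
  cases a with
  | nop => simp only [Instr.bits]; omega
  | const x v => have := natSize_le ha; simp only [Instr.bits, Instr.literal] at *; omega
  | add x y z =>
    have := hn y
    have := hn z
    have := natSize_le (two ▸ add_le_add (hs.nreg y) (hs.nreg z))
    simp only [Instr.bits]; omega
  | sub x y z =>
    have := hn y
    have := hn z
    have := natSize_le ((Nat.sub_le _ (s.nreg z)).trans (hs.nreg y))
    simp only [Instr.bits]; omega
  | load x y => have := hn y; have := hm (s.nreg y); simp only [Instr.bits]; omega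
  | store x y => have := hn y; have := hn x; simp only [Instr.bits]; omega
  | qadd x y z =>
    have := hq y
    have := hq z
    have := ((hs.qreg y).add hD (hs.qreg z)).ratSize_le hD he
    simp only [Instr.bits]; omega
  | qsub x y z =>
    have := hq y
    have := hq z
    have := ((hs.qreg y).sub hD (hs.qreg z)).ratSize_le hD he
    simp only [Instr.bits]; omega
  | qload x y => have := hn y; have := hqm (s.nreg y); simp only [Instr.bits]; omega
  | qstore x y => have := hn x; have := hq y; simp only [Instr.bits]; omega
  | dist x i j u v =>
    have := hn i
    have := hn j
    have := hn u
    have := hn v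
    have := (hE.dist (s.nreg i) (s.nreg j) (s.nreg u) (s.nreg v)).ratSize_le hD he
    simp only [Instr.bits]; omega
  | delG x i u =>
    have := hn i
    have := hn u
    have := (hE.delG (s.nreg i) (s.nreg u)).ratSize_le hD he
    simp only [Instr.bits]; omega
  | delH x i u =>
    have := hn i
    have := hn u
    have := (hE.delH (s.nreg i) (s.nreg u)).ratSize_le hD he
    simp only [Instr.bits]; omega

theorem Test.bits_le {D β e : ℕ} (hD : D ≠ 0) (he : D < 2 ^ e) (b : Test) {s : State}
    (hs : s.Bounded D β) : b.bits s ≤ 5 * (β + 2 * e + 3) := by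
  have hn := fun x => natSize_le (hs.nreg x)
  have hq := fun x => (hs.qreg x).ratSize_le hD he
  cases b with
  | natLt x y => have := hn x; have := hn y; simp only [Test.bits]; omega
  | natEq x y => have := hn x; have := hn y; simp only [Test.bits]; omega
  | ratLt x y => have := hq x; have := hq y; simp only [Test.bits]; omega
  | ratLe x y => have := hq x; have := hq y; simp only [Test.bits]; omega

/-- The numbers at most double in a step, so the logarithmic cost of a run is controlled by its
number of steps. -/
theorem Exec.bits_le {D e : ℕ} (hD : D ≠ 0) (he : D < 2 ^ e) {E : Tables} {P : Program}
    {s s' : State} {m B : ℕ} (h : Exec E P s m B s') :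
    ∀ β, E.Bounded D β → P.literals ≤ 2 ^ β → s.Bounded D β →
      s'.Bounded D (β + m) ∧ B ≤ m * (5 * (β + m + 2 * e + 3)) := by
  induction h with
  | instr a s =>
    intro β hE hP hs
    refine ⟨a.run_bounded hD hE hP hs, (a.bits_le hD he hE hP hs).trans ?_⟩
    omega
  | @seq P Q s₁ s₂ s₃ m₁ m₂ B₁ B₂ h₁ h₂ ih₁ ih₂ =>
    intro β hE hP hs
    simp only [Program.literals] at hP
    obtain ⟨hs₂, hB₁⟩ := ih₁ β hE (by omega) hs
    have hpow : (2 : ℕ) ^ β ≤ 2 ^ (β + m₁) := Nat.pow_le_pow_right (by norm_num) (by omega)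
    -- The second part starts with magnitudes up to `2 ^ (β + m₁)`, which is why the induction is
    -- uniform in `β`.
    obtain ⟨hs₃, hB₂⟩ := ih₂ (β + m₁) (hE.mono (by omega)) (by omega) hs₂
    refine ⟨hs₃.mono (by omega), ?_⟩
    have h1 : m₁ * (5 * (β + m₁ + 2 * e + 3)) ≤ m₁ * (5 * (β + (m₁ + m₂) + 2 * e + 3)) :=
      Nat.mul_le_mul_left _ (by omega)
    have h2 : m₂ * (5 * (β + m₁ + m₂ + 2 * e + 3)) ≤ m₂ * (5 * (β + (m₁ + m₂) + 2 * e + 3)) :=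
      Nat.mul_le_mul_left _ (by omega)
    rw [add_mul]
    omega
  | @ite_true b P Q s s' m B hb h ih =>
    intro β hE hP hs
    simp only [Program.literals] at hP
    obtain ⟨hs', hB⟩ := ih β hE (by omega) hs
    refine ⟨hs'.mono (by omega), ?_⟩
    have hb' := b.bits_le hD he hs
    have h1 : m * (5 * (β + m + 2 * e + 3)) ≤ m * (5 * (β + (1 + m) + 2 * e + 3)) :=
      Nat.mul_le_mul_left _ (by omega)
    rw [add_mul]
    omega
  | @ite_false b P Q s s' m B hb h ih =>
    intro β hE hP hs
    simp only [Program.literals] at hP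
    obtain ⟨hs', hB⟩ := ih β hE (by omega) hs
    refine ⟨hs'.mono (by omega), ?_⟩
    have hb' := b.bits_le hD he hs
    have h1 : m * (5 * (β + m + 2 * e + 3)) ≤ m * (5 * (β + (1 + m) + 2 * e + 3)) :=
      Nat.mul_le_mul_left _ (by omega)
    rw [add_mul]
    omega
  | @loop_done b P s hb =>
    intro β hE hP hs
    have hb' := b.bits_le hD he hs
    exact ⟨hs.mono (by omega), by omega⟩
  | @loop_step b P s₁ s₂ s₃ m₁ m₂ B₁ B₂ hb h₁ h₂ ih₁ ih₂ =>
    intro β hE hP hs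
    have hP' : P.literals ≤ 2 ^ β := hP
    have hb' := b.bits_le hD he hs
    obtain ⟨hs₂, hB₁⟩ := ih₁ β hE hP' hs
    have hpow : (2 : ℕ) ^ β ≤ 2 ^ (β + m₁) := Nat.pow_le_pow_right (by norm_num) (by omega)
    obtain ⟨hs₃, hB₂⟩ := ih₂ (β + m₁) (hE.mono (by omega)) (by omega) hs₂
    refine ⟨hs₃.mono (by omega), ?_⟩
    have h1 : m₁ * (5 * (β + m₁ + 2 * e + 3)) ≤ m₁ * (5 * (β + (1 + m₁ + m₂) + 2 * e + 3)) :=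
      Nat.mul_le_mul_left _ (by omega)
    have h2 : m₂ * (5 * (β + m₁ + m₂ + 2 * e + 3)) ≤
        m₂ * (5 * (β + (1 + m₁ + m₂) + 2 * e + 3)) := Nat.mul_le_mul_left _ (by omega)
    rw [add_mul, add_mul]
    omega

/-! ### The common denominator of an instance -/

namespace Instance

variable (x : Instance)

/-- The product of all denominators of the input numbers. -/
def denominator : ℕ :=
  x.c.den * (∏ i, ∏ j, ∏ u, ∏ v, (x.d (x.G.sig i u) (x.H.sig j v)).den)
    * (∏ i, ∏ u, (x.G.del i u).den) * (∏ j, ∏ v, (x.H.del j v).den)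

theorem denominator_ne_zero : x.denominator ≠ 0 := by
  simp [denominator, Finset.prod_eq_zero_iff]

theorem prod_lt_two_pow {ι : Type*} (s : Finset ι) (f g : ι → ℕ) (h : ∀ i ∈ s, f i ≤ 2 ^ g i) :
    ∏ i ∈ s, f i ≤ 2 ^ ∑ i ∈ s, g i := by
  rw [← Finset.prod_pow_eq_pow_sum]
  exact Finset.prod_le_prod' h

theorem den_le_two_pow_ratSize (q : ℚ) : q.den ≤ 2 ^ ratSize q :=
  (Nat.lt_size_self _).le.trans (Nat.pow_le_pow_right (by norm_num) (by unfold ratSize; omega))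

/-- Each denominator is at most `2` to the power of its encoding length, and these lengths add up to
a part of the size. -/
theorem denominator_lt : x.denominator < 2 ^ (x.size + 1) := by
  have h : x.denominator ≤ 2 ^ (ratSize x.c
      + ∑ i, ∑ j, ∑ u, ∑ v, ratSize (x.d (x.G.sig i u) (x.H.sig j v))
      + ∑ i, ∑ u, ratSize (x.G.del i u)
      + ∑ j, ∑ v, ratSize (x.H.del j v)) := by
    rw [pow_add, pow_add, pow_add, denominator]
    gcongr
    · exact den_le_two_pow_ratSize _
    · refine prod_lt_two_pow _ _ _ fun i _ => prod_lt_two_pow _ _ _ fun j _ =>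
        prod_lt_two_pow _ _ _ fun u _ => prod_lt_two_pow _ _ _ fun v _ =>
          den_le_two_pow_ratSize _
    · exact prod_lt_two_pow _ _ _ fun i _ => prod_lt_two_pow _ _ _ fun u _ =>
        den_le_two_pow_ratSize _
    · exact prod_lt_two_pow _ _ _ fun i _ => prod_lt_two_pow _ _ _ fun u _ =>
        den_le_two_pow_ratSize _
  refine h.trans_lt (Nat.pow_lt_pow_right (by norm_num) ?_)
  unfold size
  omega

theorem abs_le_two_pow_ratSize (q : ℚ) : |q| ≤ 2 ^ ratSize q := by
  have h1 : |q| ≤ (q.num.natAbs : ℚ) := by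
    rw [Nat.cast_natAbs, Int.cast_abs, ← Rat.mul_den_eq_num q, abs_mul]
    refine le_mul_of_one_le_right (abs_nonneg q) ?_
    rw [Nat.abs_cast]
    exact_mod_cast q.den_pos
  have h2 : q.num.natAbs ≤ 2 ^ ratSize q :=
    (Nat.lt_size_self _).le.trans (Nat.pow_le_pow_right (by norm_num) (by unfold ratSize; omega))
  exact h1.trans (by exact_mod_cast h2)

theorem ratBound_of {q : ℚ} (h1 : q.den ∣ x.denominator) (h2 : ratSize q ≤ x.size) :
    RatBound x.denominator x.size q :=
  ⟨h1, (abs_le_two_pow_ratSize q).trans (pow_le_pow_right₀ (by norm_num) h2)⟩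

theorem ratBound_c : RatBound x.denominator x.size x.c := by
  refine x.ratBound_of ?_ (by unfold size; omega)
  unfold denominator
  exact ((dvd_mul_right _ _).mul_right _).mul_right _

theorem tables_bounded : x.tables.Bounded x.denominator x.size where
  dist i j u v := by
    simp only [tables]
    split_ifs with h
    · refine x.ratBound_of ?_ ?_
      · unfold denominator
        refine ((Dvd.dvd.mul_left ?_ _).mul_right _).mul_right _
        exact (((Finset.dvd_prod_of_mem (fun v => (x.d (x.G.sig ⟨i, h.1⟩ ⟨u, h.2.2.1⟩)
            (x.H.sig ⟨j, h.2.1⟩ v)).den) (Finset.mem_univ (⟨v, h.2.2.2⟩ : Fin x.nW))).trans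
          (Finset.dvd_prod_of_mem (fun u => ∏ v, (x.d (x.G.sig ⟨i, h.1⟩ u)
            (x.H.sig ⟨j, h.2.1⟩ v)).den) (Finset.mem_univ (⟨u, h.2.2.1⟩ : Fin x.nV)))).trans
          (Finset.dvd_prod_of_mem (fun j => ∏ u, ∏ v, (x.d (x.G.sig ⟨i, h.1⟩ u)
            (x.H.sig j v)).den) (Finset.mem_univ (⟨j, h.2.1⟩ : Fin x.U)))).trans
          (Finset.dvd_prod_of_mem (fun i => ∏ j, ∏ u, ∏ v, (x.d (x.G.sig i u)
            (x.H.sig j v)).den) (Finset.mem_univ (⟨i, h.1⟩ : Fin x.T)))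
      · unfold size
        have h1 : ratSize (x.d (x.G.sig ⟨i, h.1⟩ ⟨u, h.2.2.1⟩) (x.H.sig ⟨j, h.2.1⟩ ⟨v, h.2.2.2⟩)) ≤
            ∑ i, ∑ j, ∑ u, ∑ v, ratSize (x.d (x.G.sig i u) (x.H.sig j v)) :=
          (((Finset.single_le_sum (f := fun v => ratSize (x.d (x.G.sig ⟨i, h.1⟩ ⟨u, h.2.2.1⟩)
            (x.H.sig ⟨j, h.2.1⟩ v))) (fun _ _ => Nat.zero_le _) (Finset.mem_univ _)).trans
          (Finset.single_le_sum (f := fun u => ∑ v, ratSize (x.d (x.G.sig ⟨i, h.1⟩ u)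
            (x.H.sig ⟨j, h.2.1⟩ v))) (fun _ _ => Nat.zero_le _) (Finset.mem_univ _))).trans
          (Finset.single_le_sum (f := fun j => ∑ u, ∑ v, ratSize (x.d (x.G.sig ⟨i, h.1⟩ u)
            (x.H.sig j v))) (fun _ _ => Nat.zero_le _) (Finset.mem_univ _))).trans
          (Finset.single_le_sum (f := fun i => ∑ j, ∑ u, ∑ v, ratSize (x.d (x.G.sig i u)
            (x.H.sig j v))) (fun _ _ => Nat.zero_le _) (Finset.mem_univ _))
        omega
    · exact RatBound.zero _ _
  delG i u := by
    simp only [tables]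
    split_ifs with h
    · refine x.ratBound_of ?_ ?_
      · unfold denominator
        refine (Dvd.dvd.mul_left ?_ _).mul_right _
        exact (Finset.dvd_prod_of_mem (fun u => (x.G.del ⟨i, h.1⟩ u).den)
            (Finset.mem_univ (⟨u, h.2⟩ : Fin x.nV))).trans
          (Finset.dvd_prod_of_mem (fun i => ∏ u, (x.G.del i u).den) (Finset.mem_univ (⟨i, h.1⟩ : Fin x.T)))
      · unfold size
        have h1 : ratSize (x.G.del ⟨i, h.1⟩ ⟨u, h.2⟩) ≤ ∑ i, ∑ u, ratSize (x.G.del i u) :=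
          (Finset.single_le_sum (f := fun u => ratSize (x.G.del ⟨i, h.1⟩ u))
            (fun _ _ => Nat.zero_le _) (Finset.mem_univ _)).trans
          (Finset.single_le_sum (f := fun i => ∑ u, ratSize (x.G.del i u))
            (fun _ _ => Nat.zero_le _) (Finset.mem_univ _))
        omega
    · exact RatBound.zero _ _
  delH i u := by
    simp only [tables]
    split_ifs with h
    · refine x.ratBound_of ?_ ?_
      · unfold denominator
        refine Dvd.dvd.mul_left ?_ _
        exact (Finset.dvd_prod_of_mem (fun u => (x.H.del ⟨i, h.1⟩ u).den)
            (Finset.mem_univ (⟨u, h.2⟩ : Fin x.nW))).trans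
          (Finset.dvd_prod_of_mem (fun i => ∏ u, (x.H.del i u).den) (Finset.mem_univ (⟨i, h.1⟩ : Fin x.U)))
      · unfold size
        have h1 : ratSize (x.H.del ⟨i, h.1⟩ ⟨u, h.2⟩) ≤ ∑ i, ∑ u, ratSize (x.H.del i u) :=
          (Finset.single_le_sum (f := fun u => ratSize (x.H.del ⟨i, h.1⟩ u))
            (fun _ _ => Nat.zero_le _) (Finset.mem_univ _)).trans
          (Finset.single_le_sum (f := fun i => ∑ u, ratSize (x.H.del i u))
            (fun _ _ => Nat.zero_le _) (Finset.mem_univ _))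
        omega
    · exact RatBound.zero _ _

/-- The slack is a parameter and not part of `size`, so it enters the bound separately. -/
theorem init_bounded : x.init.Bounded x.denominator (x.size + x.lam) where
  nreg i := by
    have h : x.init.nreg i ≤ x.size + x.lam := by
      unfold init size
      dsimp only
      split <;> omega
    exact h.trans Nat.lt_two_pow_self.le
  nmem i := by simp [init]
  qreg i := by
    unfold init
    dsimp only
    split
    · exact x.ratBound_c.mono (by omega)
    · exact RatBound.zero _ _
  qmem i := RatBound.zero _ _

/-- The logarithmic cost of a run on `x` with `m` steps. -/
theorem exec_bits_le {P : Program} {m B : ℕ} {s : State} (h : Exec x.tables P x.init m B s) :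
    B ≤ m * (5 * (3 * x.size + x.lam + P.literals + m + 5)) := by
  have h1 : P.literals ≤ 2 ^ (x.size + x.lam + P.literals) :=
    Nat.lt_two_pow_self.le.trans (Nat.pow_le_pow_right (by norm_num) (by omega))
  refine (h.bits_le x.denominator_ne_zero x.denominator_lt (x.size + x.lam + P.literals)
    (x.tables_bounded.mono (by omega)) h1 (x.init_bounded.mono (by omega))).2.trans ?_
  exact Nat.mul_le_mul_left _ (by omega)

end Instance


set_option linter.constructorNameAsVariable false

/-! ## A small imperative language with named variables and arrays -/

/-- Variables of type `ℕ`. -/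
inductive NVar where
  | T | U | nV | nW | lam | N | i | j | r | len | mv | fl | u | v | k | x | q | b | y
  deriving DecidableEq

/-- Variables of type `ℚ`. -/
inductive QVar where
  | c | s | e
  deriving DecidableEq

/-- Arrays of natural numbers. -/
inductive NArr where
  | rb | st | p | way | ord
  deriving DecidableEq

/-- Arrays of rational numbers. -/
inductive QArr where
  | A | pu | pv | D
  deriving DecidableEq

/-- The register holding a variable. -/
def NVar.idx : NVar → ℕ
  | .T => 0 | .U => 1 | .nV => 2 | .nW => 3 | .lam => 4 | .N => 5 | .i => 6 | .j => 7 | .r => 8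
  | .len => 9 | .mv => 10 | .fl => 11 | .u => 12 | .v => 13 | .k => 14 | .x => 15 | .q => 16
  | .b => 17 | .y => 18

def QVar.idx : QVar → ℕ
  | .c => 0 | .s => 1 | .e => 2

def NArr.idx : NArr → ℕ
  | .rb => 0 | .st => 1 | .p => 2 | .way => 3 | .ord => 4

def QArr.idx : QArr → ℕ
  | .A => 0 | .pu => 1 | .pv => 2 | .D => 3

theorem NVar.idx_injective : Function.Injective NVar.idx := by
  intro a b h
  cases a <;> cases b <;> first | rfl | exact absurd h (by decide)

theorem QVar.idx_injective : Function.Injective QVar.idx := by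
  intro a b h
  cases a <;> cases b <;> first | rfl | exact absurd h (by decide)

theorem NArr.idx_injective : Function.Injective NArr.idx := by
  intro a b h
  cases a <;> cases b <;> first | rfl | exact absurd h (by decide)

theorem QArr.idx_injective : Function.Injective QArr.idx := by
  intro a b h
  cases a <;> cases b <;> first | rfl | exact absurd h (by decide)

theorem NVar.idx_lt (a : NVar) : a.idx < 32 := by cases a <;> decide
theorem QVar.idx_lt (a : QVar) : a.idx < 32 := by cases a <;> decide
theorem NArr.idx_lt (a : NArr) : a.idx < 8 := by cases a <;> decide
theorem QArr.idx_lt (a : QArr) : a.idx < 8 := by cases a <;> decide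

/-- The values of all variables and arrays. -/
structure Mem where
  n : NVar → ℕ
  q : QVar → ℚ
  na : NArr → ℕ → ℕ
  qa : QArr → ℕ → ℚ

/-- Expressions of type `ℕ`. -/
inductive NExp where
  | var (x : NVar)
  | lit (c : ℕ)
  | add (e f : NExp)
  | sub (e f : NExp)
  | get (a : NArr) (e : NExp)

/-- Expressions of type `ℚ`. -/
inductive QExp where
  | var (x : QVar)
  | zero
  | add (e f : QExp)
  | sub (e f : QExp)
  | get (a : QArr) (e : NExp)
  | dist (i j u v : NExp)
  | delG (i u : NExp)
  | delH (j v : NExp)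

/-! Variables as expressions. -/

abbrev NExp.T : NExp := .var .T
abbrev NExp.U : NExp := .var .U
abbrev NExp.nV : NExp := .var .nV
abbrev NExp.nW : NExp := .var .nW
abbrev NExp.lam : NExp := .var .lam
abbrev NExp.N : NExp := .var .N
abbrev NExp.i : NExp := .var .i
abbrev NExp.j : NExp := .var .j
abbrev NExp.r : NExp := .var .r
abbrev NExp.len : NExp := .var .len
abbrev NExp.mv : NExp := .var .mv
abbrev NExp.fl : NExp := .var .fl
abbrev NExp.u : NExp := .var .u
abbrev NExp.v : NExp := .var .v
abbrev NExp.k : NExp := .var .k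
abbrev NExp.x : NExp := .var .x
abbrev NExp.q : NExp := .var .q
abbrev NExp.b : NExp := .var .b
abbrev NExp.y : NExp := .var .y
abbrev QExp.c : QExp := .var .c
abbrev QExp.s : QExp := .var .s
abbrev QExp.e : QExp := .var .e

instance : Coe NVar NExp := ⟨.var⟩
instance (c : ℕ) : OfNat NExp c := ⟨.lit c⟩
instance : Add NExp := ⟨.add⟩
instance : Sub NExp := ⟨.sub⟩
instance : Zero QExp := ⟨.zero⟩
instance : Add QExp := ⟨.add⟩
instance : Sub QExp := ⟨.sub⟩

def NExp.eval (a : Mem) : NExp → ℕ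
  | .var x => a.n x
  | .lit c => c
  | .add e f => e.eval a + f.eval a
  | .sub e f => e.eval a - f.eval a
  | .get t e => a.na t (e.eval a)

def QExp.eval (E : Tables) (a : Mem) : QExp → ℚ
  | .var x => a.q x
  | .zero => 0
  | .add e f => e.eval E a + f.eval E a
  | .sub e f => e.eval E a - f.eval E a
  | .get t e => a.qa t (e.eval a)
  | .dist i j u v => E.dist (i.eval a) (j.eval a) (u.eval a) (v.eval a)
  | .delG i u => E.delG (i.eval a) (u.eval a)
  | .delH j v => E.delH (j.eval a) (v.eval a)

section eval

variable (E : Tables) (a : Mem)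

@[simp] theorem NExp.eval_var (x : NVar) : (NExp.var x).eval a = a.n x := rfl
@[simp] theorem NExp.eval_zero : (0 : NExp).eval a = 0 := rfl
@[simp] theorem NExp.eval_one : (1 : NExp).eval a = 1 := rfl
@[simp] theorem NExp.eval_two : (2 : NExp).eval a = 2 := rfl
@[simp] theorem NExp.eval_three : (3 : NExp).eval a = 3 := rfl
@[simp] theorem NExp.eval_add (e f : NExp) : (e + f).eval a = e.eval a + f.eval a := rfl
@[simp] theorem NExp.eval_sub (e f : NExp) : (e - f).eval a = e.eval a - f.eval a := rfl
@[simp] theorem NExp.eval_get (t : NArr) (e : NExp) :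
    (NExp.get t e).eval a = a.na t (e.eval a) := rfl
@[simp] theorem QExp.eval_var (x : QVar) : (QExp.var x).eval E a = a.q x := rfl
@[simp] theorem QExp.eval_zero : (0 : QExp).eval E a = 0 := rfl
@[simp] theorem QExp.eval_add (e f : QExp) : (e + f).eval E a = e.eval E a + f.eval E a := rfl
@[simp] theorem QExp.eval_sub (e f : QExp) : (e - f).eval E a = e.eval E a - f.eval E a := rfl
@[simp] theorem QExp.eval_get (t : QArr) (e : NExp) :
    (QExp.get t e).eval E a = a.qa t (e.eval a) := rfl
@[simp] theorem QExp.eval_dist (i j u v : NExp) : (QExp.dist i j u v).eval E a =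
    E.dist (i.eval a) (j.eval a) (u.eval a) (v.eval a) := rfl
@[simp] theorem QExp.eval_delG (i u : NExp) : (QExp.delG i u).eval E a =
    E.delG (i.eval a) (u.eval a) := rfl
@[simp] theorem QExp.eval_delH (j v : NExp) : (QExp.delH j v).eval E a =
    E.delH (j.eval a) (v.eval a) := rfl

end eval

/-- Conditions. -/
inductive Cond where
  | lt (e f : NExp)
  | eq (e f : NExp)
  | qlt (e f : QExp)
  | qle (e f : QExp)

def Cond.holds (E : Tables) (a : Mem) : Cond → Prop
  | .lt e f => e.eval a < f.eval a
  | .eq e f => e.eval a = f.eval a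
  | .qlt e f => e.eval E a < f.eval E a
  | .qle e f => e.eval E a ≤ f.eval E a

/-- Commands. -/
inductive Cmd where
  | skip
  | nset (x : NVar) (e : NExp)
  | qset (x : QVar) (e : QExp)
  | nput (t : NArr) (e f : NExp)
  | qput (t : QArr) (e : NExp) (f : QExp)
  | seq (P Q : Cmd)
  | ite (b : Cond) (P Q : Cmd)
  | while (b : Cond) (P : Cmd)

infixr:30 " ;; " => Cmd.seq

namespace Mem

def setN (a : Mem) (x : NVar) (v : ℕ) : Mem := { a with n := Function.update a.n x v }
def setQ (a : Mem) (x : QVar) (v : ℚ) : Mem := { a with q := Function.update a.q x v }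
def putN (a : Mem) (t : NArr) (k v : ℕ) : Mem :=
  { a with na := Function.update a.na t (Function.update (a.na t) k v) }
def putQ (a : Mem) (t : QArr) (k : ℕ) (v : ℚ) : Mem :=
  { a with qa := Function.update a.qa t (Function.update (a.qa t) k v) }

section

variable (a : Mem) (x x' : NVar) (z z' : QVar) (t t' : NArr) (w w' : QArr) (k k' v : ℕ) (c : ℚ)

@[simp] theorem setN_n : (a.setN x v).n x' = if x' = x then v else a.n x' := by
  simp [setN, Function.update_apply]
@[simp] theorem setN_q : (a.setN x v).q = a.q := rfl
@[simp] theorem setN_na : (a.setN x v).na = a.na := rfl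
@[simp] theorem setN_qa : (a.setN x v).qa = a.qa := rfl
@[simp] theorem setQ_q : (a.setQ z c).q z' = if z' = z then c else a.q z' := by
  simp [setQ, Function.update_apply]
@[simp] theorem setQ_n : (a.setQ z c).n = a.n := rfl
@[simp] theorem setQ_na : (a.setQ z c).na = a.na := rfl
@[simp] theorem setQ_qa : (a.setQ z c).qa = a.qa := rfl
@[simp] theorem putN_na :
    (a.putN t k v).na t' = if t' = t then Function.update (a.na t) k v else a.na t' := by
  simp [putN, Function.update_apply]
@[simp] theorem putN_n : (a.putN t k v).n = a.n := rfl
@[simp] theorem putN_q : (a.putN t k v).q = a.q := rfl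
@[simp] theorem putN_qa : (a.putN t k v).qa = a.qa := rfl
@[simp] theorem putQ_qa :
    (a.putQ w k c).qa w' = if w' = w then Function.update (a.qa w) k c else a.qa w' := by
  simp [putQ, Function.update_apply]
@[simp] theorem putQ_n : (a.putQ w k c).n = a.n := rfl
@[simp] theorem putQ_q : (a.putQ w k c).q = a.q := rfl
@[simp] theorem putQ_na : (a.putQ w k c).na = a.na := rfl

end

end Mem

/-- `Runs E P a m a'`: started in `a`, the command `P` ends in `a'` after executing `m`
assignments and tests. -/
inductive Runs (E : Tables) : Cmd → Mem → ℕ → Mem → Prop where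
  | skip (a : Mem) : Runs E .skip a 1 a
  | nset (x : NVar) (e : NExp) (a : Mem) : Runs E (.nset x e) a 1 (a.setN x (e.eval a))
  | qset (x : QVar) (e : QExp) (a : Mem) : Runs E (.qset x e) a 1 (a.setQ x (e.eval E a))
  | nput (t : NArr) (e f : NExp) (a : Mem) :
      Runs E (.nput t e f) a 1 (a.putN t (e.eval a) (f.eval a))
  | qput (t : QArr) (e : NExp) (f : QExp) (a : Mem) :
      Runs E (.qput t e f) a 1 (a.putQ t (e.eval a) (f.eval E a))
  | seq {P Q : Cmd} {a₁ a₂ a₃ : Mem} {m₁ m₂ : ℕ} :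
      Runs E P a₁ m₁ a₂ → Runs E Q a₂ m₂ a₃ → Runs E (.seq P Q) a₁ (m₁ + m₂) a₃
  | ite_true {b : Cond} {P Q : Cmd} {a a' : Mem} {m : ℕ} :
      b.holds E a → Runs E P a m a' → Runs E (.ite b P Q) a (1 + m) a'
  | ite_false {b : Cond} {P Q : Cmd} {a a' : Mem} {m : ℕ} :
      ¬ b.holds E a → Runs E Q a m a' → Runs E (.ite b P Q) a (1 + m) a'
  | while_done {b : Cond} {P : Cmd} {a : Mem} :
      ¬ b.holds E a → Runs E (.while b P) a 1 a
  | while_step {b : Cond} {P : Cmd} {a₁ a₂ a₃ : Mem} {m₁ m₂ : ℕ} :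
      b.holds E a₁ → Runs E P a₁ m₁ a₂ → Runs E (.while b P) a₂ m₂ a₃ →
      Runs E (.while b P) a₁ (1 + m₁ + m₂) a₃

/-! ### Frames -/

/-- The variables and arrays that a command may change. -/
def Cmd.nw : Cmd → NVar → Bool
  | .nset x _, y => y = x
  | .seq P Q, y => P.nw y || Q.nw y
  | .ite _ P Q, y => P.nw y || Q.nw y
  | .while _ P, y => P.nw y
  | _, _ => false

def Cmd.qw : Cmd → QVar → Bool
  | .qset x _, y => y = x
  | .seq P Q, y => P.qw y || Q.qw y
  | .ite _ P Q, y => P.qw y || Q.qw y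
  | .while _ P, y => P.qw y
  | _, _ => false

def Cmd.naw : Cmd → NArr → Bool
  | .nput x _ _, y => y = x
  | .seq P Q, y => P.naw y || Q.naw y
  | .ite _ P Q, y => P.naw y || Q.naw y
  | .while _ P, y => P.naw y
  | _, _ => false

def Cmd.qaw : Cmd → QArr → Bool
  | .qput x _ _, y => y = x
  | .seq P Q, y => P.qaw y || Q.qaw y
  | .ite _ P Q, y => P.qaw y || Q.qaw y
  | .while _ P, y => P.qaw y
  | _, _ => false

/-- `a'` differs from `a` at most in what `P` may change. -/
structure Frame (P : Cmd) (a a' : Mem) : Prop where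
  n : ∀ x, P.nw x = false → a'.n x = a.n x
  q : ∀ x, P.qw x = false → a'.q x = a.q x
  na : ∀ x, P.naw x = false → a'.na x = a.na x
  qa : ∀ x, P.qaw x = false → a'.qa x = a.qa x

theorem Frame.rfl (P : Cmd) (a : Mem) : Frame P a a :=
  ⟨fun _ _ => .refl _, fun _ _ => .refl _, fun _ _ => .refl _, fun _ _ => .refl _⟩

theorem Frame.trans {P : Cmd} {a b c : Mem} (h : Frame P a b) (h' : Frame P b c) :
    Frame P a c where
  n x hx := (h'.n x hx).trans (h.n x hx)
  q x hx := (h'.q x hx).trans (h.q x hx)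
  na x hx := (h'.na x hx).trans (h.na x hx)
  qa x hx := (h'.qa x hx).trans (h.qa x hx)

theorem Frame.weaken {P Q : Cmd} {a b : Mem} (h : Frame P a b)
    (hn : ∀ x, Q.nw x = false → P.nw x = false) (hq : ∀ x, Q.qw x = false → P.qw x = false)
    (hna : ∀ x, Q.naw x = false → P.naw x = false)
    (hqa : ∀ x, Q.qaw x = false → P.qaw x = false) : Frame Q a b where
  n x hx := h.n x (hn x hx)
  q x hx := h.q x (hq x hx)
  na x hx := h.na x (hna x hx)
  qa x hx := h.qa x (hqa x hx)

theorem Frame.seq_left {P Q : Cmd} {a b : Mem} (h : Frame P a b) : Frame (P ;; Q) a b := by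
  apply h.weaken <;> intro x hx <;> simp_all [Cmd.nw, Cmd.qw, Cmd.naw, Cmd.qaw]

theorem Frame.seq_right {P Q : Cmd} {a b : Mem} (h : Frame Q a b) : Frame (P ;; Q) a b := by
  apply h.weaken <;> intro x hx <;> simp_all [Cmd.nw, Cmd.qw, Cmd.naw, Cmd.qaw]

theorem Frame.ite_left {b : Cond} {P Q : Cmd} {a a' : Mem} (h : Frame P a a') :
    Frame (.ite b P Q) a a' := by
  apply h.weaken <;> intro x hx <;> simp_all [Cmd.nw, Cmd.qw, Cmd.naw, Cmd.qaw]

theorem Frame.ite_right {b : Cond} {P Q : Cmd} {a a' : Mem} (h : Frame Q a a') :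
    Frame (.ite b P Q) a a' := by
  apply h.weaken <;> intro x hx <;> simp_all [Cmd.nw, Cmd.qw, Cmd.naw, Cmd.qaw]

theorem Frame.while {b : Cond} {P : Cmd} {a a' : Mem} (h : Frame P a a') :
    Frame (.while b P) a a' :=
  h.weaken (fun _ h => h) (fun _ h => h) (fun _ h => h) (fun _ h => h)

theorem Runs.frame {E : Tables} {P : Cmd} {a a' : Mem} {m : ℕ} (h : Runs E P a m a') :
    Frame P a a' := by
  induction h with
  | skip a => exact .rfl _ _
  | nset x e a => constructor <;> intro y hy <;> simp_all [Cmd.nw]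
  | qset x e a => constructor <;> intro y hy <;> simp_all [Cmd.qw]
  | nput x e a => constructor <;> intro y hy <;> simp_all [Cmd.naw]
  | qput x e a => constructor <;> intro y hy <;> simp_all [Cmd.qaw]
  | seq _ _ h₁ h₂ => exact h₁.seq_left.trans h₂.seq_right
  | ite_true _ _ h => exact h.ite_left
  | ite_false _ _ h => exact h.ite_right
  | while_done _ => exact .rfl _ _
  | while_step _ _ _ h₁ h₂ => exact h₁.while.trans h₂

/-! ### Weakest preconditions -/

/-- `P` halts from `a` after some number `m` of steps in some `a'` with `Q m a'`. -/
def wp (E : Tables) (P : Cmd) (Q : ℕ → Mem → Prop) (a : Mem) : Prop :=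
  ∃ m a', Runs E P a m a' ∧ Q m a'

section wp

variable {E : Tables} {a : Mem} {Q : ℕ → Mem → Prop}

/-- The frame is handed to the continuation, so postconditions need not mention what the command
leaves untouched. -/
theorem wp.mono {P : Cmd} {Q' : ℕ → Mem → Prop} (h : wp E P Q' a)
    (hQ : ∀ m a', Frame P a a' → Q' m a' → Q m a') : wp E P Q a := by
  obtain ⟨m, a', hr, hq⟩ := h
  exact ⟨m, a', hr, hQ m a' hr.frame hq⟩

@[simp] theorem wp_skip : wp E .skip Q a ↔ Q 1 a := by
  constructor
  · rintro ⟨m, a', h, hq⟩; cases h; exact hq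
  · exact fun h => ⟨_, _, .skip a, h⟩

@[simp] theorem wp_nset {x : NVar} {e : NExp} :
    wp E (.nset x e) Q a ↔ Q 1 (a.setN x (e.eval a)) := by
  constructor
  · rintro ⟨m, a', h, hq⟩; cases h; exact hq
  · exact fun h => ⟨_, _, .nset x e a, h⟩

@[simp] theorem wp_qset {x : QVar} {e : QExp} :
    wp E (.qset x e) Q a ↔ Q 1 (a.setQ x (e.eval E a)) := by
  constructor
  · rintro ⟨m, a', h, hq⟩; cases h; exact hq
  · exact fun h => ⟨_, _, .qset x e a, h⟩

@[simp] theorem wp_nput {t : NArr} {e f : NExp} :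
    wp E (.nput t e f) Q a ↔ Q 1 (a.putN t (e.eval a) (f.eval a)) := by
  constructor
  · rintro ⟨m, a', h, hq⟩; cases h; exact hq
  · exact fun h => ⟨_, _, .nput t e f a, h⟩

@[simp] theorem wp_qput {t : QArr} {e : NExp} {f : QExp} :
    wp E (.qput t e f) Q a ↔ Q 1 (a.putQ t (e.eval a) (f.eval E a)) := by
  constructor
  · rintro ⟨m, a', h, hq⟩; cases h; exact hq
  · exact fun h => ⟨_, _, .qput t e f a, h⟩

@[simp] theorem wp_seq {P R : Cmd} :
    wp E (P ;; R) Q a ↔ wp E P (fun m a' => wp E R (fun m' => Q (m + m')) a') a := by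
  constructor
  · rintro ⟨m, a', h, hq⟩
    cases h with
    | seq h₁ h₂ => exact ⟨_, _, h₁, _, _, h₂, hq⟩
  · rintro ⟨m, a', h, m', a'', h', hq⟩
    exact ⟨_, _, .seq h h', hq⟩

@[simp] theorem wp_ite {b : Cond} {P R : Cmd} :
    wp E (.ite b P R) Q a ↔ (b.holds E a → wp E P (fun m => Q (1 + m)) a) ∧
      (¬ b.holds E a → wp E R (fun m => Q (1 + m)) a) := by
  constructor
  · rintro ⟨m, a', h, hq⟩
    cases h with
    | ite_true hb h => exact ⟨fun _ => ⟨_, _, h, hq⟩, fun h' => absurd hb h'⟩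
    | ite_false hb h => exact ⟨fun h' => absurd h' hb, fun _ => ⟨_, _, h, hq⟩⟩
  · rintro ⟨h₁, h₂⟩
    by_cases hb : b.holds E a
    · obtain ⟨m, a', h, hq⟩ := h₁ hb
      exact ⟨_, _, .ite_true hb h, hq⟩
    · obtain ⟨m, a', h, hq⟩ := h₂ hb
      exact ⟨_, _, .ite_false hb h, hq⟩

/-- A loop with invariant `I`, variant `μ` and at most `K` steps in its body. -/
theorem wp_while {b : Cond} {P : Cmd} (I : Mem → Prop) (μ : Mem → ℕ) (K : ℕ) (h0 : I a)
    (step : ∀ a', Frame (.while b P) a a' → I a' → b.holds E a' →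
      wp E P (fun m a'' => m ≤ K ∧ I a'' ∧ μ a'' < μ a') a')
    (done : ∀ m a', Frame (.while b P) a a' → I a' → ¬ b.holds E a' → m ≤ μ a * (K + 1) + 1 →
      Q m a') :
    wp E (.while b P) Q a := by
  suffices h : ∀ n a', Frame (.while b P) a a' → I a' → μ a' = n →
      wp E (.while b P) (fun m a'' => I a'' ∧ ¬ b.holds E a'' ∧ m ≤ n * (K + 1) + 1) a' by
    refine (h _ a (.rfl _ _) h0 rfl).mono fun m a' hF h => ?_
    exact done m a' hF h.1 h.2.1 h.2.2
  intro n
  induction n using Nat.strong_induction_on with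
  | _ n ih =>
    intro a' hF hI hn
    by_cases hb : b.holds E a'
    · obtain ⟨m₁, a₁, hr, hm₁, hI₁, hμ⟩ := step a' hF hI hb
      obtain ⟨m₂, a₂, hr₂, hI₂, hb₂, hm₂⟩ :=
        ih (μ a₁) (hn ▸ hμ) a₁ (hF.trans hr.frame.while) hI₁ rfl
      refine ⟨_, a₂, .while_step hb hr hr₂, hI₂, hb₂, ?_⟩
      have : (μ a₁ + 1) * (K + 1) ≤ n * (K + 1) := Nat.mul_le_mul_right _ (by omega)
      rw [add_mul] at this
      omega
    · exact ⟨1, a', .while_done hb, hI, hb, by omega⟩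

/-- `for x in 0, …, e - 1`. -/
def Cmd.for (x : NVar) (e : NExp) (P : Cmd) : Cmd :=
  .nset x 0 ;; .while (.lt x e) (P ;; .nset x (x + 1))

/-- Each round costs the body, one test and one increment, hence `K + 2`; the final `2` is the
initialisation and the failing test. The bound `e` is evaluated anew in each round, so it has to be
constant on all memories that the loop can produce. -/
theorem wp_for {x : NVar} {e : NExp} {P : Cmd} (I : ℕ → Mem → Prop) (n K : ℕ)
    (he : ∀ a', Frame (.for x e P) a a' → e.eval a' = n) (hx : P.nw x = false)
    (h0 : I 0 (a.setN x 0))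
    (step : ∀ l a', l < n → Frame (.for x e P) a a' → a'.n x = l → I l a' →
      wp E P (fun m a'' => m ≤ K ∧ I (l + 1) (a''.setN x (l + 1))) a')
    (done : ∀ m a', Frame (.for x e P) a a' → I n a' → m ≤ n * (K + 2) + 2 → Q m a') :
    wp E (.for x e P) Q a := by
  have hF0 : Frame (.for x e P) a (a.setN x 0) :=
    (Runs.nset (E := E) x 0 a).frame.seq_left
  rw [Cmd.for, wp_seq, wp_nset]
  have hFw : ∀ {a'}, Frame (.while (.lt x e) (P ;; .nset x (x + 1)))
      (a.setN x (NExp.eval a 0)) a' → Frame (.for x e P) a a' :=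
    fun h => hF0.trans h.seq_right
  refine wp_while (fun a' => a'.n x ≤ n ∧ I (a'.n x) a') (fun a' => n - a'.n x) (K + 1)
    (by simpa using h0) ?_ ?_
  · rintro a' hF ⟨hle, hI⟩ hb
    have hb' : a'.n x < e.eval a' := hb
    rw [he a' (hFw hF)] at hb'
    refine wp_seq.2 ((step _ a' hb' (hFw hF) rfl hI).mono fun m a'' hF' h => ?_)
    have hx' := hF'.n x hx
    simp only [wp_nset, NExp.eval_add, NExp.eval_var, NExp.eval_one, hx', Mem.setN_n, if_true]
    exact ⟨by omega, ⟨by omega, h.2⟩, by omega⟩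
  · rintro m a' hF ⟨hle, hI⟩ hb hm
    have hb' : ¬ a'.n x < e.eval a' := hb
    rw [he a' (hFw hF)] at hb'
    have hn : a'.n x = n := by omega
    rw [hn] at hI
    refine done _ a' (hFw hF) hI ?_
    simp only [Mem.setN_n, if_true, NExp.eval_zero, Nat.sub_zero] at hm
    change m ≤ n * (K + 2) + 1 at hm
    omega

end wp

/-! ### Compilation -/

/-- Scratch registers start here. -/
abbrev scratch (d : ℕ) : ℕ := 32 + d

/-- `s` represents `a`. -/
structure Rep (s : State) (a : Mem) : Prop where
  n : ∀ x : NVar, s.nreg x.idx = a.n x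
  q : ∀ x : QVar, s.qreg x.idx = a.q x
  na : ∀ (t : NArr) (k : ℕ), s.nmem (8 * k + t.idx) = a.na t k
  qa : ∀ (t : QArr) (k : ℕ), s.qmem (8 * k + t.idx) = a.qa t k

/-- Replace the number in the scratch register `d` by the address `8 * d + t`. -/
def addressProgram (d t : ℕ) : Program :=
  .seq (.instr (.add (scratch d) (scratch d) (scratch d)))
  (.seq (.instr (.add (scratch d) (scratch d) (scratch d)))
  (.seq (.instr (.add (scratch d) (scratch d) (scratch d)))
  (.seq (.instr (.const (scratch (d + 1)) t))
    (.instr (.add (scratch d) (scratch d) (scratch (d + 1)))))))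

/-- Evaluate into the scratch register `d`, using only scratch registers from `d` on. -/
def NExp.compile (d : ℕ) : NExp → Program
  | .var x => .seq (.instr (.const (scratch (d + 1)) 0))
      (.instr (.add (scratch d) x.idx (scratch (d + 1))))
  | .lit c => .instr (.const (scratch d) c)
  | .add e f => .seq (e.compile d) (.seq (f.compile (d + 1))
      (.instr (.add (scratch d) (scratch d) (scratch (d + 1)))))
  | .sub e f => .seq (e.compile d) (.seq (f.compile (d + 1))
      (.instr (.sub (scratch d) (scratch d) (scratch (d + 1)))))
  | .get t e => .seq (e.compile d) (.seq (addressProgram d t.idx)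
      (.instr (.load (scratch d) (scratch d))))

/-- Evaluate into the rational scratch register `d`. -/
def QExp.compile (d : ℕ) : QExp → Program
  -- The machine has neither a copy instruction nor a rational literal: zero is a difference of
  -- equal numbers, and copying is adding zero.
  | .var x => .seq (.instr (.qsub (scratch (d + 1)) (scratch (d + 1)) (scratch (d + 1))))
      (.instr (.qadd (scratch d) x.idx (scratch (d + 1))))
  | .zero => .instr (.qsub (scratch d) (scratch d) (scratch d))
  | .add e f => .seq (e.compile d) (.seq (f.compile (d + 1))
      (.instr (.qadd (scratch d) (scratch d) (scratch (d + 1)))))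
  | .sub e f => .seq (e.compile d) (.seq (f.compile (d + 1))
      (.instr (.qsub (scratch d) (scratch d) (scratch (d + 1)))))
  | .get t e => .seq (e.compile 0) (.seq (addressProgram 0 t.idx)
      (.instr (.qload (scratch d) (scratch 0))))
  | .dist i j u v => .seq (i.compile 0) (.seq (j.compile 1) (.seq (u.compile 2)
      (.seq (v.compile 3)
        (.instr (.dist (scratch d) (scratch 0) (scratch 1) (scratch 2) (scratch 3))))))
  | .delG i u => .seq (i.compile 0) (.seq (u.compile 1)
      (.instr (.delG (scratch d) (scratch 0) (scratch 1))))
  | .delH j v => .seq (j.compile 0) (.seq (v.compile 1)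
      (.instr (.delH (scratch d) (scratch 0) (scratch 1))))

/-- The program evaluating the operands of a condition. -/
def Cond.compile : Cond → Program
  | .lt e f => .seq (e.compile 0) (f.compile 1)
  | .eq e f => .seq (e.compile 0) (f.compile 1)
  | .qlt e f => .seq (e.compile 0) (f.compile 1)
  | .qle e f => .seq (e.compile 0) (f.compile 1)

def Cond.test : Cond → Test
  | .lt _ _ => .natLt (scratch 0) (scratch 1)
  | .eq _ _ => .natEq (scratch 0) (scratch 1)
  | .qlt _ _ => .ratLt (scratch 0) (scratch 1)
  | .qle _ _ => .ratLe (scratch 0) (scratch 1)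

/-- The operands of a condition must be in scratch registers when the test is made, so a loop
evaluates them once in front and again at the end of its body. -/
def Cmd.compile : Cmd → Program
  | .skip => .instr .nop
  | .nset x e => .seq (e.compile 0) (.seq (.instr (.const (scratch 1) 0))
      (.instr (.add x.idx (scratch 0) (scratch 1))))
  | .qset x e => .seq (e.compile 0)
      (.seq (.instr (.qsub (scratch 1) (scratch 1) (scratch 1)))
        (.instr (.qadd x.idx (scratch 0) (scratch 1))))
  | .nput t e f => .seq (f.compile 0) (.seq (e.compile 1) (.seq (addressProgram 1 t.idx)
      (.instr (.store (scratch 1) (scratch 0)))))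
  | .qput t e f => .seq (f.compile 0) (.seq (e.compile 0) (.seq (addressProgram 0 t.idx)
      (.instr (.qstore (scratch 0) (scratch 0)))))
  | .seq P Q => .seq P.compile Q.compile
  | .ite b P Q => .seq b.compile (.ite b.test P.compile Q.compile)
  | .while b P => .seq b.compile (.loop b.test (.seq P.compile b.compile))

/-- The number of instructions of a loop-free program. -/
def Program.cost : Program → ℕ
  | .instr _ => 1
  | .seq P Q => P.cost + Q.cost
  | .ite _ P Q => 1 + P.cost + Q.cost
  | .loop _ P => 1 + P.cost

theorem NVar.idx_ne_scratch (x : NVar) (d : ℕ) : x.idx ≠ scratch d := by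
  have := x.idx_lt
  unfold scratch
  omega

theorem QVar.idx_ne_scratch (x : QVar) (d : ℕ) : x.idx ≠ scratch d := by
  have := x.idx_lt
  unfold scratch
  omega

theorem exec_addressProgram (E : Tables) (d t : ℕ) (s : State) {a : Mem} (h : Rep s a) :
    ∃ B s', Exec E (addressProgram d t) s 5 B s' ∧ Rep s' a ∧ s'.qreg = s.qreg ∧
      s'.nreg (scratch d) = 8 * s.nreg (scratch d) + t ∧
      ∀ d' < d, s'.nreg (scratch d') = s.nreg (scratch d') := by
  refine ⟨_, _, .seq (.instr _ _) (.seq (.instr _ _) (.seq (.instr _ _) (.seq (.instr _ _)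
    (.instr _ _)))), ⟨?_, h.q, h.na, h.qa⟩, rfl, ?_, ?_⟩
  · intro x
    simp [Instr.run, x.idx_ne_scratch, h.n]
  · simp [Instr.run]
    ring
  · intro d' hd'
    have h1 : d' ≠ d := by omega
    have h2 : d' ≠ d + 1 := by omega
    simp [Instr.run, h1, h2]

/-- The scratch registers act as an evaluation stack: whatever lies below `d` survives. That the
rational registers are untouched is needed when an index is evaluated inside a rational expression.
-/
theorem NExp.exec_compile (E : Tables) (e : NExp) : ∀ (d : ℕ) (s : State) (a : Mem), Rep s a →
    ∃ B s', Exec E (e.compile d) s (e.compile d).cost B s' ∧ Rep s' a ∧ s'.qreg = s.qreg ∧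
      s'.nreg (scratch d) = e.eval a ∧
      ∀ d' < d, s'.nreg (scratch d') = s.nreg (scratch d') := by
  induction e with
  | var x =>
    intro d s a h
    refine ⟨_, _, .seq (.instr _ _) (.instr _ _), ⟨?_, h.q, h.na, h.qa⟩, rfl, ?_, ?_⟩
    · intro y
      simp [Instr.run, Function.update_apply, y.idx_ne_scratch, h.n]
    · simp [Instr.run, x.idx_ne_scratch, h.n]
    · intro d' hd'
      have h1 : d' ≠ d := by omega
      have h2 : d' ≠ d + 1 := by omega
      simp [Instr.run, Function.update_apply, h1, h2]
  | lit c =>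
    intro d s a h
    refine ⟨_, _, .instr _ _, ⟨?_, h.q, h.na, h.qa⟩, rfl, ?_, ?_⟩
    · intro y
      simp [Instr.run, y.idx_ne_scratch, h.n]
    · simp [Instr.run, NExp.eval]
    · intro d' hd'
      have h1 : d' ≠ d := by omega
      simp [Instr.run, h1]
  | add e f ihe ihf =>
    intro d s a h
    obtain ⟨B₁, s₁, hr₁, h₁, hq₁, hv₁, hd₁⟩ := ihe d s a h
    obtain ⟨B₂, s₂, hr₂, h₂, hq₂, hv₂, hd₂⟩ := ihf (d + 1) s₁ a h₁
    refine ⟨_, _, .seq hr₁ (.seq hr₂ (.instr _ _)), ⟨?_, h₂.q, h₂.na, h₂.qa⟩,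
      hq₂.trans hq₁, ?_, ?_⟩
    · intro y
      simp [Instr.run, y.idx_ne_scratch, h₂.n]
    · simp only [Instr.run, Function.update_self, hv₂, hd₂ d (by omega), hv₁]
      rfl
    · intro d' hd'
      have h1 : scratch d' ≠ scratch d := by unfold scratch; omega
      simp only [Instr.run, Function.update_apply, h1, if_false]
      rw [hd₂ d' (by omega), hd₁ d' hd']
  | sub e f ihe ihf =>
    intro d s a h
    obtain ⟨B₁, s₁, hr₁, h₁, hq₁, hv₁, hd₁⟩ := ihe d s a h
    obtain ⟨B₂, s₂, hr₂, h₂, hq₂, hv₂, hd₂⟩ := ihf (d + 1) s₁ a h₁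
    refine ⟨_, _, .seq hr₁ (.seq hr₂ (.instr _ _)), ⟨?_, h₂.q, h₂.na, h₂.qa⟩,
      hq₂.trans hq₁, ?_, ?_⟩
    · intro y
      simp [Instr.run, y.idx_ne_scratch, h₂.n]
    · simp only [Instr.run, Function.update_self, hv₂, hd₂ d (by omega), hv₁]
      rfl
    · intro d' hd'
      have h1 : scratch d' ≠ scratch d := by unfold scratch; omega
      simp only [Instr.run, Function.update_apply, h1, if_false]
      rw [hd₂ d' (by omega), hd₁ d' hd']
  | get t e ihe =>
    intro d s a h
    obtain ⟨B₁, s₁, hr₁, h₁, hq₁, hv₁, hd₁⟩ := ihe d s a h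
    obtain ⟨B₂, s₂, hr₂, h₂, hq₂, hv₂, hd₂⟩ := exec_addressProgram E d t.idx s₁ h₁
    refine ⟨_, _, .seq hr₁ (.seq hr₂ (.instr _ _)), ⟨?_, h₂.q, h₂.na, h₂.qa⟩,
      hq₂.trans hq₁, ?_, ?_⟩
    · intro y
      simp [Instr.run, y.idx_ne_scratch, h₂.n]
    · simp only [Instr.run, Function.update_self, hv₂, hv₁, h₂.na]
      rfl
    · intro d' hd'
      have h1 : scratch d' ≠ scratch d := by unfold scratch; omega
      simp only [Instr.run, Function.update_apply, h1, if_false]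
      rw [hd₂ d' (by omega), hd₁ d' hd']

theorem Rep.update_qreg {s : State} {a : Mem} (h : Rep s a) (d : ℕ) (c : ℚ) :
    Rep { s with qreg := Function.update s.qreg (scratch d) c } a :=
  ⟨h.n, fun x => by simp [x.idx_ne_scratch, h.q], h.na, h.qa⟩

/-- Nothing is claimed about natural scratch registers, since all index expressions of one rational
subexpression are evaluated afresh just before they are used. -/
theorem QExp.exec_compile (E : Tables) (e : QExp) : ∀ (d : ℕ) (s : State) (a : Mem), Rep s a →
    ∃ B s', Exec E (e.compile d) s (e.compile d).cost B s' ∧ Rep s' a ∧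
      s'.qreg (scratch d) = e.eval E a ∧
      ∀ d' < d, s'.qreg (scratch d') = s.qreg (scratch d') := by
  have ne : ∀ {d d' : ℕ}, d' < d → scratch d' ≠ scratch d := by
    intro d d' h; unfold scratch; omega
  induction e with
  | var x =>
    intro d s a h
    refine ⟨_, _, .seq (.instr _ _) (.instr _ _), (h.update_qreg _ _).update_qreg _ _, ?_, ?_⟩
    · simp [Instr.run, x.idx_ne_scratch, h.q]
    · intro d' hd'
      have h2 : d' ≠ d + 1 := by omega
      simp [Instr.run, Function.update_apply, hd'.ne, h2]
  | zero =>
    intro d s a h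
    refine ⟨_, _, .instr _ _, h.update_qreg _ _, ?_, ?_⟩
    · simp [Instr.run, QExp.eval]
    · intro d' hd'
      simp [Instr.run, hd'.ne]
  | add e f ihe ihf =>
    intro d s a h
    obtain ⟨B₁, s₁, hr₁, h₁, hv₁, hd₁⟩ := ihe d s a h
    obtain ⟨B₂, s₂, hr₂, h₂, hv₂, hd₂⟩ := ihf (d + 1) s₁ a h₁
    refine ⟨_, _, .seq hr₁ (.seq hr₂ (.instr _ _)), h₂.update_qreg _ _, ?_, ?_⟩
    · simp only [Instr.run, Function.update_self, hv₂, hd₂ d (by omega), hv₁]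
      rfl
    · intro d' hd'
      simp only [Instr.run, Function.update_apply, ne hd', if_false]
      rw [hd₂ d' (by omega), hd₁ d' hd']
  | sub e f ihe ihf =>
    intro d s a h
    obtain ⟨B₁, s₁, hr₁, h₁, hv₁, hd₁⟩ := ihe d s a h
    obtain ⟨B₂, s₂, hr₂, h₂, hv₂, hd₂⟩ := ihf (d + 1) s₁ a h₁
    refine ⟨_, _, .seq hr₁ (.seq hr₂ (.instr _ _)), h₂.update_qreg _ _, ?_, ?_⟩
    · simp only [Instr.run, Function.update_self, hv₂, hd₂ d (by omega), hv₁]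
      rfl
    · intro d' hd'
      simp only [Instr.run, Function.update_apply, ne hd', if_false]
      rw [hd₂ d' (by omega), hd₁ d' hd']
  | get t e =>
    intro d s a h
    obtain ⟨B₁, s₁, hr₁, h₁, hq₁, hv₁, hd₁⟩ := e.exec_compile E 0 s a h
    obtain ⟨B₂, s₂, hr₂, h₂, hq₂, hv₂, hd₂⟩ := exec_addressProgram E 0 t.idx s₁ h₁
    refine ⟨_, _, .seq hr₁ (.seq hr₂ (.instr _ _)), h₂.update_qreg _ _, ?_, ?_⟩
    · simp only [Instr.run, Function.update_self, hv₂, hv₁, h₂.qa]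
      rfl
    · intro d' hd'
      simp only [Instr.run, Function.update_apply, ne hd', if_false, hq₂, hq₁]
  | dist i j u v =>
    intro d s a h
    obtain ⟨B₁, s₁, hr₁, h₁, hq₁, hv₁, -⟩ := i.exec_compile E 0 s a h
    obtain ⟨B₂, s₂, hr₂, h₂, hq₂, hv₂, hd₂⟩ := j.exec_compile E 1 s₁ a h₁
    obtain ⟨B₃, s₃, hr₃, h₃, hq₃, hv₃, hd₃⟩ := u.exec_compile E 2 s₂ a h₂
    obtain ⟨B₄, s₄, hr₄, h₄, hq₄, hv₄, hd₄⟩ := v.exec_compile E 3 s₃ a h₃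
    refine ⟨_, _, .seq hr₁ (.seq hr₂ (.seq hr₃ (.seq hr₄ (.instr _ _)))), h₄.update_qreg _ _,
      ?_, ?_⟩
    · simp only [Instr.run, Function.update_self, hv₄, hd₄ 2 (by omega), hd₄ 1 (by omega),
        hd₄ 0 (by omega), hv₃, hd₃ 1 (by omega), hd₃ 0 (by omega), hv₂, hd₂ 0 (by omega), hv₁]
      rfl
    · intro d' hd'
      simp only [Instr.run, Function.update_apply, ne hd', if_false, hq₄, hq₃, hq₂, hq₁]
  | delG i u =>
    intro d s a h
    obtain ⟨B₁, s₁, hr₁, h₁, hq₁, hv₁, -⟩ := i.exec_compile E 0 s a h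
    obtain ⟨B₂, s₂, hr₂, h₂, hq₂, hv₂, hd₂⟩ := u.exec_compile E 1 s₁ a h₁
    refine ⟨_, _, .seq hr₁ (.seq hr₂ (.instr _ _)), h₂.update_qreg _ _, ?_, ?_⟩
    · simp only [Instr.run, Function.update_self, hv₂, hd₂ 0 (by omega), hv₁]
      rfl
    · intro d' hd'
      simp only [Instr.run, Function.update_apply, ne hd', if_false, hq₂, hq₁]
  | delH i u =>
    intro d s a h
    obtain ⟨B₁, s₁, hr₁, h₁, hq₁, hv₁, -⟩ := i.exec_compile E 0 s a h
    obtain ⟨B₂, s₂, hr₂, h₂, hq₂, hv₂, hd₂⟩ := u.exec_compile E 1 s₁ a h₁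
    refine ⟨_, _, .seq hr₁ (.seq hr₂ (.instr _ _)), h₂.update_qreg _ _, ?_, ?_⟩
    · simp only [Instr.run, Function.update_self, hv₂, hd₂ 0 (by omega), hv₁]
      rfl
    · intro d' hd'
      simp only [Instr.run, Function.update_apply, ne hd', if_false, hq₂, hq₁]

theorem Cond.exec_compile (E : Tables) (b : Cond) (s : State) (a : Mem) (h : Rep s a) :
    ∃ B s', Exec E b.compile s b.compile.cost B s' ∧ Rep s' a ∧
      (b.test.holds s' ↔ b.holds E a) := by
  cases b with
  | lt e f | eq e f =>
    obtain ⟨B₁, s₁, hr₁, h₁, hq₁, hv₁, hd₁⟩ := e.exec_compile E 0 s a h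
    obtain ⟨B₂, s₂, hr₂, h₂, hq₂, hv₂, hd₂⟩ := f.exec_compile E 1 s₁ a h₁
    refine ⟨_, _, .seq hr₁ hr₂, h₂, ?_⟩
    simp only [Cond.test, Test.holds, Cond.holds, hv₂, hd₂ 0 (by omega), hv₁]
  | qlt e f | qle e f =>
    obtain ⟨B₁, s₁, hr₁, h₁, hv₁, hd₁⟩ := e.exec_compile E 0 s a h
    obtain ⟨B₂, s₂, hr₂, h₂, hv₂, hd₂⟩ := f.exec_compile E 1 s₁ a h₁
    refine ⟨_, _, .seq hr₁ hr₂, h₂, ?_⟩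
    simp only [Cond.test, Test.holds, Cond.holds, hv₂, hd₂ 0 (by omega), hv₁]

/-- All arrays share one memory, interleaved modulo `8`: the residue of an address identifies the
array and the quotient the position, so distinct cells never collide. -/
theorem update_address {α : Type*} {ι : Type*} [DecidableEq ι] {idx : ι → ℕ}
    (hinj : Function.Injective idx) (hlt : ∀ t, idx t < 8) {mem : ℕ → α} {f : ι → ℕ → α}
    (h : ∀ t k, mem (8 * k + idx t) = f t k) (t : ι) (k : ℕ) (v : α) (t' : ι) (k' : ℕ) :
    Function.update mem (8 * k + idx t) v (8 * k' + idx t') =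
      Function.update f t (Function.update (f t) k v) t' k' := by
  have h1 := hlt t
  have h2 := hlt t'
  by_cases ht : t' = t
  · subst ht
    by_cases hk : k' = k
    · subst hk; simp
    · rw [Function.update_of_ne (by omega)]
      simp [hk, h]
  · have : idx t' ≠ idx t := fun e => ht (hinj e)
    rw [Function.update_of_ne (by omega), Function.update_of_ne ht, h]

/-- Every run of a command is simulated by its compilation, with constant overhead. -/
theorem Runs.exec_compile {E : Tables} {P : Cmd} {a a' : Mem} {m : ℕ} (hr : Runs E P a m a') :
    ∀ s, Rep s a → ∃ m' B s', Exec E P.compile s m' B s' ∧ m' ≤ P.compile.cost * m ∧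
      Rep s' a' := by
  induction hr with
  | skip a =>
    intro s h
    exact ⟨_, _, _, .instr _ _, by simp [Cmd.compile, Program.cost], h⟩
  | nset x e a =>
    intro s h
    obtain ⟨B₁, s₁, hr₁, h₁, hq₁, hv₁, hd₁⟩ := e.exec_compile E 0 s a h
    refine ⟨_, _, _, .seq hr₁ (.seq (.instr _ _) (.instr _ _)), ?_, ⟨?_, h₁.q, h₁.na, h₁.qa⟩⟩
    · simp [Cmd.compile, Program.cost]
    · intro y
      by_cases hy : y = x
      · subst hy
        simp [Instr.run, hv₁]
      · have hy' : y.idx ≠ x.idx := fun e => hy (NVar.idx_injective e)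
        simp [Instr.run, hy, hy', y.idx_ne_scratch, h₁.n]
  | qset x e a =>
    intro s h
    obtain ⟨B₁, s₁, hr₁, h₁, hv₁, hd₁⟩ := e.exec_compile E 0 s a h
    refine ⟨_, _, _, .seq hr₁ (.seq (.instr _ _) (.instr _ _)), ?_, ⟨h₁.n, ?_, h₁.na, h₁.qa⟩⟩
    · simp [Cmd.compile, Program.cost]
    · intro y
      by_cases hy : y = x
      · subst hy
        simp [Instr.run, hv₁]
      · have hy' : y.idx ≠ x.idx := fun e => hy (QVar.idx_injective e)
        simp [Instr.run, hy, hy', y.idx_ne_scratch, h₁.q]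
  | nput t e f a =>
    intro s h
    obtain ⟨B₁, s₁, hr₁, h₁, hq₁, hv₁, hd₁⟩ := f.exec_compile E 0 s a h
    obtain ⟨B₂, s₂, hr₂, h₂, hq₂, hv₂, hd₂⟩ := e.exec_compile E 1 s₁ a h₁
    obtain ⟨B₃, s₃, hr₃, h₃, hq₃, hv₃, hd₃⟩ := exec_addressProgram E 1 t.idx s₂ h₂
    refine ⟨_, _, _, .seq hr₁ (.seq hr₂ (.seq hr₃ (.instr _ _))), ?_,
      ⟨h₃.n, h₃.q, ?_, h₃.qa⟩⟩
    · simp [Cmd.compile, Program.cost, addressProgram]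
    · intro t' k'
      simp only [Instr.run, hv₃, hv₂, hd₃ 0 (by omega), hd₂ 0 (by omega), hv₁]
      exact update_address NArr.idx_injective NArr.idx_lt h₃.na _ _ _ _ _
  | qput t e f a =>
    intro s h
    obtain ⟨B₁, s₁, hr₁, h₁, hv₁, hd₁⟩ := f.exec_compile E 0 s a h
    obtain ⟨B₂, s₂, hr₂, h₂, hq₂, hv₂, hd₂⟩ := e.exec_compile E 0 s₁ a h₁
    obtain ⟨B₃, s₃, hr₃, h₃, hq₃, hv₃, hd₃⟩ := exec_addressProgram E 0 t.idx s₂ h₂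
    refine ⟨_, _, _, .seq hr₁ (.seq hr₂ (.seq hr₃ (.instr _ _))), ?_,
      ⟨h₃.n, h₃.q, h₃.na, ?_⟩⟩
    · simp [Cmd.compile, Program.cost, addressProgram]
    · intro t' k'
      simp only [Instr.run, hv₃, hv₂, hq₃, hq₂, hv₁]
      exact update_address QArr.idx_injective QArr.idx_lt h₃.qa _ _ _ _ _
  | seq _ _ ih₁ ih₂ =>
    intro s h
    obtain ⟨m₁, B₁, s₁, hr₁, hm₁, h₁⟩ := ih₁ s h
    obtain ⟨m₂, B₂, s₂, hr₂, hm₂, h₂⟩ := ih₂ s₁ h₁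
    refine ⟨_, _, _, .seq hr₁ hr₂, ?_, h₂⟩
    simp only [Cmd.compile, Program.cost]
    nlinarith
  | @ite_true b P Q a a' m hb _ ih =>
    intro s h
    obtain ⟨B₁, s₁, hr₁, h₁, ht⟩ := b.exec_compile E s a h
    obtain ⟨m₂, B₂, s₂, hr₂, hm₂, h₂⟩ := ih s₁ h₁
    refine ⟨_, _, _, .seq hr₁ (.ite_true (ht.2 hb) hr₂), ?_, h₂⟩
    simp only [Cmd.compile, Program.cost]
    nlinarith
  | @ite_false b P Q a a' m hb _ ih =>
    intro s h
    obtain ⟨B₁, s₁, hr₁, h₁, ht⟩ := b.exec_compile E s a h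
    obtain ⟨m₂, B₂, s₂, hr₂, hm₂, h₂⟩ := ih s₁ h₁
    refine ⟨_, _, _, .seq hr₁ (.ite_false (fun h => hb (ht.1 h)) hr₂), ?_, h₂⟩
    simp only [Cmd.compile, Program.cost]
    nlinarith
  | @while_done b P a hb =>
    intro s h
    obtain ⟨B₁, s₁, hr₁, h₁, ht⟩ := b.exec_compile E s a h
    refine ⟨_, _, _, .seq hr₁ (.loop_done (fun h => hb (ht.1 h))), ?_, h₁⟩
    simp only [Cmd.compile, Program.cost]
    omega
  | @while_step b P a₁ a₂ a₃ m₁ m₂ hb _ _ ih₁ ih₂ =>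
    intro s h
    obtain ⟨B₁, s₁, hr₁, h₁, ht⟩ := b.exec_compile E s a₁ h
    obtain ⟨m₂', B₂, s₂, hr₂, hm₂, h₂⟩ := ih₁ s₁ h₁
    obtain ⟨m₃, B₃, s₃, hr₃, hm₃, h₃⟩ := ih₂ s₂ h₂
    -- The compiled remainder of the loop begins by evaluating the condition. This evaluation is
    -- split off and becomes the end of the current round's body.
    cases hr₃ with
    | seq hrb hrl =>
      refine ⟨_, _, _, .seq hr₁ (.loop_step (ht.2 hb) (.seq hr₂ hrb) hrl), ?_, h₃⟩
      simp only [Cmd.compile, Program.cost] at hm₃ ⊢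
      nlinarith


/-! ## Enumerating and counting warping paths -/

/-- Change of the row in the move `m`: the moves `0`, `1`, `2` are `(1, 1)`, `(1, 0)`, `(0, 1)`. -/
def rowStep (m : ℕ) : ℕ := if m < 2 then 1 else 0

/-- Change of the column in the move `m`. -/
def colStep (m : ℕ) : ℕ := if m = 0 ∨ m = 2 then 1 else 0

/-- The moves that can be undone at `(i, j)`. -/
def backMoves (i j : ℕ) : Finset ℕ :=
  (Finset.range 3).filter fun m => rowStep m ≤ i ∧ colStep m ≤ j

/-- The warping paths from `(0, 0)` to `(i, j)` with at most `r` moves, listed backwards. -/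
def backPaths : ℕ → ℕ → ℕ → Finset (List (ℕ × ℕ))
  | 0, i, j => if i = 0 ∧ j = 0 then {[(0, 0)]} else ∅
  | r + 1, i, j =>
    if i = 0 ∧ j = 0 then {[(0, 0)]} else
      ((backMoves i j).biUnion fun m => backPaths r (i - rowStep m) (j - colStep m)).image
        (List.cons (i, j))

theorem backPaths_zero_zero (r : ℕ) : backPaths r 0 0 = {[(0, 0)]} := by
  cases r <;> simp [backPaths]

theorem backPaths_zero_of_ne {i j : ℕ} (h : ¬ (i = 0 ∧ j = 0)) : backPaths 0 i j = ∅ := by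
  simp only [backPaths, if_neg h]

theorem mem_backPaths_succ {r i j : ℕ} (h : ¬ (i = 0 ∧ j = 0)) {l : List (ℕ × ℕ)} :
    l ∈ backPaths (r + 1) i j ↔ ∃ m ∈ backMoves i j, ∃ l' ∈ backPaths r (i - rowStep m)
      (j - colStep m), l = (i, j) :: l' := by
  simp only [backPaths, if_neg h, Finset.mem_image, Finset.mem_biUnion]
  constructor
  · rintro ⟨l', ⟨m, hm, hl'⟩, rfl⟩
    exact ⟨m, hm, l', hl', rfl⟩
  · rintro ⟨m, hm, l', hl', rfl⟩
    exact ⟨l', ⟨m, hm, hl'⟩, rfl⟩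

theorem mem_backMoves {i j m : ℕ} :
    m ∈ backMoves i j ↔ m < 3 ∧ rowStep m ≤ i ∧ colStep m ≤ j := by
  simp [backMoves]

theorem head?_of_mem_backPaths {r i j : ℕ} {l : List (ℕ × ℕ)} (hl : l ∈ backPaths r i j) :
    l.head? = some (i, j) := by
  by_cases h : i = 0 ∧ j = 0
  · obtain ⟨rfl, rfl⟩ := h
    rw [backPaths_zero_zero, Finset.mem_singleton] at hl
    simp [hl]
  · cases r with
    | zero => simp [backPaths_zero_of_ne h] at hl
    | succ r =>
      obtain ⟨m, -, l', -, rfl⟩ := (mem_backPaths_succ h).1 hl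
      rfl

/-- `b` is the predecessor of `a` for one of the three moves. -/
def BackStep (a b : ℕ × ℕ) : Prop :=
  (a.1 = b.1 + 1 ∧ a.2 = b.2 + 1) ∨ (a.1 = b.1 ∧ a.2 = b.2 + 1) ∨ (a.1 = b.1 + 1 ∧ a.2 = b.2)

theorem backStep_iff {i j : ℕ} {b : ℕ × ℕ} :
    BackStep (i, j) b ↔ ∃ m ∈ backMoves i j, b = (i - rowStep m, j - colStep m) := by
  obtain ⟨b₁, b₂⟩ := b
  simp only [BackStep, Prod.mk.injEq]
  constructor
  · rintro (h | h | h)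
    · exact ⟨0, by simp [mem_backMoves, rowStep, colStep]; omega, by simp [rowStep, colStep]; omega⟩
    · exact ⟨2, by simp [mem_backMoves, rowStep, colStep]; omega, by simp [rowStep, colStep]; omega⟩
    · exact ⟨1, by simp [mem_backMoves, rowStep, colStep]; omega, by simp [rowStep, colStep]; omega⟩
  · rintro ⟨m, hm, h₁, h₂⟩
    obtain ⟨hm, hr, hc⟩ := mem_backMoves.1 hm
    interval_cases m <;> simp [rowStep, colStep] at * <;> omega

/-- Replaces the recursion by conditions on lists that mirror the definition of a warping path.
Stopping at `(0, 0)` loses nothing because no cell precedes it, and `r` moves visit `r + 1` cells.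
-/
theorem mem_backPaths_iff (r : ℕ) : ∀ (i j : ℕ) (l : List (ℕ × ℕ)), l ∈ backPaths r i j ↔
    l.head? = some (i, j) ∧ l.getLast? = some (0, 0) ∧ l.IsChain BackStep ∧
      l.length ≤ r + 1 := by
  have key : ∀ l : List (ℕ × ℕ), (l.head? = some (0, 0) ∧ l.getLast? = some (0, 0) ∧
      l.IsChain BackStep) ↔ l = [(0, 0)] := by
    intro l
    constructor
    · rintro ⟨h₁, -, h₃⟩
      match l, h₁, h₃ with
      | [a], h₁, _ => simpa using h₁
      | a :: b :: l, h₁, h₃ =>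
        have := (List.isChain_cons_cons.1 h₃).1
        simp only [List.head?_cons, Option.some.injEq] at h₁
        subst h₁
        simp [BackStep] at this
    · rintro rfl
      simp
  induction r with
  | zero =>
    intro i j l
    by_cases h : i = 0 ∧ j = 0
    · obtain ⟨rfl, rfl⟩ := h
      rw [backPaths_zero_zero, Finset.mem_singleton]
      constructor
      · rintro rfl; simp
      · rintro ⟨h₁, h₂, h₃, -⟩; exact (key l).1 ⟨h₁, h₂, h₃⟩
    · rw [backPaths_zero_of_ne h]
      simp only [Finset.notMem_empty, false_iff]
      rintro ⟨h₁, h₂, -, h₄⟩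
      match l, h₁, h₂, h₄ with
      | [a], h₁, h₂, _ =>
        simp only [List.head?_cons, List.getLast?_singleton, Option.some.injEq] at h₁ h₂
        simp [h₁] at h₂
        omega
  | succ r ih =>
    intro i j l
    by_cases h : i = 0 ∧ j = 0
    · obtain ⟨rfl, rfl⟩ := h
      rw [backPaths_zero_zero, Finset.mem_singleton]
      constructor
      · rintro rfl; simp
      · rintro ⟨h₁, h₂, h₃, -⟩; exact (key l).1 ⟨h₁, h₂, h₃⟩
    · rw [mem_backPaths_succ h]
      constructor
      · rintro ⟨m, hm, l', hl', rfl⟩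
        obtain ⟨h₁, h₂, h₃, h₄⟩ := (ih _ _ _).1 hl'
        refine ⟨rfl, ?_, ?_, by simpa using h₄⟩
        · rw [List.getLast?_cons, h₂]; rfl
        · rw [List.isChain_cons]
          refine ⟨fun y hy => ?_, h₃⟩
          rw [h₁] at hy
          exact backStep_iff.2 ⟨m, hm, by simpa using hy.symm⟩
      · rintro ⟨h₁, h₂, h₃, h₄⟩
        match l, h₁, h₂, h₃, h₄ with
        | [a], h₁, h₂, _, _ =>
          simp only [List.head?_cons, List.getLast?_singleton, Option.some.injEq] at h₁ h₂
          simp [h₁] at h₂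
          omega
        | a :: b :: l, h₁, h₂, h₃, h₄ =>
          simp only [List.head?_cons, Option.some.injEq] at h₁
          subst h₁
          obtain ⟨hab, h₃⟩ := List.isChain_cons_cons.1 h₃
          obtain ⟨m, hm, rfl⟩ := backStep_iff.1 hab
          refine ⟨m, hm, _, (ih _ _ _).2 ⟨rfl, ?_, h₃, by simpa using h₄⟩, rfl⟩
          rwa [List.getLast?_cons_cons] at h₂

theorem chain_backStep_le {i j : ℕ} : ∀ {l : List (ℕ × ℕ)}, l.IsChain BackStep →
    l.head? = some (i, j) → ∀ c ∈ l, c.1 ≤ i ∧ c.2 ≤ j := by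
  intro l
  induction l generalizing i j with
  | nil => simp
  | cons a l ih =>
    intro h₁ h₂ c hc
    simp only [List.head?_cons, Option.some.injEq] at h₂
    subst h₂
    rcases List.mem_cons.1 hc with rfl | hc
    · simp
    · cases l with
      | nil => simp at hc
      | cons b l =>
        obtain ⟨hab, h₁⟩ := List.isChain_cons_cons.1 h₁
        have := ih h₁ (i := b.1) (j := b.2) rfl c hc
        simp only [BackStep] at hab
        omega

/-- Every step lowers the sum of the coordinates. Hence the cells of a path are distinct, and their
order can be recovered from the set. -/
theorem chain_backStep_pairwise {l : List (ℕ × ℕ)} (h : l.IsChain BackStep) :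
    l.Pairwise fun a b => b.1 + b.2 < a.1 + a.2 := by
  let R : ℕ × ℕ → ℕ × ℕ → Prop := fun a b => b.1 + b.2 < a.1 + a.2
  have : Trans R R R := ⟨fun h h' => lt_trans h' h⟩
  change l.Pairwise R
  refine List.IsChain.pairwise (h.imp fun a b hab => ?_)
  simp only [BackStep] at hab
  simp only [R]
  omega

theorem chain_backStep_nodup {l : List (ℕ × ℕ)} (h : l.IsChain BackStep) : l.Nodup :=
  (chain_backStep_pairwise h).imp fun hab e => by simp [e] at hab

/-! ### Warping paths as sets and as lists of cells -/

/-- The cell of a pair of layers. -/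
def cell {T U : ℕ} (a : Fin T × Fin U) : ℕ × ℕ := (a.1.val, a.2.val)

theorem cell_injective {T U : ℕ} : Function.Injective (cell (T := T) (U := U)) := by
  rintro ⟨a, b⟩ ⟨c, d⟩ h
  simpa [cell, Fin.ext_iff] using h

/-- The warping path formed by the cells of a list. -/
def pathOfList (T U : ℕ) (l : List (ℕ × ℕ)) : Finset (Fin T × Fin U) :=
  Finset.univ.filter fun a => cell a ∈ l

theorem mem_pathOfList {T U : ℕ} {l : List (ℕ × ℕ)} {a : Fin T × Fin U} :
    a ∈ pathOfList T U l ↔ cell a ∈ l := by simp [pathOfList]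

theorem exists_map_cell {T U : ℕ} {l : List (ℕ × ℕ)} (h : ∀ c ∈ l, c.1 < T ∧ c.2 < U) :
    ∃ l' : List (Fin T × Fin U), l'.map cell = l := by
  have : l ∈ Set.range (List.map (cell (T := T) (U := U))) := by
    rw [Set.range_list_map]
    intro c hc
    exact ⟨(⟨c.1, (h c hc).1⟩, ⟨c.2, (h c hc).2⟩), rfl⟩
  exact this

section

variable {T U L : ℕ}

theorem pathOfList_map_cell (l : List (Fin T × Fin U)) :
    pathOfList T U (l.map cell) = l.toFinset := by
  ext a
  rw [mem_pathOfList, List.mem_map_of_injective cell_injective, List.mem_toFinset]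

theorem chain_map_cell_reverse {l : List (Fin T × Fin U)} :
    (l.map cell).reverse.IsChain BackStep ↔ l.IsChain IsWarpingStep := by
  rw [List.isChain_reverse, List.isChain_map]
  rfl

/-- The lists run backwards with indices from `0`, which turns the end `(T, U)` into `(T - 1, U -
1)` and a length of `L` cells into `L - 1` moves. -/
theorem mem_warpingPaths_iff (hT : 1 ≤ T) (hU : 1 ≤ U) (hL : 1 ≤ L)
    {p : Finset (Fin T × Fin U)} :
    p ∈ warpingPaths T U L ↔
      ∃ l ∈ backPaths (L - 1) (T - 1) (U - 1), pathOfList T U l = p := by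
  simp only [warpingPaths, Finset.mem_filter, Finset.mem_univ, true_and]
  constructor
  · rintro ⟨⟨l, rfl, ⟨a, ha, ha₁, ha₂⟩, ⟨b, hb, hb₁, hb₂⟩, hc⟩, hcard⟩
    have hc' := chain_map_cell_reverse.2 hc
    have hnd := chain_backStep_nodup hc'
    have hnd' : l.Nodup := (List.nodup_reverse.1 hnd).of_map _
    rw [List.toFinset_card_of_nodup hnd'] at hcard
    refine ⟨(l.map cell).reverse, (mem_backPaths_iff _ _ _ _).2 ⟨?_, ?_, hc', ?_⟩, ?_⟩
    · rw [List.head?_reverse, List.getLast?_map, Option.mem_def.1 hb]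
      simp [cell]
      omega
    · rw [List.getLast?_reverse, List.head?_map, Option.mem_def.1 ha]
      simp [cell, ha₁, ha₂]
    · simp
      omega
    · ext a
      rw [mem_pathOfList, List.mem_reverse, List.mem_map_of_injective cell_injective,
        List.mem_toFinset]
  · rintro ⟨l, hl, rfl⟩
    obtain ⟨h₁, h₂, h₃, h₄⟩ := (mem_backPaths_iff _ _ _ _).1 hl
    obtain ⟨l', rfl⟩ := exists_map_cell (T := T) (U := U) (l := l) fun c hc => by
      have := chain_backStep_le h₃ h₁ c hc
      omega
    have hnd : l'.Nodup := (chain_backStep_nodup h₃).of_map _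
    rw [pathOfList_map_cell]
    refine ⟨⟨l'.reverse, by simp, ?_, ?_, ?_⟩, ?_⟩
    · rw [List.getLast?_map, Option.map_eq_some_iff] at h₂
      obtain ⟨a, ha, ha'⟩ := h₂
      refine ⟨a, by rw [List.head?_reverse, ha]; rfl, ?_⟩
      simpa [cell] using ha'
    · rw [List.head?_map, Option.map_eq_some_iff] at h₁
      obtain ⟨a, ha, ha'⟩ := h₁
      refine ⟨a, by rw [List.getLast?_reverse, ha]; rfl, ?_⟩
      simp only [cell, Prod.mk.injEq] at ha'
      omega
    · rw [← chain_map_cell_reverse]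
      simpa using h₃
    · rw [List.toFinset_card_of_nodup hnd]
      simp at h₄
      omega

/-- Two lists with the same cells are permutations of each other, and both are strictly sorted by
the coordinate sum, so they coincide. -/
theorem pathOfList_injOn {r : ℕ} (hT : 1 ≤ T) (hU : 1 ≤ U) :
    Set.InjOn (pathOfList T U) (backPaths r (T - 1) (U - 1) : Set (List (ℕ × ℕ))) := by
  intro l hl l' hl' h
  obtain ⟨h₁, -, h₃, -⟩ := (mem_backPaths_iff _ _ _ _).1 (Finset.mem_coe.1 hl)
  obtain ⟨h₁', -, h₃', -⟩ := (mem_backPaths_iff _ _ _ _).1 (Finset.mem_coe.1 hl')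
  refine List.Perm.eq_of_pairwise (fun a b _ _ hab hba => absurd hab (lt_asymm hba))
    (chain_backStep_pairwise h₃) (chain_backStep_pairwise h₃')
    ((List.perm_ext_iff_of_nodup (chain_backStep_nodup h₃) (chain_backStep_nodup h₃')).2 ?_)
  have aux : ∀ {k k' : List (ℕ × ℕ)}, (∀ c ∈ k, c.1 ≤ T - 1 ∧ c.2 ≤ U - 1) →
      pathOfList T U k = pathOfList T U k' → ∀ c ∈ k, c ∈ k' := by
    intro k k' hk he c hc
    have hlt := hk c hc
    have : ((⟨c.1, by omega⟩, ⟨c.2, by omega⟩) : Fin T × Fin U) ∈ pathOfList T U k :=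
      mem_pathOfList.2 hc
    rw [he] at this
    exact mem_pathOfList.1 this
  exact fun c => ⟨aux (chain_backStep_le h₃ h₁) h c, aux (chain_backStep_le h₃' h₁') h.symm c⟩

theorem card_warpingPaths (hT : 1 ≤ T) (hU : 1 ≤ U) (hL : 1 ≤ L) :
    (warpingPaths T U L).card = (backPaths (L - 1) (T - 1) (U - 1)).card := by
  have : warpingPaths T U L = (backPaths (L - 1) (T - 1) (U - 1)).image (pathOfList T U) := by
    ext p
    rw [mem_warpingPaths_iff hT hU hL, Finset.mem_image]
  rw [this, Finset.card_image_of_injOn (pathOfList_injOn hT hU)]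

theorem sum_pathOfList {r : ℕ} (hT : 1 ≤ T) (hU : 1 ≤ U) {l : List (ℕ × ℕ)}
    (hl : l ∈ backPaths r (T - 1) (U - 1)) (f : ℕ × ℕ → ℚ) :
    ∑ a ∈ pathOfList T U l, f (cell a) = (l.map f).sum := by
  obtain ⟨h₁, -, h₃, -⟩ := (mem_backPaths_iff _ _ _ _).1 hl
  obtain ⟨l', rfl⟩ := exists_map_cell (T := T) (U := U) (l := l) fun c hc => by
    have := chain_backStep_le h₃ h₁ c hc
    omega
  rw [pathOfList_map_cell, List.sum_toFinset _ ((chain_backStep_nodup h₃).of_map _), List.map_map]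
  rfl

end

/-! ### Counting warping paths by their number of moves -/

/-- The number of warping paths to `(i, j)` with exactly `s` moves. -/
def pathCount (s i j : ℕ) : ℕ := if j ≤ s then s.choose i * i.choose (s - j) else 0

/-- The closed form counts the choices of the `i` moves that change the row, and among them of the
`s - j` moves that do not change the column. It obeys the recursion over the available moves by
Pascal's rule for both binomial coefficients; the guard `j ≤ s` keeps truncated subtraction from
producing spurious terms. -/
theorem pathCount_succ (s i j : ℕ) (h : ¬ (i = 0 ∧ j = 0)) :
    pathCount (s + 1) i j = ∑ m ∈ backMoves i j, pathCount s (i - rowStep m) (j - colStep m) := by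
  rw [backMoves, Finset.sum_filter]
  simp only [Finset.sum_range_succ, Finset.sum_range_zero]
  rcases i with - | i <;> rcases j with - | j
  · simp at h
  · simp [rowStep, colStep, pathCount]
  · simp only [rowStep, colStep, pathCount]
    rcases lt_trichotomy s i with hs | rfl | hs
    · simp [Nat.choose_eq_zero_of_lt hs, Nat.choose_eq_zero_of_lt (Nat.succ_lt_succ hs)]
    · simp
    · simp [Nat.choose_eq_zero_of_lt hs]
      right
      exact Nat.choose_eq_zero_of_lt (by omega)
  · simp only [rowStep, colStep, pathCount]
    rcases lt_trichotomy s j with hs | rfl | hs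
    · simp [show ¬ j ≤ s by omega, show ¬ j < s by omega]
    · simp [Nat.choose_succ_succ]
    -- Writing `s` through the excess `d` removes every truncated subtraction, after which Pascal's
    -- rule applies twice.
    · obtain ⟨d, rfl⟩ : ∃ d, s = j + 1 + d := ⟨s - (j + 1), by omega⟩
      have e1 : j + 1 + d + 1 - (j + 1) = d + 1 := by omega
      have e2 : j + 1 + d - j = d + 1 := by omega
      have e3 : j + 1 + d - (j + 1) = d := by omega
      have l1 : j + 1 ≤ j + 1 + d + 1 := by omega
      have l2 : j ≤ j + 1 + d := by omega
      simp [e1, e2, e3, l1, l2, Nat.choose_succ_succ (j + 1 + d) i, Nat.choose_succ_succ i d]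
      ring

/-- Continuations by different moves start in different cells, so the union in the recursion is
disjoint and the cardinalities satisfy the recursion of `pathCount`. -/
theorem card_backPaths (r : ℕ) : ∀ i j : ℕ,
    (backPaths r i j).card = ∑ s ∈ Finset.range (r + 1), pathCount s i j := by
  have hz : ∀ r, ∑ s ∈ Finset.range (r + 1), pathCount s 0 0 = 1 := by
    intro r
    rw [Finset.sum_range_succ']
    simp [pathCount]
  induction r with
  | zero =>
    intro i j
    by_cases h : i = 0 ∧ j = 0
    · obtain ⟨rfl, rfl⟩ := h
      rw [backPaths_zero_zero, hz]
      rfl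
    · rw [backPaths_zero_of_ne h]
      rcases i with - | i <;> rcases j with - | j <;> simp_all [pathCount]
  | succ r ih =>
    intro i j
    by_cases h : i = 0 ∧ j = 0
    · obtain ⟨rfl, rfl⟩ := h
      rw [backPaths_zero_zero, hz]
      rfl
    · have h0 : pathCount 0 i j = 0 := by
        rcases i with - | i <;> rcases j with - | j <;> simp_all [pathCount]
      -- The term without moves vanishes away from `(0, 0)`, and the remaining terms have the shape
      -- `s + 1` required by the recursion.
      rw [Finset.sum_range_succ', h0, add_zero]
      simp only [backPaths, if_neg h]
      rw [Finset.card_image_of_injective _ List.cons_injective, Finset.card_biUnion]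
      · simp only [ih, pathCount_succ _ _ _ h]
        rw [Finset.sum_comm]
      · intro m hm m' hm' hne
        rw [Function.onFun, Finset.disjoint_left]
        intro l hl hl'
        have := (head?_of_mem_backPaths hl).symm.trans (head?_of_mem_backPaths hl')
        obtain ⟨hm, h1, h2⟩ := mem_backMoves.1 (Finset.mem_coe.1 hm)
        obtain ⟨hm', h1', h2'⟩ := mem_backMoves.1 (Finset.mem_coe.1 hm')
        simp only [Option.some.injEq, Prod.mk.injEq] at this
        interval_cases m <;> interval_cases m' <;> simp [rowStep, colStep] at * <;> omega

/-- Here `U + t` and `U` are the distances to be covered, one less than the lifetimes. Fewer than `U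
+ t` moves cannot cover the rows, so only `s = U + t + l` contributes, and symmetry of the first
binomial coefficient gives the form stated. -/
theorem card_backPaths_closed (U t lam : ℕ) :
    (backPaths (U + t + lam) (U + t) U).card =
      ∑ l ∈ Finset.range (lam + 1), (U + t + l).choose l * (U + t).choose (l + t) := by
  rw [card_backPaths, show U + t + lam + 1 = U + t + (lam + 1) by omega, Finset.sum_range_add,
    Finset.sum_eq_zero, zero_add]
  · refine Finset.sum_congr rfl fun l _ => ?_
    rw [pathCount, if_pos (by omega), show U + t + l - U = l + t by omega,
      Nat.choose_symm_add]
  · intro s hs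
    rw [pathCount, Nat.choose_eq_zero_of_lt (Finset.mem_range.1 hs)]
    simp

theorem card_warpingPaths_closed (T U t lam : ℕ) (hU : 1 ≤ U) (hT : T = U + t) :
    (warpingPaths T U (T + lam)).card =
      ∑ l ∈ Finset.range (lam + 1), (T + l - 1).choose l * (T - 1).choose (l + t) := by
  obtain ⟨U, rfl⟩ : ∃ V, U = V + 1 := ⟨U - 1, by omega⟩
  subst hT
  rw [card_warpingPaths (by omega) (by omega) (by omega)]
  have e1 : U + 1 + t + lam - 1 = U + t + lam := by omega
  have e2 : U + 1 + t - 1 = U + t := by omega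
  rw [e1, e2, Nat.add_sub_cancel, card_backPaths_closed]
  refine Finset.sum_congr rfl fun l _ => ?_
  rw [show U + 1 + t + l - 1 = U + t + l by omega]

/-- A move lowers each coordinate by at most one, and diagonal moves as long as possible attain the
maximum of `i` and `j`. This is the criterion by which the search prunes. -/
theorem backPaths_nonempty_iff (r : ℕ) : ∀ i j : ℕ,
    (backPaths r i j).Nonempty ↔ i ≤ r ∧ j ≤ r := by
  induction r with
  | zero =>
    intro i j
    by_cases h : i = 0 ∧ j = 0
    · simp [h.1, h.2, backPaths_zero_zero]
    · rw [backPaths_zero_of_ne h]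
      simp [h]
  | succ r ih =>
    intro i j
    by_cases h : i = 0 ∧ j = 0
    · simp [h.1, h.2, backPaths_zero_zero]
    · simp only [backPaths, if_neg h, Finset.image_nonempty, Finset.biUnion_nonempty, ih]
      constructor
      · rintro ⟨m, hm, h1, h2⟩
        obtain ⟨hm, h3, h4⟩ := mem_backMoves.1 hm
        simp only [rowStep, colStep] at *
        split_ifs at * <;> omega
      · rintro ⟨h1, h2⟩
        by_cases hi : i = 0
        · exact ⟨2, by simp [mem_backMoves, rowStep, colStep]; omega,
            by simp [rowStep, colStep]; omega⟩
        · by_cases hj : j = 0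
          · exact ⟨1, by simp [mem_backMoves, rowStep, colStep]; omega,
              by simp [rowStep, colStep]; omega⟩
          · exact ⟨0, by simp [mem_backMoves, rowStep, colStep]; omega,
              by simp [rowStep, colStep]; omega⟩

/-- A bound on the number of warping paths. -/
theorem card_backPaths_le (T U t lam : ℕ) (hU : 1 ≤ U) (hT : T = U + t) :
    (backPaths (T + lam - 1) (T - 1) (U - 1)).card ≤
      2 * ((T + lam) ^ lam * T ^ (lam + t)) := by
  -- A geometric sum is at most twice its last term if the ratio is at least `2`. The ratio `(T +
  -- lam) * T` can be smaller only for `lam = 0`, where there is a single term.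
  have hgeom : ∀ X : ℕ, ∀ n, 2 ≤ X ∨ n = 0 → ∑ l ∈ Finset.range (n + 1), X ^ l ≤ 2 * X ^ n := by
    rintro X n (hX | rfl)
    · induction n with
      | zero => simp
      | succ n ih =>
        rw [Finset.sum_range_succ, pow_succ]
        nlinarith [Nat.pow_pos (n := n) (show 0 < X by omega)]
    · simp
  rw [← card_warpingPaths (by omega) hU (by omega), card_warpingPaths_closed T U t lam hU hT]
  calc ∑ l ∈ Finset.range (lam + 1), (T + l - 1).choose l * (T - 1).choose (l + t)
      ≤ ∑ l ∈ Finset.range (lam + 1), ((T + lam) * T) ^ l * T ^ t := by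
        refine Finset.sum_le_sum fun l hl => ?_
        have hl' : l ≤ lam := by simpa [Nat.lt_succ_iff] using hl
        rw [mul_pow, mul_assoc, ← pow_add]
        exact Nat.mul_le_mul
          ((Nat.choose_le_pow _ _).trans (Nat.pow_le_pow_left (by omega) _))
          ((Nat.choose_le_pow _ _).trans (Nat.pow_le_pow_left (by omega) _))
    _ ≤ (2 * ((T + lam) * T) ^ lam) * T ^ t := by
        rw [← Finset.sum_mul]
        refine Nat.mul_le_mul_right _ (hgeom _ _ ?_)
        by_cases h : lam = 0
        · exact Or.inr h
        · left
          have h1 : 2 ≤ T + lam := by omega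
          have h2 : 1 ≤ T := by omega
          nlinarith
    _ = 2 * ((T + lam) ^ lam * T ^ (lam + t)) := by rw [mul_pow, pow_add]; ring


/-! ## Reduction to assignment problems -/

/-- Used to complete a vertex mapping to a permutation of the padded vertex set. -/
theorem exists_perm_extending {ι α : Type*} [Finite α] {f g : ι → α}
    (hf : Function.Injective f) (hg : Function.Injective g) :
    ∃ σ : Equiv.Perm α, ∀ i, σ (f i) = g i := by
  classical
  have := Fintype.ofFinite α
  let e : {x // x ∈ Set.range f} ≃ {x // x ∈ Set.range g} :=
    (Equiv.ofInjective f hf).symm.trans (Equiv.ofInjective g hg)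
  refine ⟨e.extendSubtype, fun i => ?_⟩
  rw [e.extendSubtype_apply_of_mem _ ⟨i, rfl⟩]
  have : (Equiv.ofInjective f hf).symm ⟨f i, ⟨i, rfl⟩⟩ = i :=
    (Equiv.symm_apply_eq _).2 rfl
  simp only [e, Equiv.trans_apply, this]
  rfl

namespace Instance

variable (x : Instance)

/-- The vertices of both graphs, padded to the larger number. -/
def padV (u : Fin x.nV) : Fin x.n := Fin.castLE (show x.nV ≤ x.n from le_max_left _ _) u

def padW (v : Fin x.nW) : Fin x.n := Fin.castLE (show x.nW ≤ x.n from le_max_right _ _) v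

/-- The cost of assigning `u` to `v` in the layers `i` and `j`, where vertices out of range stand
for deletion. -/
def weight (i j u v : ℕ) : ℚ :=
  if u < x.nV then (if v < x.nW then x.tables.dist i j u v else x.tables.delG i u)
  else x.tables.delH j v

/-- The cost of assigning `u` to `v` along a list of pairs of layers. -/
def pathWeight (l : List (ℕ × ℕ)) (u v : ℕ) : ℚ := (l.map fun c => x.weight c.1 c.2 u v).sum

/-- The vertex mapping induced by a permutation of the padded vertex set. -/
def mappingOfPerm (σ : Equiv.Perm (Fin x.n)) : Finset (Fin x.nV × Fin x.nW) :=
  Finset.univ.filter fun a => σ (x.padV a.1) = x.padW a.2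

variable {x}

theorem padV_injective : Function.Injective x.padV :=
  Fin.castLE_injective (le_max_left x.nV x.nW)

theorem padW_injective : Function.Injective x.padW :=
  Fin.castLE_injective (le_max_right x.nV x.nW)

theorem exists_padV {u : Fin x.n} (h : u.val < x.nV) : ∃ u', x.padV u' = u := ⟨⟨u, h⟩, rfl⟩

theorem exists_padW {v : Fin x.n} (h : v.val < x.nW) : ∃ v', x.padW v' = v := ⟨⟨v, h⟩, rfl⟩

theorem mem_mappingOfPerm {σ : Equiv.Perm (Fin x.n)} {a : Fin x.nV × Fin x.nW} :
    a ∈ x.mappingOfPerm σ ↔ σ (x.padV a.1) = x.padW a.2 := by simp [mappingOfPerm]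

theorem mem_vertexMappings {M : Finset (Fin x.nV × Fin x.nW)} :
    M ∈ vertexMappings (Fin x.nV) (Fin x.nW) ↔ IsVertexMapping M := by simp [vertexMappings]

/-- At most the smaller vertex set is padded, so a dummy is never assigned to a dummy; `weight`
needs no case for that. -/
theorem lt_or_lt (u v : Fin x.n) : u.val < x.nV ∨ v.val < x.nW := by
  have h1 := u.isLt
  have h2 := v.isLt
  unfold n at h1 h2
  omega

theorem isVertexMapping_mappingOfPerm (σ : Equiv.Perm (Fin x.n)) :
    IsVertexMapping (x.mappingOfPerm σ) := by
  have hinj1 : ∀ a ∈ x.mappingOfPerm σ, ∀ b ∈ x.mappingOfPerm σ, a.1 = b.1 → a = b := by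
    intro a ha b hb h
    rw [mem_mappingOfPerm] at ha hb
    refine Prod.ext h (padW_injective ?_)
    rw [← ha, ← hb, h]
  have hinj2 : ∀ a ∈ x.mappingOfPerm σ, ∀ b ∈ x.mappingOfPerm σ, a.2 = b.2 → a = b := by
    intro a ha b hb h
    rw [mem_mappingOfPerm] at ha hb
    refine Prod.ext (padV_injective (σ.injective ?_)) h
    rw [ha, hb, h]
  refine ⟨?_, hinj1, hinj2⟩
  rcases le_total x.nV x.nW with h | h
  · rw [Fintype.card_fin, Fintype.card_fin, min_eq_left h,
      ← Finset.card_image_of_injOn (f := Prod.fst) (fun a ha b hb hab => hinj1 a ha b hb hab)]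
    have : (x.mappingOfPerm σ).image Prod.fst = Finset.univ := by
      refine Finset.eq_univ_of_forall fun u => ?_
      obtain ⟨v, hv⟩ := exists_padW (x := x) (v := σ (x.padV u)) (by
        have h1 : (σ (x.padV u)).val < max x.nV x.nW := (σ (x.padV u)).isLt
        omega)
      exact Finset.mem_image.2 ⟨(u, v), mem_mappingOfPerm.2 hv.symm, rfl⟩
    simp [this]
  · rw [Fintype.card_fin, Fintype.card_fin, min_eq_right h,
      ← Finset.card_image_of_injOn (f := Prod.snd) (fun a ha b hb hab => hinj2 a ha b hb hab)]
    have : (x.mappingOfPerm σ).image Prod.snd = Finset.univ := by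
      refine Finset.eq_univ_of_forall fun v => ?_
      obtain ⟨u, hu⟩ := exists_padV (x := x) (u := σ.symm (x.padW v)) (by
        have h1 : (σ.symm (x.padW v)).val < max x.nV x.nW := (σ.symm (x.padW v)).isLt
        omega)
      exact Finset.mem_image.2 ⟨(u, v), mem_mappingOfPerm.2 (by simp [hu]), rfl⟩
    simp [this]

/-- Any permutation extending `M` induces a mapping that contains `M`, and the two have the same
cardinality. -/
theorem exists_perm_of_isVertexMapping {M : Finset (Fin x.nV × Fin x.nW)}
    (hM : IsVertexMapping M) : ∃ σ, x.mappingOfPerm σ = M := by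
  obtain ⟨σ, hσ⟩ := exists_perm_extending (ι := M) (f := fun a => x.padV a.1.1)
    (g := fun a => x.padW a.1.2)
    (fun a b h => Subtype.ext (hM.2.1 _ a.2 _ b.2 (padV_injective h)))
    (fun a b h => Subtype.ext (hM.2.2 _ a.2 _ b.2 (padW_injective h)))
  refine ⟨σ, (Finset.eq_of_subset_of_card_le (fun a ha => ?_) ?_).symm⟩
  · exact mem_mappingOfPerm.2 (hσ ⟨a, ha⟩)
  · rw [hM.1, (isVertexMapping_mappingOfPerm σ).1]

/-- The rows of the padded problem split into matched vertices, vertices of `V` assigned to dummies,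
and dummies assigned to vertices of `W`. These are the three sums of the cost. -/
theorem layerCost_mappingOfPerm (σ : Equiv.Perm (Fin x.n)) (i : Fin x.T) (j : Fin x.U) :
    layerCost x.d x.G x.H (x.mappingOfPerm σ) i j = ∑ u : Fin x.n, x.weight i j u (σ u) := by
  have hsplit : ∑ u : Fin x.n, x.weight i j u (σ u) =
      ∑ u : Fin x.n with u.val < x.nV ∧ (σ u).val < x.nW, x.weight i j u (σ u) +
      ∑ u : Fin x.n with u.val < x.nV ∧ ¬ (σ u).val < x.nW, x.weight i j u (σ u) +
      ∑ u : Fin x.n with ¬ u.val < x.nV, x.weight i j u (σ u) := by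
    rw [← Finset.sum_filter_add_sum_filter_not Finset.univ (fun u : Fin x.n => u.val < x.nV),
      ← Finset.sum_filter_add_sum_filter_not (Finset.univ.filter fun u : Fin x.n => u.val < x.nV)
        (fun u => (σ u).val < x.nW), Finset.filter_filter, Finset.filter_filter]
  rw [hsplit, layerCost]
  congr 1
  · congr 1
    · refine Finset.sum_bij (fun a _ => x.padV a.1) ?_ ?_ ?_ ?_
      · intro a ha
        rw [mem_mappingOfPerm] at ha
        simp only [Finset.mem_filter, Finset.mem_univ, true_and, ha]
        exact ⟨a.1.isLt, a.2.isLt⟩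
      · intro a ha b hb h
        exact (isVertexMapping_mappingOfPerm σ).2.1 a ha b hb (padV_injective h)
      · intro u hu
        simp only [Finset.mem_filter, Finset.mem_univ, true_and] at hu
        obtain ⟨u', rfl⟩ := exists_padV hu.1
        obtain ⟨v', hv'⟩ := exists_padW hu.2
        exact ⟨(u', v'), mem_mappingOfPerm.2 hv'.symm, rfl⟩
      · intro a ha
        rw [mem_mappingOfPerm] at ha
        have h1 : (x.padV a.1).val < x.nV := a.1.isLt
        have h2 : (x.padW a.2).val < x.nW := a.2.isLt
        rw [ha, weight, if_pos h1, if_pos h2, tables]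
        dsimp only
        rw [dif_pos ⟨i.isLt, j.isLt, h1, h2⟩]
        rfl
    · refine Finset.sum_bij (fun u _ => x.padV u) ?_ ?_ ?_ ?_
      · intro u hu
        simp only [Finset.mem_sdiff, Finset.mem_univ, true_and, Finset.mem_image, not_exists,
          not_and] at hu
        simp only [Finset.mem_filter, Finset.mem_univ, true_and]
        refine ⟨u.isLt, fun h => ?_⟩
        obtain ⟨v', hv'⟩ := exists_padW h
        exact hu (u, v') (mem_mappingOfPerm.2 hv'.symm) rfl
      · intro a _ b _ h
        exact padV_injective h
      · intro u hu
        simp only [Finset.mem_filter, Finset.mem_univ, true_and] at hu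
        obtain ⟨u', rfl⟩ := exists_padV hu.1
        refine ⟨u', ?_, rfl⟩
        simp only [Finset.mem_sdiff, Finset.mem_univ, true_and, Finset.mem_image, not_exists,
          not_and]
        rintro a ha rfl
        rw [mem_mappingOfPerm] at ha
        rw [ha] at hu
        exact hu.2 a.2.isLt
      · intro u hu
        simp only [Finset.mem_sdiff, Finset.mem_univ, true_and, Finset.mem_image, not_exists,
          not_and] at hu
        have h1 : (x.padV u).val < x.nV := u.isLt
        have h2 : ¬ (σ (x.padV u)).val < x.nW := fun h => by
          obtain ⟨v', hv'⟩ := exists_padW h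
          exact hu (u, v') (mem_mappingOfPerm.2 hv'.symm) rfl
        rw [weight, if_pos h1, if_neg h2, tables]
        dsimp only
        rw [dif_pos ⟨i.isLt, h1⟩]
        rfl
  · refine Finset.sum_bij (fun v _ => σ.symm (x.padW v)) ?_ ?_ ?_ ?_
    · intro v hv
      simp only [Finset.mem_sdiff, Finset.mem_univ, true_and, Finset.mem_image, not_exists,
        not_and] at hv
      simp only [Finset.mem_filter, Finset.mem_univ, true_and]
      intro h
      obtain ⟨u', hu'⟩ := exists_padV h
      exact hv (u', v) (mem_mappingOfPerm.2 (by simp [hu'])) rfl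
    · intro a _ b _ h
      exact padW_injective (σ.symm.injective h)
    · intro u hu
      simp only [Finset.mem_filter, Finset.mem_univ, true_and] at hu
      obtain ⟨v', hv'⟩ := exists_padW ((lt_or_lt u (σ u)).resolve_left hu)
      refine ⟨v', ?_, by simp [hv']⟩
      simp only [Finset.mem_sdiff, Finset.mem_univ, true_and, Finset.mem_image, not_exists,
        not_and]
      rintro a ha rfl
      rw [mem_mappingOfPerm, hv'] at ha
      rw [← σ.injective ha] at hu
      exact hu a.1.isLt
    · intro v hv
      simp only [Finset.mem_sdiff, Finset.mem_univ, true_and, Finset.mem_image, not_exists,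
        not_and] at hv
      have h1 : ¬ (σ.symm (x.padW v)).val < x.nV := fun h => by
        obtain ⟨u', hu'⟩ := exists_padV h
        exact hv (u', v) (mem_mappingOfPerm.2 (by simp [hu'])) rfl
      rw [weight, if_neg h1, Equiv.apply_symm_apply, tables]
      dsimp only
      rw [dif_pos ⟨j.isLt, v.isLt⟩]
      rfl

/-- The cheapest assignment for the weights `w` costs at most `c`. -/
def AssignmentLe (n : ℕ) (w : ℕ → ℕ → ℚ) (c : ℚ) : Prop :=
  ∃ σ : Equiv.Perm (Fin n), ∑ u : Fin n, w u (σ u) ≤ c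

/-- One permutation serves all layers, so summing first over the path and then over the rows gives
an assignment problem for the accumulated weights. The minimum is at most `c` iff some candidate is,
as `c` is finite. -/
theorem isYes_iff : x.IsYes ↔ ∃ l ∈ backPaths (x.T + x.lam - 1) (x.T - 1) (x.U - 1),
    AssignmentLe x.n (x.pathWeight l) x.c := by
  have hT := x.G.lifetime_pos
  have hU := x.H.lifetime_pos
  have hcost : ∀ l ∈ backPaths (x.T + x.lam - 1) (x.T - 1) (x.U - 1), ∀ σ,
      ∑ a ∈ pathOfList x.T x.U l, layerCost x.d x.G x.H (x.mappingOfPerm σ) a.1 a.2 =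
        ∑ u : Fin x.n, x.pathWeight l u (σ u) := by
    intro l hl σ
    simp only [layerCost_mappingOfPerm, pathWeight]
    rw [Finset.sum_comm]
    exact Finset.sum_congr rfl fun u _ =>
      sum_pathOfList hT hU hl fun c => x.weight c.1 c.2 u (σ u)
  unfold IsYes boundedDtgw
  have htop : (x.c : WithTop ℚ) < ⊤ := WithTop.coe_lt_top _
  simp only [Finset.inf_le_iff htop, WithTop.coe_le_coe]
  constructor
  · rintro ⟨M, hM, p, hp, h⟩
    obtain ⟨l, hl, rfl⟩ := (mem_warpingPaths_iff hT hU (by omega)).1 hp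
    obtain ⟨σ, rfl⟩ := exists_perm_of_isVertexMapping (mem_vertexMappings.1 hM)
    rw [hcost l hl] at h
    exact ⟨l, hl, σ, h⟩
  · rintro ⟨l, hl, σ, h⟩
    refine ⟨x.mappingOfPerm σ,
      mem_vertexMappings.2 (isVertexMapping_mappingOfPerm σ),
      pathOfList x.T x.U l, (mem_warpingPaths_iff hT hU (by omega)).2 ⟨l, hl, rfl⟩, ?_⟩
    rwa [hcost l hl]

end Instance


/-! ## The assignment problem: theory

The rows and columns are `0, …, N - 1`; `p x` is the row assigned to the column `x`, and `N` if
there is none. The additional column `N` holds the row that is being inserted. -/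

/-- The potentials `pu`, `pv` and the assignment `p` are an optimal solution for the first `k`
rows. -/
structure Matching (N k : ℕ) (w : ℕ → ℕ → ℚ) (pu pv : ℕ → ℚ) (p : ℕ → ℕ) : Prop where
  feasible : ∀ i < k, ∀ x < N, pu i + pv x ≤ w i x
  tight : ∀ x < N, p x ≠ N → pu (p x) + pv x = w (p x) x
  range : ∀ x < N, p x = N ∨ p x < k
  inj : ∀ x < N, ∀ y < N, p x = p y → p x ≠ N → x = y
  surj : ∀ i < k, ∃ x < N, p x = i

/-- Pigeonhole: fewer than `N` rows cannot occupy all `N` columns. -/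
theorem Matching.exists_free {N k : ℕ} {w : ℕ → ℕ → ℚ} {pu pv : ℕ → ℚ} {p : ℕ → ℕ}
    (h : Matching N k w pu pv p) (hk : k < N) : ∃ x < N, p x = N := by
  by_contra! hne
  have h1 : Set.MapsTo p (Finset.range N) (Finset.range k) := fun x hx => by
    have hx' : x < N := by simpa using hx
    simpa using (h.range x hx').resolve_left (hne x hx')
  have h2 : Set.InjOn p (Finset.range N) := fun x hx y hy hxy => by
    have hx' : x < N := by simpa using hx
    have hy' : y < N := by simpa using hy
    exact h.inj x hx' y hy' hxy (hne x hx')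
  have := Finset.card_le_card_of_injOn p h1 h2
  simp at this
  omega

/-- Optimality of the potentials. -/
theorem Matching.assignmentLe_iff {N : ℕ} {w : ℕ → ℕ → ℚ} {pu pv : ℕ → ℚ} {p : ℕ → ℕ}
    (h : Matching N N w pu pv p) (c : ℚ) :
    Instance.AssignmentLe N w c ↔ ∑ x ∈ Finset.range N, (pu x + pv x) ≤ c := by
  have hsum : ∀ σ : Equiv.Perm (Fin N),
      ∑ u : Fin N, (pu u + pv (σ u)) = ∑ x ∈ Finset.range N, (pu x + pv x) := by
    intro σ
    rw [Finset.sum_add_distrib, Equiv.sum_comp σ (fun u : Fin N => pv u), ← Finset.sum_add_distrib,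
      Finset.sum_range]
  constructor
  · rintro ⟨σ, hσ⟩
    rw [← hsum σ]
    -- Weak duality: feasible potentials bound every assignment from below.
    exact (Finset.sum_le_sum fun (u : Fin N) _ => h.feasible u u.isLt _ (σ u).isLt).trans hσ
  · intro hc
    -- Conversely the tight pairs form a permutation that attains the bound.
    choose x hx hpx using fun i : Fin N => h.surj i i.isLt
    have hinj : Function.Injective fun i : Fin N => (⟨x i, hx i⟩ : Fin N) := by
      intro i j hij
      have : x i = x j := by simpa using hij
      exact Fin.ext (by rw [← hpx i, ← hpx j, this])
    refine ⟨Equiv.ofBijective _ hinj.bijective_of_finite, le_trans (le_of_eq ?_) hc⟩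
    rw [← hsum (Equiv.ofBijective _ hinj.bijective_of_finite)]
    refine Finset.sum_congr rfl fun i _ => ?_
    have := h.tight (x i) (hx i) (by rw [hpx i]; exact i.isLt.ne)
    rw [hpx i] at this
    exact this.symm

/-- A shortest path tree with respect to the slacks `s`, rooted at the column `N`. The columns with
`0 < ord x` have been settled, in this order. -/
structure Tree (N k q : ℕ) (s : ℕ → ℕ → ℚ) (p ord way : ℕ → ℕ) (D : ℕ → ℚ) : Prop where
  root : p N = k
  ord_root : ord N = 1
  dist_root : D N = 0
  ord_le : ∀ x ≤ N, ord x ≤ q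
  way_le : ∀ x < N, way x ≤ N
  way_pos : ∀ x < N, 0 < ord (way x)
  way_lt : ∀ x < N, 0 < ord x → ord (way x) < ord x
  dist_way : ∀ x < N, D x = D (way x) + s (p (way x)) x
  matched : ∀ x < N, 0 < ord x → p x ≠ N
  relaxed : ∀ j ≤ N, 0 < ord j → ∀ x < N, D x ≤ D j + s (p j) x
  mono : ∀ j < N, 0 < ord j → ∀ x < N, ord x = 0 → D j ≤ D x

/-- `b` is an unsettled column of minimal distance. -/
structure IsNearest (N b : ℕ) (ord : ℕ → ℕ) (D : ℕ → ℚ) : Prop where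
  lt : b < N
  ord_eq : ord b = 0
  le : ∀ y < N, ord y = 0 → D b ≤ D y

/-- The distances and predecessors after settling the column `b`. -/
structure Relaxed (N b : ℕ) (s : ℕ → ℚ) (ord way : ℕ → ℕ) (D : ℕ → ℚ) (way' : ℕ → ℕ)
    (D' : ℕ → ℚ) : Prop where
  improved : ∀ x < N, ord x = 0 → D b + s x < D x → D' x = D b + s x ∧ way' x = b
  unchanged : ∀ x, (N ≤ x ∨ ord x ≠ 0 ∨ D x ≤ D b + s x) → D' x = D x ∧ way' x = way x

/-- One step of Dijkstra's algorithm. Slacks in the row of `b` are nonnegative and `b` is nearest,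
so distances of settled columns cannot improve and unsettled ones stay at least `D b`. Slacks in the
new row `k` may be negative, but its edges leave only the root, which `mono` exempts. -/
theorem Tree.settle {N k q b : ℕ} {s : ℕ → ℕ → ℚ} {p ord way way' : ℕ → ℕ} {D D' : ℕ → ℚ}
    (h : Tree N k q s p ord way D) (hb : IsNearest N b ord D) (hs : ∀ x < N, 0 ≤ s (p b) x)
    (hpb : p b ≠ N)
    (hr : Relaxed N b (s (p b)) (Function.update ord b (q + 1)) way D way' D') :
    Tree N k (q + 1) s p (Function.update ord b (q + 1)) way' D' := by
  obtain ⟨hbN, hb0, hbm⟩ := hb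
  have hord : ∀ x, Function.update ord b (q + 1) x = if x = b then q + 1 else ord x := fun x => by
    rw [Function.update_apply]
  set ord' := Function.update ord b (q + 1)
  have hused : ∀ x, 0 < ord' x → D' x = D x ∧ way' x = way x := fun x hx =>
    hr.unchanged x (Or.inr (Or.inl hx.ne'))
  have hNb : N ≠ b := hbN.ne'
  have hle : ∀ x < N, D' x ≤ D x ∧ (ord' x = 0 → D' x ≤ D b + s (p b) x) := by
    intro x hx
    by_cases h0 : ord' x = 0
    · by_cases h1 : D b + s (p b) x < D x
      · have := hr.improved x hx h0 h1
        exact ⟨by rw [this.1]; exact h1.le, fun _ => this.1.le⟩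
      · have := hr.unchanged x (Or.inr (Or.inr (not_lt.1 h1)))
        exact ⟨this.1.le, fun _ => this.1.le.trans (not_lt.1 h1)⟩
    · exact ⟨(hused x (Nat.pos_of_ne_zero h0)).1.le, fun h => absurd h h0⟩
  have hold : ∀ x, 0 < ord x → 0 < ord' x ∧ x ≠ b := by
    intro x hx
    have : x ≠ b := by rintro rfl; omega
    rw [hord, if_neg this]
    exact ⟨hx, this⟩
  have hb' : 0 < ord' b := by rw [hord, if_pos rfl]; omega
  have hDb : D' b = D b := (hused b hb').1
  -- every column either has its old predecessor or `b`
  have hway : ∀ x < N, (way' x = way x ∧ D' x = D x) ∨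
      (way' x = b ∧ D' x = D b + s (p b) x ∧ ord' x = 0) := by
    intro x hx
    by_cases h0 : ord' x = 0
    · by_cases h1 : D b + s (p b) x < D x
      · have := hr.improved x hx h0 h1
        exact Or.inr ⟨this.2, this.1, h0⟩
      · have := hr.unchanged x (Or.inr (Or.inr (not_lt.1 h1)))
        exact Or.inl ⟨this.2, this.1⟩
    · have := hused x (Nat.pos_of_ne_zero h0)
      exact Or.inl ⟨this.2, this.1⟩
  have hlow : ∀ x < N, ord' x = 0 → D b ≤ D' x := by
    intro x hx h0
    rcases hway x hx with h1 | h1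
    · rw [h1.2]
      refine hbm x hx ?_
      rw [hord] at h0
      split_ifs at h0
      exact h0
    · rw [h1.2.1]
      linarith [hs x hx]
  refine ⟨h.root, ?_, ?_, ?_, ?_, ?_, ?_, ?_, ?_, ?_, ?_⟩
  · rw [hord, if_neg hNb, h.ord_root]
  · rw [(hr.unchanged N (Or.inl le_rfl)).1, h.dist_root]
  · intro x hx
    rw [hord]
    have := h.ord_le x hx
    split_ifs <;> omega
  · intro x hx
    rcases hway x hx with h1 | h1
    · rw [h1.1]; exact h.way_le x hx
    · rw [h1.1]; exact hbN.le
  · intro x hx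
    rcases hway x hx with h1 | h1
    · rw [h1.1]; exact (hold _ (h.way_pos x hx)).1
    · rw [h1.1]; exact hb'
  · intro x hx hx0
    rw [(hused x hx0).2]
    have h1 := (hold _ (h.way_pos x hx)).2
    rw [hord, if_neg h1, hord]
    rw [hord] at hx0
    split_ifs at hx0 ⊢ with h2
    · have := h.ord_le _ (h.way_le x hx)
      omega
    · exact h.way_lt x hx hx0
  · intro x hx
    rcases hway x hx with h1 | h1
    · rw [h1.1, h1.2, (hused _ (hold _ (h.way_pos x hx)).1).1]
      exact h.dist_way x hx
    · rw [h1.1, h1.2.1, hDb]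
  · intro x hx hx0
    rw [hord] at hx0
    split_ifs at hx0 with h2
    · rw [h2]; exact hpb
    · exact h.matched x hx hx0
  · intro j hj hj0 x hx
    rw [(hused j hj0).1]
    rw [hord] at hj0
    split_ifs at hj0 with h2
    · subst h2
      by_cases h0 : ord' x = 0
      · exact (hle x hx).2 h0
      · rw [(hused x (Nat.pos_of_ne_zero h0)).1]
        have := hs x hx
        rw [hord] at h0
        split_ifs at h0 with h3
        · rw [h3] at this ⊢
          linarith
        -- A column settled earlier is no farther than the new one, so a nonnegative edge cannot
        -- shorten its distance.
        · linarith [h.mono x hx (Nat.pos_of_ne_zero h0) j hbN hb0]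
    · exact (hle x hx).1.trans (h.relaxed j hj hj0 x hx)
  · intro j hj hj0 x hx hx0
    rw [(hused j hj0).1]
    rw [hord] at hj0
    split_ifs at hj0 with h2
    · rw [h2]; exact hlow x hx hx0
    · exact (h.mono j hj hj0 b hbN hb0).trans (hlow x hx hx0)

/-- The tree consisting of the root only. -/
theorem Tree.init {N k : ℕ} {s : ℕ → ℕ → ℚ} {p ord way : ℕ → ℕ} {D : ℕ → ℚ} (hp : p N = k)
    (hN : ord N = 1) (hD : D N = 0) (ho : ∀ x < N, ord x = 0) (hw : ∀ x < N, way x = N)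
    (hs : ∀ x < N, D x = s k x) : Tree N k 1 s p ord way D where
  root := hp
  ord_root := hN
  dist_root := hD
  ord_le x hx := by
    rcases hx.lt_or_eq with h | rfl
    · rw [ho x h]; omega
    · exact hN.le
  way_le x hx := (hw x hx).le
  way_pos x hx := by rw [hw x hx, hN]; exact one_pos
  way_lt x hx h := by rw [ho x hx] at h; omega
  dist_way x hx := by rw [hw x hx, hD, hp, hs x hx, zero_add]
  matched x hx h := by rw [ho x hx] at h; omega
  relaxed j hj hj0 x hx := by
    rcases hj.lt_or_eq with h | rfl
    · rw [ho j h] at hj0; omega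
    · rw [hD, hp, hs x hx, zero_add]
  mono j hj hj0 := by rw [ho j hj] at hj0; omega

/-! ### Change of potentials and augmentation -/

/-- The potentials after the tree has reached the free column `b`. -/
structure Shifted (N b : ℕ) (p ord : ℕ → ℕ) (D pu pv pu' pv' : ℕ → ℚ) : Prop where
  row : ∀ x ≤ N, 0 < ord x → pu' (p x) = pu (p x) + (D b - D x)
  row_of_not : ∀ i, (∀ x ≤ N, 0 < ord x → p x ≠ i) → pu' i = pu i
  col : ∀ x ≤ N, 0 < ord x → pv' x = pv x - (D b - D x)
  col_of_not : ∀ x, ord x = 0 → pv' x = pv x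

/-- The assignment while it is being augmented: the column `b` is about to be reassigned. -/
structure Augmenting (N k b : ℕ) (w : ℕ → ℕ → ℚ) (pu pv : ℕ → ℚ) (p : ℕ → ℕ) : Prop where
  feasible : ∀ i ≤ k, ∀ x < N, pu i + pv x ≤ w i x
  tight : ∀ x < N, x ≠ b → p x ≠ N → pu (p x) + pv x = w (p x) x
  range : ∀ x ≤ N, x ≠ b → p x = N ∨ p x ≤ k
  inj : ∀ x ≤ N, ∀ y ≤ N, x ≠ b → y ≠ b → p x = p y → p x ≠ N → x = y
  surj : ∀ i ≤ k, ∃ x ≤ N, x ≠ b ∧ p x = i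

/-- The column `b` takes over the row of its predecessor `y`, so the hole in the assignment moves on
to `y`. The new pair is tight by assumption. -/
theorem Augmenting.step {N k b y : ℕ} {w : ℕ → ℕ → ℚ} {pu pv : ℕ → ℚ} {p : ℕ → ℕ}
    (h : Augmenting N k b w pu pv p) (hb : b < N) (hy : y ≤ N) (hyb : y ≠ b)
    (ht : pu (p y) + pv b = w (p y) b) :
    Augmenting N k y w pu pv (Function.update p b (p y)) := by
  obtain ⟨h1, h2, h3, h4, h5⟩ := h
  have hp : ∀ x, Function.update p b (p y) x = if x = b then p y else p x := fun x => by
    rw [Function.update_apply]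
  refine ⟨h1, ?_, ?_, ?_, ?_⟩
  · intro x hx hxy hxN
    rw [hp] at hxN ⊢
    split_ifs with hxb
    · rw [hxb]; exact ht
    · rw [if_neg hxb] at hxN
      exact h2 x hx hxb hxN
  · intro x hx hxy
    rw [hp]
    split_ifs with hxb
    · exact h3 y hy hyb
    · exact h3 x hx hxb
  · intro x hx z hz hxy hzy he hne
    rw [hp] at he hne
    rw [hp] at he
    split_ifs at he hne with hxb hzb hzb
    · rw [hxb, hzb]
    · exact absurd (h4 y hy z hz hyb hzb he hne).symm hzy
    · exact absurd (h4 x hx y hy hxb hyb he hne) hxy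
    · exact h4 x hx z hz hxb hzb he hne
  · intro i hi
    obtain ⟨x, hx, hxb, rfl⟩ := h5 i hi
    by_cases hxy : x = y
    · exact ⟨b, hb.le, hyb.symm, by rw [hp, if_pos rfl, hxy]⟩
    · exact ⟨x, hx, hxy, by rw [hp, if_neg hxb]⟩

/-- Once the hole has reached the additional column `N`, all rows sit in genuine columns. -/
theorem Augmenting.matching {N k : ℕ} {w : ℕ → ℕ → ℚ} {pu pv : ℕ → ℚ} {p : ℕ → ℕ}
    (h : Augmenting N k N w pu pv p) : Matching N (k + 1) w pu pv p where
  feasible i hi := h.feasible i (by omega)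
  tight x hx := h.tight x hx hx.ne
  range x hx := (h.range x hx.le hx.ne).imp_right Nat.lt_succ_of_le
  inj x hx y hy := h.inj x hx.le y hy.le hx.ne hy.ne
  surj i hi := by
    obtain ⟨x, hx, hne, hp⟩ := h.surj i (by omega)
    exact ⟨x, by omega, hp⟩

section shift

variable {N k q b : ℕ} {w : ℕ → ℕ → ℚ} {pu pv pu' pv' : ℕ → ℚ} {p ord way : ℕ → ℕ} {D : ℕ → ℚ}

/-- Includes the root column `N`, whose row `k` is new. It ensures that changing the potentials
along the tree touches each row once. -/
theorem Tree.p_inj (hm : ∀ x < N, p x = N ∨ p x < k)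
    (hi : ∀ x < N, ∀ y < N, p x = p y → p x ≠ N → x = y)
    {s : ℕ → ℕ → ℚ} (h : Tree N k q s p ord way D) :
    ∀ x ≤ N, ∀ y ≤ N, 0 < ord x → 0 < ord y → p x = p y → x = y := by
  intro x hx y hy hx0 hy0 he
  rcases hx.lt_or_eq with hx | rfl <;> rcases hy.lt_or_eq with hy | rfl
  · exact hi x hx y hy he (h.matched x hx hx0)
  · have h1 := (hm x hx).resolve_left (h.matched x hx hx0)
    rw [he, h.root] at h1
    omega
  · have h1 := (hm y hy).resolve_left (h.matched y hy hy0)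
    rw [← he, h.root] at h1
    omega
  · rfl

variable (hkN : k < N) (hfeas : ∀ i < k, ∀ x < N, pu i + pv x ≤ w i x)
  (htight : ∀ x < N, p x ≠ N → pu (p x) + pv x = w (p x) x)
  (hrange : ∀ x < N, p x = N ∨ p x < k)
  (hinj : ∀ x < N, ∀ y < N, p x = p y → p x ≠ N → x = y)
  (hsurj : ∀ i < k, ∃ x < N, p x = i)
  (h : Tree N k q (fun i x => w i x - pu i - pv x) p ord way D)
  (hb : IsNearest N b ord D) (hs : Shifted N b p ord D pu pv pu' pv')

include h hs in
-- A tree edge has slack `D x - D (way x)`, which is exactly what the change of potentials removes.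
-- For the unsettled column `b` the column potential does not change, in accordance with `D b - D b
-- = 0`.
theorem Tree.tight_way (x : ℕ) (hx : x < N) (hx0 : 0 < ord x ∨ x = b) (hb0 : ord b = 0) :
    pu' (p (way x)) + pv' x = w (p (way x)) x := by
  have h1 := h.dist_way x hx
  rw [hs.row _ (h.way_le x hx) (h.way_pos x hx)]
  rcases hx0 with hx0 | rfl
  · rw [hs.col x hx.le hx0]
    linarith
  · rw [hs.col_of_not x hb0]
    linarith

include hkN hfeas htight hrange hinj hsurj h hb hs in
-- The row of a settled column `j` gains `D b - D j`, and a settled column `x` loses `D b - D x`.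
-- The slack in that row is at least `D x - D j`, which pays for the change; for unsettled `x` this
-- uses `D b ≤ D x`. Matched settled pairs change by opposite amounts and stay tight.
theorem Tree.augmenting (hpb : p b = N) : Augmenting N k b w pu' pv' p where
  feasible i hi x hx := by
    have hcol : pv' x ≤ pv x := by
      rcases Nat.eq_zero_or_pos (ord x) with h0 | h0
      · rw [hs.col_of_not x h0]
      · rw [hs.col x hx.le h0]
        linarith [h.mono x hx h0 b hb.lt hb.ord_eq]
    by_cases hi' : ∃ j ≤ N, 0 < ord j ∧ p j = i
    · obtain ⟨j, hj, hj0, rfl⟩ := hi'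
      have h1 := h.relaxed j hj hj0 x hx
      rw [hs.row j hj hj0]
      rcases Nat.eq_zero_or_pos (ord x) with h0 | h0
      · rw [hs.col_of_not x h0]
        linarith [hb.le x hx h0]
      · rw [hs.col x hx.le h0]
        linarith
    · push Not at hi'
      have hik : i ≠ k := by
        rintro rfl
        exact hi' N le_rfl (by rw [h.ord_root]; exact one_pos) h.root
      rw [hs.row_of_not i hi']
      linarith [hfeas i (by omega) x hx]
  tight x hx hxb hxN := by
    rcases Nat.eq_zero_or_pos (ord x) with h0 | h0
    · rw [hs.col_of_not x h0, hs.row_of_not, htight x hx hxN]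
      intro y hy hy0 he
      rcases hy.lt_or_eq with hy | rfl
      · rw [hinj y hy x hx he (he ▸ hxN)] at hy0
        omega
      · have := (hrange x hx).resolve_left hxN
        rw [h.root] at he
        omega
    · rw [hs.col x hx.le h0, hs.row x hx.le h0]
      linarith [htight x hx hxN]
  range x hx hxb := by
    rcases hx.lt_or_eq with hx | rfl
    · exact (hrange x hx).imp_right le_of_lt
    · exact Or.inr h.root.le
  inj x hx y hy hxb hyb he hne := by
    rcases hx.lt_or_eq with hx | rfl <;> rcases hy.lt_or_eq with hy | rfl
    · exact hinj x hx y hy he hne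
    · have := (hrange x hx).resolve_left hne
      rw [h.root] at he
      omega
    · have := (hrange y hy).resolve_left (he ▸ hne)
      rw [h.root] at he
      omega
    · rfl
  surj i hi := by
    rcases hi.lt_or_eq with hi | rfl
    · obtain ⟨x, hx, rfl⟩ := hsurj i hi
      refine ⟨x, hx.le, ?_, rfl⟩
      rintro rfl
      omega
    · exact ⟨N, le_rfl, hb.lt.ne', h.root⟩

end shift


set_option linter.constructorNameAsVariable false

/-! ## The assignment problem: program -/

/-- Let `b` be a column outside the search tree of minimal distance. -/
def select : Cmd :=
  .nset .b .N ;;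
  .for .x .N
    (.ite (.eq (.get .ord .x) 0)
      (.ite (.eq .b .N) (.nset .b .x)
        (.ite (.qlt (.get .D .x) (.get .D .b)) (.nset .b .x) .skip))
      .skip)

/-- Update the distances of the columns outside the search tree along the edges from the row
assigned to the column `b`. -/
def relax : Cmd :=
  .for .x .N
    (.ite (.eq (.get .ord .x) 0)
      (.qset .s (.get .D .b + (.get .A (.get .rb (.get .p .b) + .x) - .get .pu (.get .p .b)
        - .get .pv .x)) ;;
      .ite (.qlt .s (.get .D .x)) (.qput .D .x .s ;; .nput .way .x .b) .skip)
      .skip)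

/-- Change the potentials along the search tree. -/
def updatePotentials : Cmd :=
  .for .x (.N + 1)
    (.ite (.lt 0 (.get .ord .x))
      (.qset .s (.get .D .b - .get .D .x) ;;
      .qput .pu (.get .p .x) (.get .pu (.get .p .x) + .s) ;;
      .qput .pv .x (.get .pv .x - .s))
      .skip)

/-- Augment the matching along the path from the column `b` to the root. -/
def augment : Cmd :=
  .while (.lt .b .N)
    (.nset .y (.get .way .b) ;;
    .nput .p .b (.get .p .y) ;;
    .nset .b .y)

/-- Start the search tree with the row `k`, assigned to the additional column `N`. -/
def initTree : Cmd :=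
  .nput .p .N .k ;;
  .for .x .N
    (.nput .ord .x 0 ;;
    .nput .way .x .N ;;
    .qput .D .x (.get .A (.get .rb .k + .x) - .get .pu .k - .get .pv .x)) ;;
  .nput .ord .N 1 ;;
  .qput .D .N 0 ;;
  .nset .q 1

def growTree : Cmd :=
  select ;;
  .while (.lt (.get .p .b) .N)
    (.nset .q (.q + 1) ;;
    .nput .ord .b .q ;;
    relax ;;
    select)

/-- Solve the assignment problem for the matrix `A`; the optimal value is stored in `e`. -/
def hungarian : Cmd :=
  .for .x .N (.qput .pu .x 0 ;; .qput .pv .x 0 ;; .nput .p .x .N) ;;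
  .for .k .N (initTree ;; growTree ;; updatePotentials ;; augment) ;;
  .qset .e 0 ;;
  .for .x .N (.qset .e (.e + (.get .pu .x + .get .pv .x)))

/-! ### Correctness of the loops -/

section loops

variable {E : Tables} {a : Mem} {N : ℕ}

theorem wp_select (hN : a.n .N = N) (hex : ∃ x < N, a.na .ord x = 0) :
    wp E select (fun m a' => m ≤ 6 * N + 3 ∧ IsNearest N (a'.n .b) (a.na .ord) (a.qa .D)) a := by
  rw [select, wp_seq, wp_nset]
  -- The value `N` of `b` stands for no unsettled column seen so far.
  refine wp_for (fun l a' => (a'.n .b = N ∧ ∀ y < l, a.na .ord y ≠ 0) ∨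
      (a'.n .b < N ∧ a.na .ord (a'.n .b) = 0 ∧
        ∀ y < l, a.na .ord y = 0 → a.qa .D (a'.n .b) ≤ a.qa .D y)) N 4
    (fun a' hF => by simp [hF.n .N rfl, hN]) rfl (by simp [hN]) ?_ ?_
  · intro l a' hl hF hx hI
    have hN' : a'.n .N = N := by simp [hF.n .N rfl, hN]
    have hord : a'.na .ord = a.na .ord := by simp [hF.na .ord rfl]
    have hD : a'.qa .D = a.qa .D := by simp [hF.qa .D rfl]
    simp only [wp_ite, wp_nset, wp_skip, Cond.holds, NExp.eval_get, NExp.eval_var, NExp.eval_zero,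
      QExp.eval_get, hN', hord, hD, hx, Mem.setN_n]
    grind
  · rintro m a' - hI hm
    obtain ⟨x, hx, hx0⟩ := hex
    refine ⟨by omega, ?_⟩
    rcases hI with hI | hI
    · exact absurd hx0 (hI.2 x hx)
    · exact ⟨hI.1, hI.2.1, hI.2.2⟩

theorem wp_relax {w : ℕ → ℕ → ℚ} (hN : a.n .N = N) (hb : a.na .ord (a.n .b) ≠ 0)
    (hrb : a.na .rb (a.na .p (a.n .b)) = a.na .p (a.n .b) * N)
    (hw : ∀ x < N, a.qa .A (a.na .p (a.n .b) * N + x) = w (a.na .p (a.n .b)) x) :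
    wp E relax (fun m a' => m ≤ 7 * N + 2 ∧ Relaxed N (a.n .b)
      (fun x => w (a.na .p (a.n .b)) x - a.qa .pu (a.na .p (a.n .b)) - a.qa .pv x)
      (a.na .ord) (a.na .way) (a.qa .D) (a'.na .way) (a'.qa .D)) a := by
  set b := a.n .b with hbdef
  set i := a.na .p b with hi
  -- `Relaxed` with `l` in place of `N` says that the columns from `l` on are still unchanged, so it
  -- serves as the invariant.
  refine wp_for (fun l a' => Relaxed l b (fun x => w i x - a.qa .pu i - a.qa .pv x)
      (a.na .ord) (a.na .way) (a.qa .D) (a'.na .way) (a'.qa .D)) N 5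
    (fun a' hF => by simp [hF.n .N rfl, hN]) rfl
    ⟨fun x hx => by omega, fun x _ => by simp⟩ ?_ ?_
  · intro l a' hl hF hx hI
    have hb' : a'.n .b = b := by simp [hF.n .b rfl, hbdef]
    have hord : a'.na .ord = a.na .ord := by simp [hF.na .ord rfl]
    have hp : a'.na .p b = i := by simp [hF.na .p rfl, hi]
    have hrb' : a'.na .rb i = i * N := by simp [hF.na .rb rfl, hrb]
    have hA : a'.qa .A (i * N + l) = w i l := by simp [hF.qa .A rfl, hw l hl]
    have hpu : a'.qa .pu = a.qa .pu := by simp [hF.qa .pu rfl]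
    have hpv : a'.qa .pv = a.qa .pv := by simp [hF.qa .pv rfl]
    -- The column `b` is already settled, so every round reads its original distance.
    have hDb : a'.qa .D b = a.qa .D b := (hI.2 b (Or.inr (Or.inl hb))).1
    have hl' := hI.2 l (Or.inl le_rfl)
    simp only [wp_ite, wp_skip, wp_seq, wp_qset, wp_qput, wp_nput, Cond.holds,
      NExp.eval_get, NExp.eval_var, NExp.eval_zero, NExp.eval_add, QExp.eval_get, QExp.eval_add,
      QExp.eval_sub, QExp.eval_var, hb', hord, hp, hrb', hA, hpu, hpv, hDb, hx, hl'.1,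
      Mem.setQ_q, Mem.setQ_n, Mem.setQ_qa, Mem.setQ_na, Mem.putQ_n, Mem.putQ_qa, Mem.putQ_na,
      Mem.putN_na, Mem.putN_qa, Mem.setN_na, Mem.setN_qa, if_true]
    obtain ⟨h1, h2⟩ := hI
    refine ⟨fun h0 => ⟨fun hlt => ⟨by omega, ?_⟩, fun hlt => ⟨by omega, ?_⟩⟩,
      fun h0 => ⟨by omega, ?_⟩⟩ <;> constructor <;> intro x <;> grind
  · rintro m a' - hI hm
    exact ⟨by omega, hI⟩

theorem wp_updatePotentials (hN : a.n .N = N)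
    (hinj : ∀ x ≤ N, ∀ y ≤ N, 0 < a.na .ord x → 0 < a.na .ord y → a.na .p x = a.na .p y → x = y) :
    wp E updatePotentials (fun m a' => m ≤ 6 * (N + 1) + 2 ∧ Shifted N (a.n .b) (a.na .p)
      (a.na .ord) (a.qa .D) (a.qa .pu) (a.qa .pv) (a'.qa .pu) (a'.qa .pv)) a := by
  refine wp_for (fun l a' =>
      (∀ x < l, 0 < a.na .ord x → a'.qa .pu (a.na .p x) =
        a.qa .pu (a.na .p x) + (a.qa .D (a.n .b) - a.qa .D x)) ∧
      (∀ i, (∀ x < l, 0 < a.na .ord x → a.na .p x ≠ i) → a'.qa .pu i = a.qa .pu i) ∧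
      (∀ x < l, 0 < a.na .ord x → a'.qa .pv x =
        a.qa .pv x - (a.qa .D (a.n .b) - a.qa .D x)) ∧
      (∀ x, l ≤ x ∨ a.na .ord x = 0 → a'.qa .pv x = a.qa .pv x)) (N + 1) 4
    (fun a' hF => by simp [hF.n .N rfl, hN]) rfl (by simp) ?_ ?_
  · intro l a' hl hF hx hI
    have hb' : a'.n .b = a.n .b := by simp [hF.n .b rfl]
    have hord : a'.na .ord = a.na .ord := by simp [hF.na .ord rfl]
    have hp : a'.na .p = a.na .p := by simp [hF.na .p rfl]
    have hD : a'.qa .D = a.qa .D := by simp [hF.qa .D rfl]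
    obtain ⟨h1, h2, h3, h4⟩ := hI
    -- By injectivity no earlier round has changed the potential of this row.
    have hpl : 0 < a.na .ord l → a'.qa .pu (a.na .p l) = a.qa .pu (a.na .p l) := by
      intro h0
      refine h2 _ fun x hxl hx0 he => ?_
      have := hinj x (by omega) l (by omega) hx0 h0 he
      omega
    have hvl := h4 l (Or.inl le_rfl)
    simp only [wp_ite, wp_skip, wp_seq, wp_qset, wp_qput, Cond.holds,
      NExp.eval_get, NExp.eval_var, NExp.eval_zero, QExp.eval_get, QExp.eval_add,
      QExp.eval_sub, QExp.eval_var, hb', hord, hp, hD, hx,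
      Mem.setQ_q, Mem.setQ_n, Mem.setQ_qa, Mem.setQ_na, Mem.putQ_n, Mem.putQ_qa,
      Mem.putQ_q, Mem.setN_qa, if_true]
    refine ⟨fun h0 => ⟨by omega, ?_⟩, fun h0 => ⟨by omega, ?_⟩⟩
    · simp only [hpl h0, hvl, reduceCtorEq, if_false, Function.update_apply]
      refine ⟨?_, ?_, ?_, ?_⟩ <;> grind
    · refine ⟨?_, ?_, ?_, ?_⟩ <;> grind
  · rintro m a' - ⟨h1, h2, h3, h4⟩ hm
    exact ⟨by omega, fun x hx => h1 x (by omega), fun i hi => h2 i fun x hx => hi x (by omega),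
      fun x hx => h3 x (by omega), fun x hx => h4 x (Or.inr hx)⟩

theorem wp_initTree {k : ℕ} {w : ℕ → ℕ → ℚ} (hN : a.n .N = N) (hk : a.n .k = k)
    (hrb : a.na .rb k = k * N) (hw : ∀ x < N, a.qa .A (k * N + x) = w k x) :
    wp E initTree (fun m a' => m ≤ 5 * N + 6 ∧ a'.na .p = Function.update (a.na .p) N k ∧
      (∀ x < N, a'.na .ord x = 0) ∧ a'.n .q = 1 ∧
      Tree N k 1 (fun i x => w i x - a.qa .pu i - a.qa .pv x) (a'.na .p) (a'.na .ord)
        (a'.na .way) (a'.qa .D)) a := by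
  rw [initTree, wp_seq, wp_nput, wp_seq]
  refine wp_for (fun l a' => ∀ x < l, a'.na .ord x = 0 ∧ a'.na .way x = N ∧
      a'.qa .D x = w k x - a.qa .pu k - a.qa .pv x) N 3
    (fun a' hF => by simp [hF.n .N rfl, hN]) rfl (by simp) ?_ ?_
  · intro l a' hl hF hx hI
    have hN' : a'.n .N = N := by simp [hF.n .N rfl, hN]
    have hk' : a'.n .k = k := by simp [hF.n .k rfl, hk]
    have hrb' : a'.na .rb k = k * N := by simp [hF.na .rb rfl, hrb]
    have hA : a'.qa .A (k * N + l) = w k l := by simp [hF.qa .A rfl, hw l hl]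
    have hpu : a'.qa .pu = a.qa .pu := by simp [hF.qa .pu rfl]
    have hpv : a'.qa .pv = a.qa .pv := by simp [hF.qa .pv rfl]
    simp only [wp_seq, wp_qput, wp_nput, NExp.eval_get, NExp.eval_var, NExp.eval_zero,
      NExp.eval_add, QExp.eval_get, QExp.eval_sub, hN', hk', hrb', hA, hpu, hpv, hx,
      Mem.putQ_qa, Mem.putQ_na, Mem.putN_na, Mem.putN_qa, Mem.putN_n, Mem.setN_na, Mem.setN_qa,
      reduceCtorEq, if_true, if_false, Function.update_apply]
    refine ⟨by omega, fun x hx => ?_⟩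
    grind
  · intro m a' hF hI hm
    have hN' : a'.n .N = N := by simp [hF.n .N rfl, hN]
    have hp : a'.na .p = Function.update (a.na .p) N k := by simp [hF.na .p rfl, hN, hk]
    simp only [wp_seq, wp_qput, wp_nput, wp_nset, NExp.eval_var, NExp.eval_one,
      QExp.eval_zero, hN', hp, Mem.putQ_qa, Mem.putQ_na, Mem.putN_na, Mem.putN_qa, Mem.putN_n,
      Mem.setN_na, Mem.setN_n, Mem.setN_qa, reduceCtorEq, if_true, if_false]
    have hord : ∀ x < N, Function.update (a'.na .ord) N 1 x = 0 := fun x hx => by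
      rw [Function.update_of_ne hx.ne, (hI x hx).1]
    refine ⟨by omega, trivial, hord, trivial, Tree.init (by simp) (by simp) (by simp) hord
      (fun x hx => (hI x hx).2.1) fun x hx => ?_⟩
    rw [Function.update_of_ne hx.ne, (hI x hx).2.2]

/-- The rows of the matrix `A` start at the multiples of `N`, which are stored in `rb`, and its
entries are `w`. -/
structure HasMatrix (a : Mem) (N : ℕ) (w : ℕ → ℕ → ℚ) : Prop where
  size : a.n .N = N
  base : ∀ u < N, a.na .rb u = u * N
  entry : ∀ u < N, ∀ v < N, a.qa .A (u * N + v) = w u v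

theorem HasMatrix.frame {w : ℕ → ℕ → ℚ} {P : Cmd} {a a' : Mem} (h : HasMatrix a N w)
    (hF : Frame P a a') (hN : P.nw .N = false) (hrb : P.naw .rb = false)
    (hA : P.qaw .A = false) : HasMatrix a' N w where
  size := (hF.n _ hN).trans h.size
  base u hu := by rw [hF.na _ hrb, h.base u hu]
  entry u hu v hv := by rw [hF.qa _ hA, h.entry u hu v hv]

theorem Tree.exists_unsettled {k q : ℕ} {s w : ℕ → ℕ → ℚ} {pu pv : ℕ → ℚ} {p ord way : ℕ → ℕ}
    {D : ℕ → ℚ} (h : Tree N k q s p ord way D) (hm : Matching N k w pu pv p) (hk : k < N) :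
    ∃ x < N, ord x = 0 := by
  obtain ⟨x, hx, hp⟩ := hm.exists_free hk
  exact ⟨x, hx, by by_contra h0; exact h.matched x hx (Nat.pos_of_ne_zero h0) hp⟩

/-- Each round settles one column at linear cost. A free column exists and is never settled inside
the tree, so `select` always finds a candidate and the loop ends at a free column. -/
theorem wp_growTree {k : ℕ} {w : ℕ → ℕ → ℚ} (hA : HasMatrix a N w) (hk : k < N)
    (hm : Matching N k w (a.qa .pu) (a.qa .pv) (a.na .p)) (hord : ∀ x < N, a.na .ord x = 0)
    (hq : a.n .q = 1)
    (ht : Tree N k 1 (fun i x => w i x - a.qa .pu i - a.qa .pv x) (a.na .p) (a.na .ord)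
      (a.na .way) (a.qa .D)) :
    wp E growTree (fun m a' => m ≤ 13 * (N * N) + 14 * N + 4 ∧ a'.na .p (a'.n .b) = N ∧
      IsNearest N (a'.n .b) (a'.na .ord) (a'.qa .D) ∧ ∃ q ≤ N + 1,
      Tree N k q (fun i x => w i x - a.qa .pu i - a.qa .pv x) (a'.na .p) (a'.na .ord)
        (a'.na .way) (a'.qa .D)) a := by
  let card : (ℕ → ℕ) → ℕ := fun ord => ((Finset.range N).filter fun x => ord x = 0).card
  rw [growTree, wp_seq]
  refine (wp_select hA.size (ht.exists_unsettled hm hk)).mono fun m₁ a₁ hF₁ ⟨hm₁, hb₁⟩ => ?_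
  have hcard₁ : card (a₁.na .ord) = N := by
    have : (Finset.range N).filter (fun x => a₁.na .ord x = 0) = Finset.range N := by
      refine Finset.filter_true_of_mem fun x hx => ?_
      rw [hF₁.na .ord rfl, hord x (Finset.mem_range.1 hx)]
    simp only [card, this, Finset.card_range]
  refine wp_while (fun a' => IsNearest N (a'.n .b) (a'.na .ord) (a'.qa .D) ∧
      a'.n .q + card (a'.na .ord) = N + 1 ∧
      Tree N k (a'.n .q) (fun i x => w i x - a.qa .pu i - a.qa .pv x) (a'.na .p) (a'.na .ord)
        (a'.na .way) (a'.qa .D)) (fun a' => card (a'.na .ord)) (13 * N + 7) ?_ ?_ ?_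
  · refine ⟨?_, ?_, ?_⟩
    · rwa [hF₁.na .ord rfl, hF₁.qa .D rfl]
    · rw [hcard₁, hF₁.n .q rfl, hq, add_comm]
    · rw [hF₁.na .ord rfl, hF₁.qa .D rfl, hF₁.na .p rfl, hF₁.na .way rfl, hF₁.n .q rfl, hq]
      exact ht
  · rintro a₂ hF₂ ⟨hb₂, hc₂, ht₂⟩ hlt
    have hA₂ : HasMatrix a₂ N w := (hA.frame hF₁ rfl rfl rfl).frame hF₂ rfl rfl rfl
    have hp₂ : a₂.na .p = a.na .p := by rw [hF₂.na .p rfl, hF₁.na .p rfl]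
    have hpu₂ : a₂.qa .pu = a.qa .pu := by rw [hF₂.qa .pu rfl, hF₁.qa .pu rfl]
    have hpv₂ : a₂.qa .pv = a.qa .pv := by rw [hF₂.qa .pv rfl, hF₁.qa .pv rfl]
    simp only [Cond.holds, NExp.eval_get, NExp.eval_var, hA₂.size] at hlt
    set b := a₂.n .b with hb
    set q := a₂.n .q with hqdef
    set i := a₂.na .p b with hi
    have hik : i < k := by
      rw [hp₂] at hi
      exact hi ▸ (hm.range b hb₂.lt).resolve_left (hi ▸ hlt.ne)
    rw [wp_seq, wp_nset, wp_seq, wp_nput, wp_seq]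
    simp only [NExp.eval_add, NExp.eval_var, NExp.eval_one, Mem.setN_n, reduceCtorEq, if_true,
      if_false, ← hb, ← hqdef]
    set a₃ := (a₂.setN .q (q + 1)).putN .ord b (q + 1) with ha₃
    have ho₃ : a₃.na .ord = Function.update (a₂.na .ord) b (q + 1) := by simp [ha₃]
    have hA₃ : HasMatrix a₃ N w :=
      ⟨by simp [ha₃, hA₂.size], fun u hu => by simp [ha₃, hA₂.base u hu],
        fun u hu v hv => by simp [ha₃, hA₂.entry u hu v hv]⟩
    have hb₃ : a₃.n .b = b := by simp [ha₃, hb]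
    have hp₃ : a₃.na .p = a₂.na .p := by simp [ha₃]
    have hD₃ : a₃.qa .D = a₂.qa .D := by simp [ha₃]
    have hway₃ : a₃.na .way = a₂.na .way := by simp [ha₃]
    have hpu₃ : a₃.qa .pu = a.qa .pu := by simp [ha₃, hpu₂]
    have hpv₃ : a₃.qa .pv = a.qa .pv := by simp [ha₃, hpv₂]
    have hq₃ : a₃.n .q = q + 1 := by simp [ha₃]
    refine (wp_relax (N := N) (w := w) hA₃.size (by rw [ho₃, hb₃]; simp)
      (by rw [hb₃, hp₃, hA₃.base _ hlt]) (fun x hx => by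
        rw [hb₃, hp₃, hA₃.entry _ hlt x hx])).mono fun m₄ a₄ hF₄ ⟨hm₄, hr⟩ => ?_
    rw [hb₃, hp₃, hpu₃, hpv₃, ho₃, hway₃, hD₃] at hr
    -- The settled column belongs to an old row `i < k`, for which feasibility gives nonnegative
    -- slacks.
    have ht₄ := ht₂.settle hb₂ (fun x hx => by
      have := hm.feasible i hik x hx
      linarith) hlt.ne hr
    have hp₄ : a₄.na .p = a₂.na .p := by rw [hF₄.na .p rfl, hp₃]
    have ho₄ : a₄.na .ord = Function.update (a₂.na .ord) b (q + 1) := by rw [hF₄.na .ord rfl, ho₃]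
    have hq₄ : a₄.n .q = q + 1 := by rw [hF₄.n .q rfl, hq₃]
    rw [← ho₄, ← hp₄] at ht₄
    have hm₄' : Matching N k w (a.qa .pu) (a.qa .pv) (a₄.na .p) := by rwa [hp₄, hp₂]
    refine (wp_select ((hA₃.frame hF₄ rfl rfl rfl).size)
      (ht₄.exists_unsettled hm₄' hk)).mono fun m₅ a₅ hF₅ ⟨hm₅, hb₅⟩ => ?_
    have hcard : card (a₅.na .ord) + 1 = card (a₂.na .ord) := by
      have : (Finset.range N).filter (fun x => a₅.na .ord x = 0) =
          ((Finset.range N).filter fun x => a₂.na .ord x = 0).erase b := by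
        ext x
        rw [hF₅.na .ord rfl, ho₄]
        simp only [Finset.mem_filter, Finset.mem_range, Finset.mem_erase, Function.update_apply]
        split_ifs with hx <;> simp [hx]
      simp only [card, this]
      exact Finset.card_erase_add_one (by simp [hb₂.lt, hb₂.ord_eq])
    refine ⟨by omega, ⟨?_, ?_, ?_⟩, by omega⟩
    · rwa [hF₅.na .ord rfl, hF₅.qa .D rfl]
    · rw [hF₅.n .q rfl, hq₄]
      omega
    · rw [hF₅.na .ord rfl, hF₅.qa .D rfl, hF₅.na .p rfl, hF₅.na .way rfl, hF₅.n .q rfl, hq₄]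
      exact ht₄
  · rintro m₂ a₂ hF₂ ⟨hb₂, hc₂, ht₂⟩ hlt hm₂
    have hA₂ : HasMatrix a₂ N w := (hA.frame hF₁ rfl rfl rfl).frame hF₂ rfl rfl rfl
    have hp₂ : a₂.na .p = a.na .p := by rw [hF₂.na .p rfl, hF₁.na .p rfl]
    simp only [Cond.holds, NExp.eval_get, NExp.eval_var, hA₂.size] at hlt
    rw [hcard₁] at hm₂
    refine ⟨by nlinarith, ?_, hb₂, _, by omega, ht₂⟩
    rcases hm.range _ hb₂.lt with h | h
    · rw [hp₂, h]
    · rw [hp₂] at hlt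
      omega

/-- The predecessors have strictly decreasing `ord`, so the walk ends at the root within `q + 1`
rounds and only overwrites columns that it will not read again. -/
theorem wp_augment {k q : ℕ} {w : ℕ → ℕ → ℚ} {pu pv : ℕ → ℚ} {ord : ℕ → ℕ} (hN : a.n .N = N)
    (hb : a.n .b < N) (hb0 : ord (a.n .b) = 0) (hle : ∀ x ≤ N, ord x ≤ q)
    (hway : ∀ x < N, a.na .way x ≤ N ∧ 0 < ord (a.na .way x) ∧
      (0 < ord x → ord (a.na .way x) < ord x))
    (ht : ∀ x < N, 0 < ord x ∨ x = a.n .b →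
      pu (a.na .p (a.na .way x)) + pv x = w (a.na .p (a.na .way x)) x)
    (ha : Augmenting N k (a.n .b) w pu pv (a.na .p)) :
    wp E augment (fun m a' => m ≤ 4 * (q + 1) + 1 ∧ Matching N (k + 1) w pu pv (a'.na .p)) a := by
  refine wp_while (fun a' => a'.n .b ≤ N ∧ (a'.n .b = a.n .b ∨ 0 < ord (a'.n .b)) ∧
      Augmenting N k (a'.n .b) w pu pv (a'.na .p) ∧
      -- Settled columns up to the current position in the order still carry the rows for which
      -- tightness of the tree edges is known.
      ∀ x ≤ N, 0 < ord x → (a'.n .b = a.n .b ∨ ord x ≤ ord (a'.n .b)) →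
        a'.na .p x = a.na .p x)
    -- The starting column is unsettled and has order `0` although it comes last on the path, so it
    -- is given the value `q + 1`.
    (fun a' => if a'.n .b = a.n .b then q + 1 else ord (a'.n .b)) 3
    ⟨hb.le, Or.inl rfl, ha, fun _ _ _ _ => rfl⟩ ?_ ?_
  · rintro a' hF ⟨hbN, hb', ha', hp⟩ hlt
    have hN' : a'.n .N = N := by rw [hF.n .N rfl, hN]
    have hw' : a'.na .way = a.na .way := hF.na .way rfl
    simp only [Cond.holds, NExp.eval_var, hN'] at hlt
    simp only [wp_seq, wp_nset, wp_nput, NExp.eval_var, NExp.eval_get, hw', Mem.setN_n,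
      Mem.setN_na, Mem.putN_na, Mem.putN_n, reduceCtorEq, if_true, if_false]
    set b := a'.n .b
    obtain ⟨hy, hy0, hylt⟩ := hway b hlt
    set y := a.na .way b
    have hyb : y ≠ b := by
      rintro h
      rcases hb' with h1 | h1
      · rw [h, h1] at hy0; omega
      · have := hylt h1
        rw [h] at this
        omega
    have hyb0 : y ≠ a.n .b := by
      intro h
      rw [h] at hy0
      omega
    have hpy : a'.na .p y = a.na .p y := by
      refine hp y hy hy0 ?_
      rcases hb' with h1 | h1
      · exact Or.inl h1
      · exact Or.inr (hylt h1).le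
    refine ⟨by omega, ⟨hy, Or.inr hy0, ha'.step hlt hy hyb ?_, ?_⟩, ?_⟩
    · rw [hpy]
      exact ht b hlt hb'.symm
    · intro x hx hx0 hxy
      have hxy' := hxy.resolve_left hyb0
      rw [Function.update_of_ne]
      · refine hp x hx hx0 ?_
        rcases hb' with h1 | h1
        · exact Or.inl h1
        · exact Or.inr (by have := hylt h1; omega)
      · rintro rfl
        rcases hb' with h1 | h1
        · rw [h1] at hx0; omega
        · have := hylt h1
          omega
    · rw [if_neg hyb0]
      split_ifs with h1
      · have := hle y hy
        omega
      · exact hylt (hb'.resolve_left h1)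
  · rintro m a' hF ⟨hbN, hb', ha', hp⟩ hlt hm
    have hN' : a'.n .N = N := by rw [hF.n .N rfl, hN]
    simp only [Cond.holds, NExp.eval_var, hN'] at hlt
    have : a'.n .b = N := by omega
    rw [this] at ha'
    rw [if_pos rfl] at hm
    exact ⟨by omega, ha'.matching⟩

/-- The rows are inserted one at a time, each with a quadratic number of steps. For no rows the zero
potentials and the empty assignment are optimal, whatever the signs of the weights. -/
theorem wp_hungarian {w : ℕ → ℕ → ℚ} (hA : HasMatrix a N w) :
    wp E hungarian (fun m a' => m ≤ 100 * (N + 1) ^ 3 ∧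
      ∀ c, Instance.AssignmentLe N w c ↔ a'.q .e ≤ c) a := by
  rw [hungarian, wp_seq]
  refine wp_for (fun l a' => ∀ x < l, a'.qa .pu x = 0 ∧ a'.qa .pv x = 0 ∧ a'.na .p x = N) N 3
    (fun a' hF => by simp [hF.n .N rfl, hA.size]) rfl (by simp) ?_ ?_
  · intro l a' hl hF hx hI
    simp only [wp_seq, wp_qput, wp_nput, NExp.eval_var, QExp.eval_zero, hx, hF.n .N rfl, hA.size,
      Mem.putQ_qa, Mem.putQ_na, Mem.putN_na, Mem.putN_qa, Mem.putQ_n, Mem.setN_na, Mem.setN_qa,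
      reduceCtorEq, if_true, if_false, Function.update_apply]
    refine ⟨by omega, fun x hx => ?_⟩
    grind
  intro m₁ a₁ hF₁ hI₁ hm₁
  have hA₁ : HasMatrix a₁ N w := hA.frame hF₁ rfl rfl rfl
  rw [wp_seq]
  refine wp_for (fun l a' => Matching N l w (a'.qa .pu) (a'.qa .pv) (a'.na .p)) N
    (13 * (N * N) + 29 * N + 40) (fun a' hF => by simp [hF.n .N rfl, hA₁.size]) rfl ?_ ?_ ?_
  · refine ⟨fun i hi => by omega, fun x hx h => ?_, fun x hx => Or.inl ?_,
      fun x hx y hy _ h => ?_, fun i hi => by omega⟩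
    · exact absurd (hI₁ x hx).2.2 h
    · exact (hI₁ x hx).2.2
    · exact absurd (hI₁ x hx).2.2 h
  · intro k a₂ hk hF₂ hx hM
    have hA₂ : HasMatrix a₂ N w := hA₁.frame hF₂ rfl rfl rfl
    rw [wp_seq]
    refine (wp_initTree hA₂.size hx (hA₂.base k hk) (hA₂.entry k hk)).mono
      fun m₃ a₃ hF₃ ⟨hm₃, hp₃, ho₃, hq₃, ht₃⟩ => ?_
    have hA₃ : HasMatrix a₃ N w := hA₂.frame hF₃ rfl rfl rfl
    have hp : ∀ x < N, a₃.na .p x = a₂.na .p x := fun x hx => by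
      rw [hp₃, Function.update_of_ne hx.ne]
    rw [← hF₃.qa .pu rfl, ← hF₃.qa .pv rfl] at hM ht₃
    have hM₃ : Matching N k w (a₃.qa .pu) (a₃.qa .pv) (a₃.na .p) := by
      refine ⟨hM.feasible, fun x hx h => ?_, fun x hx => ?_, fun x hx y hy h h' => ?_,
        fun i hi => ?_⟩
      · rw [hp x hx] at h ⊢
        exact hM.tight x hx h
      · rw [hp x hx]
        exact hM.range x hx
      · rw [hp x hx] at h h'
        rw [hp y hy] at h
        exact hM.inj x hx y hy h h'
      · obtain ⟨x, hx, h⟩ := hM.surj i hi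
        exact ⟨x, hx, by rw [hp x hx, h]⟩
    rw [wp_seq]
    refine (wp_growTree hA₃ hk hM₃ ho₃ hq₃ ht₃).mono
      fun m₄ a₄ hF₄ ⟨hm₄, hpb, hb₄, q, hq, ht₄⟩ => ?_
    have hA₄ : HasMatrix a₄ N w := hA₃.frame hF₄ rfl rfl rfl
    rw [← hF₄.qa .pu rfl, ← hF₄.qa .pv rfl] at ht₄ hM₃
    rw [← hF₄.na .p rfl] at hM₃
    rw [wp_seq]
    refine (wp_updatePotentials hA₄.size (Tree.p_inj hM₃.range hM₃.inj ht₄)).mono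
      fun m₅ a₅ hF₅ ⟨hm₅, hs⟩ => ?_
    have hn₅ : a₅.n .b = a₄.n .b := hF₅.n .b rfl
    have hp₅ : a₅.na .p = a₄.na .p := hF₅.na .p rfl
    have hw₅ : a₅.na .way = a₄.na .way := hF₅.na .way rfl
    refine (wp_augment (N := N) (k := k) (q := q) (w := w) (pu := a₅.qa .pu) (pv := a₅.qa .pv)
      (ord := a₄.na .ord) ((hF₅.n .N rfl).trans hA₄.size) (by rw [hn₅]; exact hb₄.lt)
      (by rw [hn₅]; exact hb₄.ord_eq) ht₄.ord_le (fun x hx => ?_) (fun x hx hx0 => ?_) ?_).mono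
      fun m₆ a₆ hF₆ ⟨hm₆, hM₆⟩ => ?_
    · rw [hw₅]
      exact ⟨ht₄.way_le x hx, ht₄.way_pos x hx, ht₄.way_lt x hx⟩
    · rw [hw₅, hp₅]
      rw [hn₅] at hx0
      exact ht₄.tight_way hs x hx hx0 hb₄.ord_eq
    · rw [hn₅, hp₅]
      exact ht₄.augmenting hk hM₃.feasible hM₃.tight hM₃.range hM₃.inj hM₃.surj hb₄ hs hpb
    · refine ⟨by omega, ?_⟩
      simp only [Mem.setN_qa, Mem.setN_na]
      rwa [hF₆.qa .pu rfl, hF₆.qa .pv rfl]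
  · intro m₂ a₂ hF₂ hM hm₂
    have hA₂ : HasMatrix a₂ N w := hA₁.frame hF₂ rfl rfl rfl
    rw [wp_seq, wp_qset]
    refine wp_for (fun l a' => a'.q .e = ∑ x ∈ Finset.range l, (a₂.qa .pu x + a₂.qa .pv x)) N 1
      (fun a' hF => by simp [hF.n .N rfl, hA₂.size]) rfl (by simp) ?_ ?_
    · intro l a' hl hF hx hI
      have hpu : a'.qa .pu = a₂.qa .pu := by simp [hF.qa .pu rfl]
      have hpv : a'.qa .pv = a₂.qa .pv := by simp [hF.qa .pv rfl]
      simp only [wp_qset, QExp.eval_add, QExp.eval_var, QExp.eval_get, NExp.eval_var, hx, hpu, hpv,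
        Mem.setN_q, Mem.setQ_q, if_true, hI, Finset.sum_range_succ]
      exact ⟨le_rfl, trivial⟩
    · intro m₃ a₃ hF₃ hI₃ hm₃
      refine ⟨?_, fun c => ?_⟩
      · have : (100 : ℕ) * (N + 1) ^ 3 = 100 * (N * N * N) + 300 * (N * N) + 300 * N + 100 := by ring
        rw [this]
        nlinarith
      · rw [hM.assignmentLe_iff, hI₃]

end loops


set_option linter.constructorNameAsVariable false

/-! ## The main program -/

/-- Look up the cost of assigning `u` to `v` in the layers `i` and `j`. -/
def lookupWeight : Cmd :=
  .ite (.lt .u .nV)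
    (.ite (.lt .v .nW) (.qset .s (.dist .i .j .u .v)) (.qset .s (.delG .i .u)))
    (.qset .s (.delH .j .v))

/-- Combine the entries of the matrix `A` with the costs for the layers `i` and `j`. -/
def changeLayer (op : QExp → QExp → QExp) : Cmd :=
  .for .u .N (.for .v .N (lookupWeight ;;
    .qput .A (.get .rb .u + .v) (op (.get .A (.get .rb .u + .v)) .s)))

/-- Store the change of row and column of the move `mv`. -/
def lookupMove : Cmd :=
  .ite (.lt .mv 2) (.nset .x 1) (.nset .x 0) ;;
  .ite (.eq .mv 0) (.nset .y 1) (.ite (.eq .mv 2) (.nset .y 1) (.nset .y 0))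

/-- Go to the next pair of layers on the path. -/
def push : Cmd :=
  .nput .st .len .mv ;; .nset .i (.i - .x) ;; .nset .j (.j - .y) ;; .nset .r (.r - 1) ;;
  .nset .len (.len + 1) ;; .nset .mv 0 ;; changeLayer (· + ·)

/-- Make the move `mv` if it leads to a pair of layers from which the path can be completed. -/
def tryMove : Cmd :=
  lookupMove ;;
  .ite (.lt .i .x) (.nset .mv (.mv + 1))
    (.ite (.lt .j .y) (.nset .mv (.mv + 1))
      (.ite (.lt (.i - .x) .r)
        (.ite (.lt (.j - .y) .r) push (.nset .mv (.mv + 1)))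
        (.nset .mv (.mv + 1))))

/-- Solve the assignment problem for a complete path. -/
def checkPath : Cmd :=
  .ite (.eq .i 0)
    (.ite (.eq .j 0) (hungarian ;; .ite (.qle .e .c) (.nset .fl 1) .skip) .skip)
    .skip

/-- Leave a pair of layers. -/
def pop : Cmd :=
  checkPath ;;
  changeLayer (· - ·) ;;
  .nset .len (.len - 1) ;; .nset .mv (.get .st .len) ;;
  lookupMove ;;
  .nset .i (.i + .x) ;; .nset .j (.j + .y) ;; .nset .r (.r + 1) ;; .nset .mv (.mv + 1)

def searchStep : Cmd := .ite (.lt .mv 3) tryMove pop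

def setup : Cmd :=
  .ite (.lt .nV .nW) (.nset .N .nW) (.nset .N .nV) ;;
  .nset .y 0 ;;
  .for .x .N (.nput .rb .x .y ;; .nset .y (.y + .N)) ;;
  .nset .i (.T - 1) ;; .nset .j (.U - 1) ;; .nset .r (.T + .lam - 1) ;;
  -- The move `3` changes neither row nor column. As a sentinel below the first pair of layers it
  -- lets that pair be left like any other.
  .nput .st 0 3 ;; .nset .len 1 ;; .nset .mv 0 ;; .nset .fl 0 ;;
  changeLayer (· + ·)

/-- Decide the problem by going through all warping paths. -/
def decideDtgw : Cmd :=
  setup ;; .while (.lt 0 .len) searchStep ;; .nset .T .fl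

/-! ### Maintaining the matrix of accumulated weights -/

section layer

variable {x : Instance} {a : Mem} {N : ℕ}

theorem mul_add_inj {N u v u' v' : ℕ} (hv : v < N) (hv' : v' < N) (h : u * N + v = u' * N + v') :
    u = u' ∧ v = v' := by
  have h1 : (u * N + v) / N = u := by
    rw [mul_comm, Nat.mul_add_div (by omega), Nat.div_eq_of_lt hv, add_zero]
  have h2 : (u' * N + v') / N = u' := by
    rw [mul_comm, Nat.mul_add_div (by omega), Nat.div_eq_of_lt hv', add_zero]
  have h3 : u = u' := by rw [← h1, ← h2, h]
  subst h3
  exact ⟨rfl, by omega⟩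

theorem wp_lookupWeight (hV : a.n .nV = x.nV) (hW : a.n .nW = x.nW) :
    wp x.tables lookupWeight (fun m a' => m ≤ 3 ∧
      a' = a.setQ .s (x.weight (a.n .i) (a.n .j) (a.n .u) (a.n .v))) a := by
  simp only [lookupWeight, wp_ite, wp_qset, Cond.holds, NExp.eval_var, QExp.eval_dist,
    QExp.eval_delG, QExp.eval_delH, hV, hW, Instance.weight]
  refine ⟨fun h => ⟨fun h' => ⟨by omega, ?_⟩, fun h' => ⟨by omega, ?_⟩⟩, fun h => ⟨by omega, ?_⟩⟩
  · rw [if_pos h, if_pos h']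
  · rw [if_pos h, if_neg h']
  · rw [if_neg h]

/-- Stated for a general operation so that it covers both entering a pair of layers, by addition,
and leaving it, by subtraction. -/
theorem wp_changeLayer {op : QExp → QExp → QExp} {g : ℚ → ℚ → ℚ}
    (hop : ∀ E b p q, (op p q).eval E b = g (p.eval E b) (q.eval E b)) {w : ℕ → ℕ → ℚ}
    (hA : HasMatrix a N w) (hV : a.n .nV = x.nV) (hW : a.n .nW = x.nW) :
    wp x.tables (changeLayer op) (fun m a' => m ≤ N * (6 * N + 4) + 2 ∧
      HasMatrix a' N fun u v => g (w u v) (x.weight (a.n .i) (a.n .j) u v)) a := by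
  set i := a.n .i with hi
  set j := a.n .j with hj
  refine wp_for (fun l a' => ∀ u < N, ∀ v < N, a'.qa .A (u * N + v) =
      if u < l then g (w u v) (x.weight i j u v) else w u v) N (6 * N + 2)
    (fun a' hF => by simp [hF.n .N rfl, hA.size]) rfl (by simpa using hA.entry) ?_ ?_
  · intro l a' hl hF hu hI
    have hN' : a'.n .N = N := by simp [hF.n .N rfl, hA.size]
    have hrb : a'.na .rb l = l * N := by rw [hF.na .rb rfl, hA.base l hl]
    refine wp_for (fun l' a'' => ∀ u < N, ∀ v < N, a''.qa .A (u * N + v) =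
        if u < l ∨ (u = l ∧ v < l') then g (w u v) (x.weight i j u v) else w u v) N 4
      (fun a'' hF' => by simp [hF'.n .N rfl, hN']) rfl (by simpa using hI) ?_ ?_
    · intro l' a'' hl' hF' hv hI'
      rw [wp_seq]
      refine (wp_lookupWeight (x := x) (by rw [hF'.n .nV rfl, hF.n .nV rfl, hV])
        (by rw [hF'.n .nW rfl, hF.n .nW rfl, hW])).mono ?_
      rintro m b - ⟨hm, rfl⟩
      have hi' : a''.n .i = i := by rw [hF'.n .i rfl, hF.n .i rfl]
      have hj' : a''.n .j = j := by rw [hF'.n .j rfl, hF.n .j rfl]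
      have hu' : a''.n .u = l := by rw [hF'.n .u rfl, hu]
      have hrb' : a''.na .rb l = l * N := by rw [hF'.na .rb rfl, hrb]
      have hA' : a''.qa .A (l * N + l') = w l l' := by
        rw [hI' l hl l' hl', if_neg (by omega)]
      simp only [wp_qput, NExp.eval_add, NExp.eval_get, NExp.eval_var, hop, QExp.eval_get,
        QExp.eval_var, Mem.setQ_n, Mem.setQ_na, Mem.setQ_qa, Mem.setQ_q, hi', hj', hu', hv, hrb',
        hA', Mem.setN_qa, Mem.putQ_qa, if_true]
      refine ⟨by omega, fun u hu v hv => ?_⟩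
      by_cases he : u = l ∧ v = l'
      · obtain ⟨rfl, rfl⟩ := he
        rw [Function.update_self, if_pos (by omega)]
      · rw [Function.update_of_ne fun h => he (mul_add_inj hv hl' h), hI' u hu v hv]
        refine if_congr ?_ rfl rfl
        omega
    · intro m a'' hF' hI' hm
      refine ⟨by omega, fun u hu v hv => ?_⟩
      rw [Mem.setN_qa, hI' u hu v hv]
      refine if_congr ?_ rfl rfl
      omega
  · intro m a' hF hI hm
    refine ⟨by omega, ⟨(hF.n .N rfl).trans hA.size, fun u hu => ?_, fun u hu v hv => ?_⟩⟩
    · rw [hF.na .rb rfl, hA.base u hu]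
    · rw [hI u hu v hv, if_pos hu]

end layer

/-! ### Depth-first search over the warping paths -/

section search

theorem wp_lookupMove {E : Tables} {a : Mem} {Q : ℕ → Mem → Prop}
    (h : ∀ m ≤ 5, Q m ((a.setN .x (rowStep (a.n .mv))).setN .y (colStep (a.n .mv)))) :
    wp E lookupMove Q a := by
  simp only [lookupMove, wp_seq, wp_ite, wp_nset, Cond.holds, NExp.eval_var, NExp.eval_zero,
    NExp.eval_one, NExp.eval_two, Mem.setN_n, reduceCtorEq, if_false]
  generalize a.n .mv = c at h ⊢
  rcases c with - | - | - | c <;> simp [rowStep, colStep] at h ⊢ <;> exact h _ (by omega)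

/-- `P` repeated while `b` holds leads from `a` to `a'` in `m` steps. -/
def Reaches (E : Tables) (b : Cond) (P : Cmd) (a : Mem) (m : ℕ) (a' : Mem) : Prop :=
  ∀ m' a'', Runs E (.while b P) a' m' a'' → Runs E (.while b P) a (m + m') a''

/-- The recursion is simulated by a single loop with a stack. Composing stretches of this loop
allows them to be treated like recursive calls. -/
theorem Reaches.trans {E : Tables} {b : Cond} {P : Cmd} {a₁ a₂ a₃ : Mem} {m m' : ℕ}
    (h : Reaches E b P a₁ m a₂) (h' : Reaches E b P a₂ m' a₃) : Reaches E b P a₁ (m + m') a₃ := by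
  intro n a hr
  rw [add_assoc]
  exact h _ _ (h' _ _ hr)

theorem Reaches.single {E : Tables} {b : Cond} {P : Cmd} {a a' : Mem} {m : ℕ}
    (hb : b.holds E a) (h : Runs E P a m a') : Reaches E b P a (1 + m) a' :=
  fun _ _ hr => .while_step hb h hr

/-- The state of the search at the pair `(i, j)` of layers, with `r` moves left and matrix `w`;
the moves on the stack are `st`, and `f` tells whether a solution has been found. -/
structure Node (x : Instance) (w : ℕ → ℕ → ℚ) (i j r len mv : ℕ) (st : ℕ → ℕ) (f : Prop)
    (a : Mem) : Prop where
  matrix : HasMatrix a x.n w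
  nV_eq : a.n .nV = x.nV
  nW_eq : a.n .nW = x.nW
  c_eq : a.q .c = x.c
  i_eq : a.n .i = i
  j_eq : a.n .j = j
  r_eq : a.n .r = r
  len_eq : a.n .len = len
  mv_eq : a.n .mv = mv
  stack : ∀ k < len, a.na .st k = st k
  flag_le : a.n .fl ≤ 1
  flag : a.n .fl = 1 ↔ f

variable {x : Instance} {w : ℕ → ℕ → ℚ} {i j r len mv : ℕ} {st : ℕ → ℕ} {f : Prop} {a : Mem}

theorem Node.congr {f' : Prop} (h : Node x w i j r len mv st f a) (hf : f ↔ f') :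
    Node x w i j r len mv st f' a := { h with flag := h.flag.trans hf }

/-- Bound for the steps of `changeLayer`. -/
def layerCostBound (N : ℕ) : ℕ := N * (6 * N + 4) + 2

/-- A move is tried in vain. -/
theorem Node.skip_move (h : Node x w i j r len mv st f a) (hmv : mv < 3) (hlen : 0 < len)
    (hno : ¬ (mv ∈ backMoves i j ∧ i - rowStep mv < r ∧ j - colStep mv < r)) :
    ∃ m a', Reaches x.tables (.lt 0 .len) searchStep a m a' ∧ m ≤ 15 ∧
      Node x w i j r len (mv + 1) st f a' := by
  rw [mem_backMoves] at hno
  suffices hw : wp x.tables searchStep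
      (fun m a' => m ≤ 14 ∧ Node x w i j r len (mv + 1) st f a') a by
    obtain ⟨m, a', hr, hm, hn⟩ := hw
    have hb : (Cond.lt 0 .len).holds x.tables a := by
      simpa [Cond.holds, h.len_eq] using hlen
    exact ⟨_, a', .single hb hr, by omega, hn⟩
  have hn : Node x w i j r len (mv + 1) st f
      (((a.setN .x (rowStep mv)).setN .y (colStep mv)).setN .mv (mv + 1)) :=
    ⟨⟨by simp [h.matrix.size], h.matrix.base, h.matrix.entry⟩, by simp [h.nV_eq], by simp [h.nW_eq], h.c_eq,
      by simp [h.i_eq], by simp [h.j_eq], by simp [h.r_eq], by simp [h.len_eq], by simp, h.stack,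
      by simp [h.flag_le], by simp [h.flag]⟩
  rw [searchStep, wp_ite]
  refine ⟨fun _ => ?_, fun h' => absurd (by simpa [Cond.holds, h.mv_eq] using hmv) h'⟩
  rw [tryMove, wp_seq]
  refine wp_lookupMove fun m hm => ?_
  simp only [wp_ite, wp_nset, Cond.holds, NExp.eval_var, NExp.eval_sub, NExp.eval_add,
    NExp.eval_one, Mem.setN_n, reduceCtorEq, if_true, if_false, h.mv_eq, h.i_eq, h.j_eq, h.r_eq]
  refine ⟨fun _ => ⟨by omega, hn⟩, fun h1 => ⟨fun _ => ⟨by omega, hn⟩, fun h2 =>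
    ⟨fun h3 => ⟨fun h4 => absurd ?_ hno, fun _ => ⟨by omega, hn⟩⟩, fun _ => ⟨by omega, hn⟩⟩⟩⟩
  exact ⟨⟨hmv, by omega, by omega⟩, h3, h4⟩

/-- A move is made. -/
theorem Node.push_move (h : Node x w i j r len mv st f a) (hmv : mv ∈ backMoves i j)
    (hi : i - rowStep mv < r) (hj : j - colStep mv < r) (hlen : 0 < len) :
    ∃ m a', Reaches x.tables (.lt 0 .len) searchStep a m a' ∧
      m ≤ layerCostBound x.n + 20 ∧
      Node x (w + x.weight (i - rowStep mv) (j - colStep mv)) (i - rowStep mv) (j - colStep mv)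
        (r - 1) (len + 1) 0 (Function.update st len mv) f a' := by
  obtain ⟨hmv, hri, hcj⟩ := mem_backMoves.1 hmv
  suffices hw : wp x.tables searchStep (fun m a' => m ≤ layerCostBound x.n + 19 ∧
      Node x (w + x.weight (i - rowStep mv) (j - colStep mv)) (i - rowStep mv) (j - colStep mv)
        (r - 1) (len + 1) 0 (Function.update st len mv) f a') a by
    obtain ⟨m, a', hr, hm, hn⟩ := hw
    have hb : (Cond.lt 0 .len).holds x.tables a := by
      simpa [Cond.holds, h.len_eq] using hlen
    exact ⟨_, a', .single hb hr, by omega, hn⟩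
  rw [searchStep, wp_ite]
  refine ⟨fun _ => ?_, fun h' => absurd (by simpa [Cond.holds, h.mv_eq] using hmv) h'⟩
  rw [tryMove, wp_seq]
  refine wp_lookupMove fun m hm => ?_
  simp only [wp_ite, Cond.holds, NExp.eval_var, NExp.eval_sub, Mem.setN_n, reduceCtorEq, if_true,
    if_false, h.mv_eq, h.i_eq, h.j_eq, h.r_eq]
  refine ⟨fun h1 => by omega, fun _ => ⟨fun h1 => by omega, fun _ =>
    ⟨fun _ => ⟨fun _ => ?_, fun h1 => absurd hj h1⟩, fun h1 => absurd hi h1⟩⟩⟩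
  simp only [push, wp_seq, wp_nset, wp_nput, NExp.eval_var, NExp.eval_sub, NExp.eval_add,
    NExp.eval_one, NExp.eval_zero, Mem.setN_n, Mem.putN_n, reduceCtorEq, if_true, if_false,
    h.mv_eq, h.i_eq, h.j_eq, h.r_eq, h.len_eq]
  set b := ((((((((a.setN .x (rowStep mv)).setN .y (colStep mv)).putN .st len mv).setN .i
    (i - rowStep mv)).setN .j (j - colStep mv)).setN .r (r - 1)).setN .len (len + 1)).setN .mv 0)
    with hb
  have hbi : b.n .i = i - rowStep mv := by simp [hb]
  have hbj : b.n .j = j - colStep mv := by simp [hb]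
  have hbA : HasMatrix b x.n w :=
    ⟨by simp [hb, h.matrix.size], by simpa [hb] using h.matrix.base,
      by simpa [hb] using h.matrix.entry⟩
  refine (wp_changeLayer (x := x) (g := (· + ·)) (fun _ _ _ _ => rfl) hbA (by simp [hb, h.nV_eq])
    (by simp [hb, h.nW_eq])).mono fun m' a' hF ⟨hm', hA'⟩ => ?_
  rw [hbi, hbj] at hA'
  refine ⟨by unfold layerCostBound; omega, ⟨hA', ?_, ?_, ?_, ?_, ?_, ?_, ?_, ?_, ?_, ?_, ?_⟩⟩
  · rw [hF.n .nV rfl]; simp [hb, h.nV_eq]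
  · rw [hF.n .nW rfl]; simp [hb, h.nW_eq]
  · rw [hF.q .c rfl]; simp [hb, h.c_eq]
  · rw [hF.n .i rfl, hbi]
  · rw [hF.n .j rfl, hbj]
  · rw [hF.n .r rfl]; simp [hb]
  · rw [hF.n .len rfl]; simp [hb]
  · rw [hF.n .mv rfl]; simp [hb]
  · intro k hk
    rw [hF.na .st rfl]
    simp only [hb, Mem.setN_na, Mem.putN_na, if_true, Function.update_apply]
    split_ifs with he
    · rfl
    · exact h.stack k (by omega)
  · rw [hF.n .fl rfl]; simp [hb, h.flag_le]
  · rw [hF.n .fl rfl]; simp [hb, h.flag]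

/-- The cubic cost arises only at `(0, 0)`, where a path is complete. The bound keeps the two cases
apart so that it can be charged once per path. -/
theorem Node.wp_checkPath (h : Node x w i j r len mv st f a) :
    wp x.tables checkPath (fun m a' => (m ≤ 3 ∨ i = 0 ∧ j = 0 ∧ m ≤ 100 * (x.n + 1) ^ 3 + 4) ∧
      Node x w i j r len mv st (f ∨ i = 0 ∧ j = 0 ∧ Instance.AssignmentLe x.n w x.c) a') a := by
  have key : ∀ {a'}, (i = 0 → j = 0 → False) → Node x w i j r len mv st f a' →
      Node x w i j r len mv st (f ∨ i = 0 ∧ j = 0 ∧ Instance.AssignmentLe x.n w x.c) a' := by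
    intro a' h1 h2
    exact h2.congr ⟨Or.inl, fun h3 => h3.resolve_right fun h4 => h1 h4.1 h4.2.1⟩
  simp only [checkPath, wp_ite, wp_skip, Cond.holds, NExp.eval_var, NExp.eval_zero, h.i_eq, h.j_eq]
  refine ⟨fun hi => ⟨fun hj => ?_, fun hj => ⟨Or.inl (by omega), key (fun _ h => hj h) h⟩⟩,
    fun hi => ⟨Or.inl (by omega), key (fun h _ => hi h) h⟩⟩
  rw [wp_seq]
  refine (wp_hungarian h.matrix).mono fun m a' hF ⟨hm, hopt⟩ => ?_
  have hc : a'.q .c = x.c := by rw [hF.q .c rfl, h.c_eq]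
  have hn : Node x w i j r len mv st f a' :=
    ⟨h.matrix.frame hF rfl rfl rfl, by rw [hF.n .nV rfl, h.nV_eq], by rw [hF.n .nW rfl, h.nW_eq], hc,
      by rw [hF.n .i rfl, h.i_eq], by rw [hF.n .j rfl, h.j_eq], by rw [hF.n .r rfl, h.r_eq],
      by rw [hF.n .len rfl, h.len_eq], by rw [hF.n .mv rfl, h.mv_eq],
      by rw [hF.na .st rfl]; exact h.stack, by rw [hF.n .fl rfl]; exact h.flag_le,
      by rw [hF.n .fl rfl]; exact h.flag⟩
  simp only [wp_ite, wp_nset, wp_skip, Cond.holds, QExp.eval_var, NExp.eval_one, hc, ← hopt]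
  refine ⟨fun h1 => ⟨Or.inr ⟨hi, hj, by omega⟩, ?_⟩,
    fun h1 => ⟨Or.inr ⟨hi, hj, by omega⟩, ?_⟩⟩
  · exact ⟨⟨by simp [hn.matrix.size], hn.matrix.base, hn.matrix.entry⟩, by simp [hn.nV_eq],
      by simp [hn.nW_eq], hn.c_eq, by simp [hn.i_eq], by simp [hn.j_eq], by simp [hn.r_eq], by simp [hn.len_eq],
      by simp [hn.mv_eq], hn.stack, by simp, by simp [hi, hj, h1]⟩
  · exact hn.congr ⟨Or.inl, fun h2 => h2.resolve_right fun h3 => h1 h3.2.2⟩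

/-- The pair of layers is left after all moves have been tried. -/
theorem Node.pop_move (h : Node x (w + x.weight i j) i j r (len + 1) 3 st f a) :
    ∃ m a', Reaches x.tables (.lt 0 .len) searchStep a m a' ∧
      (m ≤ layerCostBound x.n + 20 ∨
        i = 0 ∧ j = 0 ∧ m ≤ layerCostBound x.n + 20 + 100 * (x.n + 1) ^ 3) ∧
      Node x w (i + rowStep (st len)) (j + colStep (st len)) (r + 1) len (st len + 1) st
        (f ∨ i = 0 ∧ j = 0 ∧ Instance.AssignmentLe x.n (w + x.weight i j) x.c) a' := by
  suffices hw : wp x.tables searchStep (fun m a' => (m ≤ layerCostBound x.n + 19 ∨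
        i = 0 ∧ j = 0 ∧ m ≤ layerCostBound x.n + 19 + 100 * (x.n + 1) ^ 3) ∧
      Node x w (i + rowStep (st len)) (j + colStep (st len)) (r + 1) len (st len + 1) st
        (f ∨ i = 0 ∧ j = 0 ∧ Instance.AssignmentLe x.n (w + x.weight i j) x.c) a') a by
    obtain ⟨m, a', hr, hm, hn⟩ := hw
    have hb : (Cond.lt 0 .len).holds x.tables a := by
      simp [Cond.holds, h.len_eq]
    exact ⟨_, a', .single hb hr, by omega, hn⟩
  rw [searchStep, wp_ite]
  refine ⟨fun h' => absurd h' (by simp [Cond.holds, h.mv_eq]), fun _ => ?_⟩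
  rw [pop, wp_seq]
  refine h.wp_checkPath.mono fun m₁ a₁ hF₁ ⟨hm₁, h₁⟩ => ?_
  rw [wp_seq]
  refine (wp_changeLayer (x := x) (g := (· - ·)) (fun _ _ _ _ => rfl) h₁.matrix h₁.nV_eq
    h₁.nW_eq).mono fun m₂ a₂ hF₂ ⟨hm₂, hA₂⟩ => ?_
  -- Subtracting the weights of the pair restores exactly the matrix of its parent, as the
  -- arithmetic is exact.
  have hA : HasMatrix a₂ x.n w := by
    convert hA₂ using 3
    simp [h₁.i_eq, h₁.j_eq]
  have hi₂ : a₂.n .i = i := by rw [hF₂.n .i rfl, h₁.i_eq]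
  have hj₂ : a₂.n .j = j := by rw [hF₂.n .j rfl, h₁.j_eq]
  have hr₂ : a₂.n .r = r := by rw [hF₂.n .r rfl, h₁.r_eq]
  have hl₂ : a₂.n .len = len + 1 := by rw [hF₂.n .len rfl, h₁.len_eq]
  have hs₂ : ∀ k < len + 1, a₂.na .st k = st k := by rw [hF₂.na .st rfl]; exact h₁.stack
  simp only [wp_seq, wp_nset, NExp.eval_var, NExp.eval_sub, NExp.eval_one, NExp.eval_get,
    Mem.setN_n, Mem.setN_na, if_true, hl₂, Nat.add_sub_cancel, hs₂ len (Nat.lt_succ_self _)]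
  refine wp_lookupMove fun m hm => ?_
  simp only [NExp.eval_var, NExp.eval_add, NExp.eval_one, Mem.setN_n, reduceCtorEq, if_true,
    if_false, hi₂, hj₂, hr₂]
  refine ⟨by unfold layerCostBound; omega, ?_⟩
  refine ⟨⟨by simp [hA.size], hA.base, hA.entry⟩, ?_, ?_, ?_, by simp, by simp, by simp, by simp,
    by simp, fun k hk => hs₂ k (by omega), ?_, ?_⟩
  · simp [hF₂.n .nV rfl, h₁.nV_eq]
  · simp [hF₂.n .nW rfl, h₁.nW_eq]
  · simp [hF₂.q .c rfl, h₁.c_eq]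
  · simp [hF₂.n .fl rfl, h₁.flag_le]
  · simp [hF₂.n .fl rfl, h₁.flag]

/-- Bound for the steps at a pair of layers, without solving assignment problems. -/
def nodeBound (N : ℕ) : ℕ := 4 * layerCostBound N + 80

/-- Bound for the steps to visit all completions of a path. -/
def visitBound (N r i j : ℕ) : ℕ :=
  (backPaths r i j).card * ((r + 1) * nodeBound N + 100 * (N + 1) ^ 3)

/-- The search visits all completions of a path. -/
def Visits (x : Instance) (r : ℕ) : Prop :=
  ∀ (i j len : ℕ) (st : ℕ → ℕ) (w : ℕ → ℕ → ℚ) (f : Prop) (a : Mem), i ≤ r → j ≤ r →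
    Node x (w + x.weight i j) i j r (len + 1) 0 st f a →
    ∃ m a', Reaches x.tables (.lt 0 .len) searchStep a m a' ∧ m ≤ visitBound x.n r i j ∧
      Node x w (i + rowStep (st len)) (j + colStep (st len)) (r + 1) len (st len + 1) st
        (f ∨ ∃ l ∈ backPaths r i j, Instance.AssignmentLe x.n (w + x.pathWeight l) x.c) a'

/-- The paths that continue with the move `mv`. -/
def childPaths (r i j mv : ℕ) : Finset (List (ℕ × ℕ)) :=
  if mv ∈ backMoves i j then backPaths r (i - rowStep mv) (j - colStep mv) else ∅

/-- An admissible move is a push followed by a visit with one move less; the concluding pop restores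
the node. A rejected move has no completions. -/
theorem Node.visit_child (hr : Visits x r) (h : Node x w i j (r + 1) len mv st f a)
    (hmv : mv < 3) (hlen : 0 < len) :
    ∃ m a', Reaches x.tables (.lt 0 .len) searchStep a m a' ∧
      m ≤ layerCostBound x.n + 20 +
        (childPaths r i j mv).card * ((r + 1) * nodeBound x.n + 100 * (x.n + 1) ^ 3) ∧
      Node x w i j (r + 1) len (mv + 1) st
        (f ∨ ∃ l ∈ childPaths r i j mv, Instance.AssignmentLe x.n (w + x.pathWeight l) x.c) a' := by
  by_cases hc : mv ∈ backMoves i j ∧ i - rowStep mv < r + 1 ∧ j - colStep mv < r + 1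
  · obtain ⟨hm, hi, hj⟩ := hc
    obtain ⟨m₁, a₁, hr₁, hm₁, h₁⟩ := h.push_move hm hi hj hlen
    obtain ⟨m₂, a₂, hr₂, hm₂, h₂⟩ := hr _ _ _ _ _ _ _ (Nat.le_of_lt_succ hi)
      (Nat.le_of_lt_succ hj) h₁
    obtain ⟨-, h3, h4⟩ := mem_backMoves.1 hm
    rw [Function.update_self, Nat.sub_add_cancel h3, Nat.sub_add_cancel h4] at h₂
    rw [childPaths, if_pos hm]
    refine ⟨_, a₂, hr₁.trans hr₂, ?_, { h₂ with stack := fun k hk => ?_ }⟩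
    · unfold visitBound at hm₂
      omega
    · rw [h₂.stack k hk, Function.update_of_ne hk.ne]
  · obtain ⟨m₁, a₁, hr₁, hm₁, h₁⟩ := h.skip_move hmv hlen hc
    have hempty : childPaths r i j mv = ∅ := by
      rw [childPaths]
      split_ifs with hm
      -- The machine's test `i - rowStep mv < r + 1` is the nonemptiness criterion for the child,
      -- which has `r` moves left.
      · rw [← Finset.not_nonempty_iff_eq_empty, backPaths_nonempty_iff]
        rintro ⟨h1, h2⟩
        exact hc ⟨hm, by omega, by omega⟩
      · rfl
    refine ⟨m₁, a₁, hr₁, by omega, h₁.congr ?_⟩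
    simp [hempty]

/-- Lets the step bounds of the three children add up to the bound of their parent. -/
theorem card_childPaths {r i j : ℕ} (h : ¬ (i = 0 ∧ j = 0)) :
    (childPaths r i j 0).card + (childPaths r i j 1).card + (childPaths r i j 2).card =
      (backPaths (r + 1) i j).card := by
  rw [card_backPaths, Finset.sum_range_succ']
  have h0 : pathCount 0 i j = 0 := by
    rcases i with - | i <;> rcases j with - | j <;> simp_all [pathCount]
  rw [h0, add_zero]
  simp only [pathCount_succ _ _ _ h]
  rw [Finset.sum_comm, backMoves, Finset.sum_filter]
  simp only [Finset.sum_range_succ, Finset.sum_range_zero, childPaths, mem_backMoves,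
    zero_add]
  congr 1
  · congr 1
    · simp only [← Finset.sum_range_succ, ← card_backPaths]
      split_ifs <;> simp_all
    · simp only [← Finset.sum_range_succ, ← card_backPaths]
      split_ifs <;> simp_all
  · simp only [← Finset.sum_range_succ, ← card_backPaths]
    split_ifs <;> simp_all

theorem mem_backPaths_iff_childPaths {r i j : ℕ} (h : ¬ (i = 0 ∧ j = 0)) {l : List (ℕ × ℕ)} :
    l ∈ backPaths (r + 1) i j ↔ ∃ mv < 3, ∃ l' ∈ childPaths r i j mv, l = (i, j) :: l' := by
  rw [mem_backPaths_succ h]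
  constructor
  · rintro ⟨m, hm, l', hl', rfl⟩
    exact ⟨m, (mem_backMoves.1 hm).1, l', by rwa [childPaths, if_pos hm], rfl⟩
  · rintro ⟨m, -, l', hl', rfl⟩
    rw [childPaths] at hl'
    split_ifs at hl' with hm
    · exact ⟨m, hm, l', hl', rfl⟩
    · simp at hl'

theorem Instance.pathWeight_cons (x : Instance) (i j : ℕ) (l : List (ℕ × ℕ)) :
    x.pathWeight ((i, j) :: l) = x.weight i j + x.pathWeight l := by
  funext u v
  simp [Instance.pathWeight]

theorem Instance.pathWeight_nil (x : Instance) : x.pathWeight [] = 0 := by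
  funext u v
  simp [Instance.pathWeight]

theorem childPaths_zero_zero (r : ℕ) {mv : ℕ} (hmv : mv < 3) : childPaths r 0 0 mv = ∅ := by
  rw [childPaths, if_neg]
  rw [mem_backMoves]
  interval_cases mv <;> simp [rowStep, colStep]

/-- Induction on the moves left. The work at the node itself, at most three pushes and one pop, is
covered by `nodeBound` and charged to one of its completions; `visitBound` provides one `nodeBound`
per completion and level. -/
theorem visits (x : Instance) (r : ℕ) : Visits x r := by
  induction r with
  | zero =>
    intro i j len st w f a hi hj h
    obtain rfl : i = 0 := by omega
    obtain rfl : j = 0 := by omega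
    obtain ⟨m₁, a₁, hr₁, hm₁, h₁⟩ := h.skip_move (by omega) (by omega) (by omega)
    obtain ⟨m₂, a₂, hr₂, hm₂, h₂⟩ := h₁.skip_move (by omega) (by omega) (by omega)
    obtain ⟨m₃, a₃, hr₃, hm₃, h₃⟩ := h₂.skip_move (by omega) (by omega) (by omega)
    obtain ⟨m₄, a₄, hr₄, hm₄, h₄⟩ := h₃.pop_move
    refine ⟨_, a₄, ((hr₁.trans hr₂).trans hr₃).trans hr₄, ?_, h₄.congr (or_congr Iff.rfl ?_)⟩
    · rw [visitBound, backPaths_zero_zero, Finset.card_singleton]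
      unfold nodeBound
      omega
    · simp [backPaths_zero_zero, Instance.pathWeight_cons, Instance.pathWeight_nil]
  | succ r ih =>
    intro i j len st w f a hi hj h
    obtain ⟨m₁, a₁, hr₁, hm₁, h₁⟩ := h.visit_child ih (by omega) (by omega)
    obtain ⟨m₂, a₂, hr₂, hm₂, h₂⟩ := h₁.visit_child ih (by omega) (by omega)
    obtain ⟨m₃, a₃, hr₃, hm₃, h₃⟩ := h₂.visit_child ih (by omega) (by omega)
    obtain ⟨m₄, a₄, hr₄, hm₄, h₄⟩ := h₃.pop_move
    refine ⟨_, a₄, ((hr₁.trans hr₂).trans hr₃).trans hr₄, ?_, h₄.congr ?_⟩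
    · set K := (r + 1) * nodeBound x.n + 100 * (x.n + 1) ^ 3 with hK
      have hn : nodeBound x.n = 4 * layerCostBound x.n + 80 := rfl
      have hv : visitBound x.n (r + 1) i j =
          (backPaths (r + 1) i j).card * K + (backPaths (r + 1) i j).card * nodeBound x.n := by
        rw [visitBound, hK]
        ring
      rw [hv]
      by_cases hij : i = 0 ∧ j = 0
      · obtain ⟨rfl, rfl⟩ := hij
        have hK' : 100 * (x.n + 1) ^ 3 ≤ K := by omega
        rw [childPaths_zero_zero r (by omega), Finset.card_empty, zero_mul] at hm₁ hm₂ hm₃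
        rw [backPaths_zero_zero, Finset.card_singleton, one_mul, one_mul]
        omega
      -- Pruning guarantees a completion below every visited node, so there is a path to charge.
      · have hpos : 1 ≤ (backPaths (r + 1) i j).card :=
          Finset.card_pos.2 ((backPaths_nonempty_iff _ _ _).2 ⟨hi, hj⟩)
        have hle := Nat.mul_le_mul_right (nodeBound x.n) hpos
        have hc := congrArg (· * K) (card_childPaths (r := r) hij)
        simp only [add_mul] at hc
        norm_num only at hm₂ hm₃
        omega
    · by_cases hij : i = 0 ∧ j = 0
      · obtain ⟨rfl, rfl⟩ := hij
        simp [childPaths_zero_zero, backPaths_zero_zero, Instance.pathWeight_cons,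
          Instance.pathWeight_nil]
      · have hb : (∃ l ∈ backPaths (r + 1) i j,
              Instance.AssignmentLe x.n (w + x.pathWeight l) x.c) ↔
            ∃ mv < 3, ∃ l ∈ childPaths r i j mv,
              Instance.AssignmentLe x.n (w + x.weight i j + x.pathWeight l) x.c := by
          simp only [mem_backPaths_iff_childPaths hij]
          constructor
          · rintro ⟨-, ⟨mv, hmv, l, hl, rfl⟩, h⟩
            exact ⟨mv, hmv, l, hl, by rwa [add_assoc, ← Instance.pathWeight_cons]⟩
          · rintro ⟨mv, hmv, l, hl, h⟩
            exact ⟨_, ⟨mv, hmv, l, hl, rfl⟩, by rwa [Instance.pathWeight_cons, ← add_assoc]⟩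
        rw [hb]
        have h3 : ∀ p : ℕ → Prop, (∃ mv < 3, p mv) ↔ p 0 ∨ p 1 ∨ p 2 := fun p =>
          ⟨fun ⟨mv, hmv, h⟩ => by interval_cases mv <;> simp [h], by
            rintro (h | h | h) <;> exact ⟨_, by omega, h⟩⟩
        -- Away from `(0, 0)` the node contributes no path of its own, only those of its three
        -- children.
        rw [h3, or_iff_left fun h => hij ⟨h.1, h.2.1⟩, or_assoc, or_assoc]

end search


set_option linter.constructorNameAsVariable false

/-! ### Running time of the complete program -/

namespace Instance

/-- The initial memory. -/
def mem (x : Instance) : Mem where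
  n y := x.init.nreg y.idx
  q y := x.init.qreg y.idx
  na _ _ := 0
  qa _ _ := 0

theorem rep_init (x : Instance) : Rep x.init x.mem := ⟨fun _ => rfl, fun _ => rfl,
  fun _ _ => rfl, fun _ _ => rfl⟩

end Instance

/-- The forms `0 + x.weight _ _` and `0 + 1` fit the hypothesis of `Visits` for an imaginary parent
with zero matrix and empty stack. -/
theorem wp_setup (x : Instance) :
    wp x.tables setup (fun m a => m ≤ layerCostBound x.n + 4 * x.n + 14 ∧
      Node x (0 + x.weight (x.T - 1) (x.U - 1)) (x.T - 1) (x.U - 1) (x.T + x.lam - 1) (0 + 1) 0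
        (fun _ => 3) False a) x.mem := by
  have h₁ : wp x.tables (.ite (.lt .nV .nW) (.nset .N .nW) (.nset .N .nV))
      (fun m a => m ≤ 2 ∧ a = x.mem.setN .N x.n) x.mem := by
    have hV : x.mem.n .nV = x.nV := rfl
    have hW : x.mem.n .nW = x.nW := rfl
    simp only [wp_ite, wp_nset, Cond.holds, NExp.eval_var, hV, hW, Instance.n]
    refine ⟨fun h => ⟨by omega, ?_⟩, fun h => ⟨by omega, ?_⟩⟩
    · rw [max_eq_right h.le]
    · rw [max_eq_left (not_lt.1 h)]
  rw [setup, wp_seq]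
  refine h₁.mono ?_
  rintro m₁ - - ⟨hm₁, rfl⟩
  rw [wp_seq, wp_nset, wp_seq]
  refine wp_for (fun l a => a.n .y = l * x.n ∧ ∀ u < l, a.na .rb u = u * x.n) x.n 2
    (fun a hF => by simp [hF.n .N rfl]) rfl (by simp) ?_ ?_
  · rintro l a hl hF hx ⟨hy, hrb⟩
    have hN : a.n .N = x.n := by simp [hF.n .N rfl]
    simp only [wp_seq, wp_nset, wp_nput, NExp.eval_var, NExp.eval_add, Mem.setN_n, Mem.setN_na,
      Mem.putN_n, Mem.putN_na, reduceCtorEq, if_true, if_false, hN, hx, hy]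
    refine ⟨by omega, by ring, fun u hu => ?_⟩
    rw [Function.update_apply]
    split_ifs with he
    · rw [he]
    · exact hrb u (by omega)
  · rintro m₂ a hF ⟨-, hrb⟩ hm₂
    have hT : a.n .T = x.T := by rw [hF.n .T rfl]; rfl
    have hU : a.n .U = x.U := by rw [hF.n .U rfl]; rfl
    have hlam : a.n .lam = x.lam := by rw [hF.n .lam rfl]; rfl
    have hV : a.n .nV = x.nV := by rw [hF.n .nV rfl]; rfl
    have hW : a.n .nW = x.nW := by rw [hF.n .nW rfl]; rfl
    have hN : a.n .N = x.n := by simp [hF.n .N rfl]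
    have hA : a.qa .A = fun _ => 0 := by rw [hF.qa .A rfl]; rfl
    have hc : a.q .c = x.c := by rw [hF.q .c rfl]; rfl
    simp only [wp_seq, wp_nset, wp_nput, NExp.eval_var, NExp.eval_sub, NExp.eval_add,
      NExp.eval_one, NExp.eval_zero, NExp.eval_three, Mem.setN_n, reduceCtorEq, if_false, hT, hU,
      hlam]
    set b := (((((((a.setN .i (x.T - 1)).setN .j (x.U - 1)).setN .r (x.T + x.lam - 1)).putN .st 0
      3).setN .len 1).setN .mv 0).setN .fl 0) with hb
    have hbA : HasMatrix b x.n 0 :=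
      ⟨by simp [hb, hN], by simpa [hb] using hrb, by simp [hb, hA]⟩
    refine (wp_changeLayer (x := x) (g := (· + ·)) (fun _ _ _ _ => rfl) hbA (by simp [hb, hV])
      (by simp [hb, hW])).mono fun m₃ a₃ hF₃ ⟨hm₃, hA₃⟩ => ?_
    have hbi : b.n .i = x.T - 1 := by simp [hb]
    have hbj : b.n .j = x.U - 1 := by simp [hb]
    rw [hbi, hbj] at hA₃
    refine ⟨by unfold layerCostBound; omega, ⟨hA₃, ?_, ?_, ?_, ?_, ?_, ?_, ?_, ?_, ?_, ?_, ?_⟩⟩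
    · rw [hF₃.n .nV rfl]; simp [hb, hV]
    · rw [hF₃.n .nW rfl]; simp [hb, hW]
    · rw [hF₃.q .c rfl]; simp [hb, hc]
    · rw [hF₃.n .i rfl, hbi]
    · rw [hF₃.n .j rfl, hbj]
    · rw [hF₃.n .r rfl]; simp [hb]
    · rw [hF₃.n .len rfl]; simp [hb]
    · rw [hF₃.n .mv rfl]; simp [hb]
    · intro k hk
      obtain rfl : k = 0 := by omega
      rw [hF₃.na .st rfl]
      simp [hb]
    · rw [hF₃.n .fl rfl]; simp [hb]
    · rw [hF₃.n .fl rfl]; simp [hb]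

theorem wp_decideDtgw (x : Instance) (hUT : x.U ≤ x.T) :
    wp x.tables decideDtgw (fun m a =>
      m ≤ layerCostBound x.n + 4 * x.n + 16 +
        visitBound x.n (x.T + x.lam - 1) (x.T - 1) (x.U - 1) ∧
      (x.IsYes ∧ a.n .T = 1 ∨ ¬ x.IsYes ∧ a.n .T = 0)) x.mem := by
  rw [decideDtgw, wp_seq]
  refine (wp_setup x).mono fun m₁ a₁ _ ⟨hm₁, h₁⟩ => ?_
  obtain ⟨m₂, a₂, hr, hm₂, h₂⟩ := visits x _ _ _ _ _ _ _ _ (by omega) (by omega) h₁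
  rw [wp_seq]
  refine ⟨_, _, hr _ _ (.while_done (by simp [Cond.holds, h₂.len_eq])), ?_⟩
  refine wp_nset.2 ⟨by omega, ?_⟩
  have hf := h₂.flag
  simp only [zero_add, false_or, ← Instance.isYes_iff] at hf
  rw [NExp.eval_var, Mem.setN_n, if_pos rfl, ← hf]
  have := h₂.flag_le
  omega

theorem card_backPaths_pos {x : Instance} (hUT : x.U ≤ x.T) :
    1 ≤ (backPaths (x.T + x.lam - 1) (x.T - 1) (x.U - 1)).card :=
  Finset.card_pos.2 ((backPaths_nonempty_iff _ _ _).2 ⟨by omega, by omega⟩)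

/-- The running time of the main program. -/
theorem exists_exec_decideDtgw (x : Instance) (t : ℕ) (hT : x.T = x.U + t) (hn : 1 ≤ x.n) :
    ∃ m B, Decides decideDtgw.compile x m B ∧
      m ≤ (decideDtgw.compile.cost * 5000) * ((x.T + x.lam) ^ x.lam * x.T ^ (x.lam + t) *
        (x.n ^ 2 * (x.T + x.lam) + x.n ^ 3)) := by
  obtain ⟨m, a, hr, hm, ha⟩ := wp_decideDtgw x (by omega)
  obtain ⟨m', B, s, hs, hm', hrep⟩ := hr.exec_compile _ x.rep_init
  refine ⟨m', B, ⟨s, hs, ?_⟩, hm'.trans ?_⟩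
  -- The variable `.T` occupies register `0`, where the answer is expected.
  · rwa [show s.nreg 0 = a.n .T from hrep.n .T]
  rw [mul_assoc]
  refine Nat.mul_le_mul_left _ (hm.trans ?_)
  have hU := x.H.lifetime_pos
  have hcard := card_backPaths_le x.T x.U t x.lam hU hT
  have hpos := card_backPaths_pos (x := x) (by omega)
  set K := (backPaths (x.T + x.lam - 1) (x.T - 1) (x.U - 1)).card
  set X := (x.T + x.lam) ^ x.lam * x.T ^ (x.lam + t)
  set L := x.T + x.lam with hL
  have hL1 : 1 ≤ L := by omega
  -- The bound equals `24 n^2 + 16 n + 88`, and `n ≥ 1` absorbs the lower terms.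
  have hnode : nodeBound x.n ≤ 128 * x.n ^ 2 := by
    unfold nodeBound layerCostBound
    nlinarith
  have hcube : (x.n + 1) ^ 3 ≤ 8 * x.n ^ 3 := by
    calc (x.n + 1) ^ 3 ≤ (2 * x.n) ^ 3 := Nat.pow_le_pow_left (by omega) 3
      _ = 8 * x.n ^ 3 := by ring
  have hsetup : layerCostBound x.n + 4 * x.n + 16 ≤ nodeBound x.n := by
    unfold nodeBound layerCostBound
    nlinarith
  have hvisit : visitBound x.n (L - 1) (x.T - 1) (x.U - 1) =
      K * (L * nodeBound x.n + 100 * (x.n + 1) ^ 3) := by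
    rw [visitBound, Nat.sub_add_cancel hL1]
  rw [hvisit]
  calc layerCostBound x.n + 4 * x.n + 16 + K * (L * nodeBound x.n + 100 * (x.n + 1) ^ 3)
      ≤ K * (L * nodeBound x.n) + K * (L * nodeBound x.n + 100 * (x.n + 1) ^ 3) := by
        refine Nat.add_le_add_right (hsetup.trans ?_) _
        rw [← mul_assoc]
        exact Nat.le_mul_of_pos_left _ (Nat.mul_pos hpos hL1)
    _ = K * (2 * L * nodeBound x.n + 100 * (x.n + 1) ^ 3) := by ring
    _ ≤ 2 * X * (2 * L * (128 * x.n ^ 2) + 100 * (8 * x.n ^ 3)) := by gcongr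
    -- The actual coefficients are `512` and `1600`.
    _ ≤ 5000 * (X * (x.n ^ 2 * L + x.n ^ 3)) := by
        have h1 : 0 ≤ X * (x.n ^ 2 * L) := Nat.zero_le _
        have h2 : 0 ≤ X * x.n ^ 3 := Nat.zero_le _
        nlinarith

/-! ### Membership in XP -/

/-- A bound polynomial in the size of the instance for every fixed slack and difference of the
lifetimes. -/
theorem le_size_pow {C P lam t n T s m B : ℕ} (hs : 2 ≤ s) (hTs : T ≤ s) (hns : n ≤ s)
    (hm : m ≤ C * ((T + lam) ^ lam * T ^ (lam + t) * (n ^ 2 * (T + lam) + n ^ 3)))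
    (hB : B ≤ m * (5 * (3 * s + lam + P + m + 5))) :
    B ≤ s ^ (2 * (C + (lam + 1) * lam + (lam + t) + lam + 4) + P + lam + 7) := by
  have le_pow : ∀ c, c ≤ s ^ c := fun c =>
    Nat.lt_two_pow_self.le.trans (Nat.pow_le_pow_left hs c)
  have hs1 : 1 ≤ s := by omega
  have hTl : T + lam ≤ s ^ (lam + 1) := by
    have h1 : lam + 1 ≤ 2 ^ lam := Nat.lt_two_pow_self
    have h2 : 2 ^ lam ≤ s ^ lam := Nat.pow_le_pow_left hs lam
    calc T + lam ≤ s * (lam + 1) := by nlinarith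
      _ ≤ s * s ^ lam := Nat.mul_le_mul_left _ (h1.trans h2)
      _ = s ^ (lam + 1) := by ring
  set e := C + (lam + 1) * lam + (lam + t) + lam + 4 with he
  have hme : m ≤ s ^ e := by
    calc m ≤ s ^ C * ((s ^ (lam + 1)) ^ lam * s ^ (lam + t) *
          (s ^ 2 * s ^ (lam + 1) + s ^ 3)) := by
          refine hm.trans ?_
          gcongr
          exact le_pow C
      _ ≤ s ^ C * ((s ^ (lam + 1)) ^ lam * s ^ (lam + t) * s ^ (lam + 4)) := by
          gcongr
          have h1 : s ^ 3 ≤ s ^ 2 * s ^ (lam + 1) := by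
            rw [← pow_add]
            exact Nat.pow_le_pow_right hs1 (by omega)
          have h2 : s ^ (lam + 4) = s ^ 2 * s ^ (lam + 1) * s := by ring
          have h3 := Nat.mul_le_mul_left (s ^ 2 * s ^ (lam + 1)) hs
          omega
      _ = s ^ e := by
          rw [he]
          ring
  have hf : 5 * (3 * s + lam + P + m + 5) ≤ s ^ (e + P + lam + 7) := by
    have le {c k : ℕ} (hk : k ≤ e + P + lam + 1) (hc : c ≤ s ^ k) :
        c ≤ s ^ (e + P + lam + 1) := hc.trans (Nat.pow_le_pow_right hs1 hk)
    have h1 := le (by omega) (pow_one s).ge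
    have h2 := le (by omega) (le_pow lam)
    have h3 := le (by omega) (le_pow P)
    have h4 := le (by omega) hme
    have h5 := le (by omega) (pow_zero s).ge
    -- Each summand is bounded by the same power of `s`; the coefficients add up to `55 ≤ 2 ^ 6`,
    -- and `2 ≤ s`.
    calc 5 * (3 * s + lam + P + m + 5) ≤ s ^ (e + P + lam + 1) * 2 ^ 6 := by omega
      _ ≤ s ^ (e + P + lam + 1) * s ^ 6 := Nat.mul_le_mul_left _ (Nat.pow_le_pow_left hs 6)
      _ = s ^ (e + P + lam + 7) := by ring
  calc B ≤ m * (5 * (3 * s + lam + P + m + 5)) := hB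
    _ ≤ s ^ e * s ^ (e + P + lam + 7) := Nat.mul_le_mul hme hf
    _ = _ := by ring

/-- A base of at least `2` is what allows constants to be absorbed into the exponent, by `c ≤ s ^
c`. -/
theorem Instance.two_le_size (x : Instance) : 2 ≤ x.size := by
  have h1 := x.G.lifetime_pos
  have h2 := x.H.lifetime_pos
  unfold Instance.size
  omega

theorem Instance.lifetime_le_size (x : Instance) : x.T ≤ x.size := by
  unfold Instance.size
  omega

theorem Instance.n_le_size (x : Instance) : x.n ≤ x.size := by
  unfold Instance.size Instance.n
  omega

end DTGW

theorem mainTheorem3 :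
    -- One program decides every instance within the running time, and within XP time.
    (∃ (P : DTGW.Program) (C : ℕ) (f : ℕ → ℕ → ℕ), ∀ (x : DTGW.Instance) (t : ℕ),
      x.T = x.U + t → 1 ≤ x.n →
        ∃ m B : ℕ, DTGW.Decides P x m B ∧
          m ≤ C * ((x.T + x.lam) ^ x.lam * x.T ^ (x.lam + t) *
            (x.n ^ 2 * (x.T + x.lam) + x.n ^ 3)) ∧
          B ≤ x.size ^ f x.lam t) ∧
    -- The number of warping paths of order `T × U`, `T = U + t`, of length at most `T + lam`.
    (∀ T U t lam : ℕ, 1 ≤ U → T = U + t →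
      (DTGW.warpingPaths T U (T + lam)).card =
        ∑ l ∈ Finset.range (lam + 1), (T + l - 1).choose l * (T - 1).choose (l + t)) := by
  set P := DTGW.decideDtgw.compile
  set C := P.cost * 5000
  refine ⟨⟨P, C, fun lam t => 2 * (C + (lam + 1) * lam + (lam + t) + lam + 4) + P.literals + lam + 7,
    fun x t hT hn => ?_⟩, fun T U t lam => DTGW.card_warpingPaths_closed T U t lam⟩
  obtain ⟨m, B, hd, hm⟩ := DTGW.exists_exec_decideDtgw x t hT hn
  obtain ⟨s, hs, -⟩ := id hd
  exact ⟨m, B, hd, hm, DTGW.le_size_pow x.two_le_size x.lifetime_le_size x.n_le_size hm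
    (DTGW.Instance.exec_bits_le x hs)⟩
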